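/- **Conventions.** Let $R$ be a complete regular local ring with maximal ideal $\mathfrak m$, and let $\pi\in\mathfrak m\setminus\mathfrak m^2$. An $(R,\pi)$-local field is a non-archimedean local field $F$ together with a surjective ring homomorphism $R\to O_F$ that maps $\pi$ to a uniformizer. Let $G$ be an affine group scheme over $R$; for an $(R,\pi)$-local field $F$ and $\ell\ge 0$ let $K_\ell(F)\subset G(F)$ be the kernel of $G(O_F)\to G(O_F/\mathfrak m_F^\ell)$, so that $K_0(F)=G(O_F)$. For a cocharacter $\lambda$ of a split torus $T\subset G$ put $\pi^\lambda=\lambda(\pi)\in G(R[\pi^{-1}])$. For a tuple $x\in F^N$ put $\mathrm{val}_F(x)=\min_i \mathrm{val}_F(x_i)$, where $\mathrm{val}_F$ is the normalized valuation. **Definition.** Let $G$ be a smooth affine group scheme over $R$ and $H\subset G$ a smooth closed subgroup scheme (the notion is meant for $G$ split reductive and $H$ reductive, as is the case below). The pair $(G,H)$ is *uniform spherical* if there are a split torus $T\subset G$ over $R$, a closed embedding of the quotient $G/H$ into an affine space $\mathbb A^N_R$, a finite subset $\mathfrak X\subset G(R)/H(R)$ and a subset $\Upsilon\subset X_*(T)$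 such that, with $\pi^\Upsilon\mathfrak X=\{\pi^\lambda x:\lambda\in\Upsilon,\ x\in\mathfrak X\}\subset (G/H)(R[\pi^{-1}])$: 1. for every $(R,\pi)$-local field $F$ the map $x\mapsto K_0(F)x$ from $\pi^\Upsilon\mathfrak X$ to $K_0(F)\backslash G(F)/H(F)$ is onto; 2. for all $x,y\in\pi^\Upsilon\mathfrak X$ the (scheme-theoretic) closure in $G$ of the $R[\pi^{-1}]$-scheme $T_{x,y}=\{g\in G\times_{\mathrm{Spec} R}\mathrm{Spec} R[\pi^{-1}] : gx=y\}$ is smooth over $R$; 3. for every $x\in\pi^\Upsilon\mathfrak X$ the valuation $\mathrm{val}_F(x)$ (in the coordinates of $\mathbb A^N$) does not depend on the $(R,\pi)$-local field $F$; 4. there is $\ell_0$ such that for all $\ell>\ell_0$, all $(R,\pi)$-local fields $F$, all $x\in\mathfrak X$ and all $\alpha\in\Upsilon$ one has $K_\ell(F)\,\pi^\alpha K_\ell(F)\,x=K_\ell(F)\,\pi^\alpha x$ in $G(F)/H(F)$. **Proposition.** Let $R$ and $\pi$ be as above and let $n\ge 0$. Let $\Delta(\mathrm{GL}_n)_R\subset(\mathrm{GL}_{n+1})_R\times(\mathrm{GL}_n)_R$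 be the image of $\mathrm{GL}_n$ under $A\mapsto\left(\begin{pmatrix}1&0\\0&A\end{pmatrix},A\right)$. Then the pair $\big((\mathrm{GL}_{n+1})_R\times(\mathrm{GL}_n)_R,\ \Delta(\mathrm{GL}_n)_R\big)$ is uniform spherical. -/

import Mathlib

open scoped TensorProduct ValuativeRel LaurentPolynomial Pointwise

universe u

noncomputable section

namespace UniformSpherical

/-! ### Points of affine group schemes

An affine group scheme `G = Spec A` over `R` is given by its commutative Hopf algebra `A`. -/

section Points

variable (R : Type u) [CommRing R]

/-- The set `G(S)` of `S`-points of `G = Spec A`, with the convolution product. -/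
def Points (A : Type u) [CommRing A] [HopfAlgebra R A] (S : Type u) [CommRing S] [Algebra R S] :
    Type u :=
  WithConv (A →ₐ[R] S)

variable {R}
variable {A B : Type u} [CommRing A] [HopfAlgebra R A] [CommRing B] [HopfAlgebra R B]
variable {S S' : Type u} [CommRing S] [Algebra R S] [CommRing S'] [Algebra R S']

namespace Points

/-- The `S`-point given by an algebra homomorphism. -/
def of (f : A →ₐ[R] S) : Points R A S := WithConv.toConv f

/-- The algebra homomorphism underlying an `S`-point. -/
def hom (g : Points R A S) : A →ₐ[R] S := WithConv.ofConv g

instance : Monoid (Points R A S) := inferInstanceAs (Monoid (WithConv (A →ₐ[R] S)))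

instance : Inv (Points R A S) where
  inv g := of (g.hom.comp (HopfAlgebra.antipodeAlgHom R A))

instance : Group (Points R A S) where
  inv_mul_cancel g := by
    have h := AlgHom.comp_convMul_distrib g.hom
      (WithConv.toConv (HopfAlgebra.antipodeAlgHom R A)) (WithConv.toConv (AlgHom.id R A))
    rw [AlgHom.antipode_id_cancel] at h
    refine WithConv.ofConv_injective (h.symm.trans ?_)
    ext a
    simp [AlgHom.convOne_def]
    rfl

/-- `G(S) → G(S')` for an `R`-algebra homomorphism `S → S'`. -/
def map (j : S →ₐ[R] S') : Points R A S →* Points R A S' where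
  toFun g := of (j.comp g.hom)
  map_one' := by
    apply WithConv.ofConv_injective
    ext a
    exact j.commutes _
  map_mul' g h := WithConv.ofConv_injective (AlgHom.comp_convMul_distrib j g h)

/-- `H(S) → G(S)` for a homomorphism of group schemes `H → G`, given on coordinate rings by
`φ : A → B`. -/
def comap (φ : A →ₐc[R] B) (S : Type u) [CommRing S] [Algebra R S] :
    Points R B S →* Points R A S where
  toFun h := of (h.hom.comp φ.toAlgHom)
  map_one' := by
    apply WithConv.ofConv_injective
    ext a
    exact congrArg (algebraMap R S) (CoalgHomClass.counit_comp_apply φ a)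
  map_mul' g h := WithConv.ofConv_injective (AlgHom.convMul_comp_bialgHom_distrib g h φ)

end Points

/-- `H(S)` as a subgroup of `G(S)`. -/
def subgroupPoints (φ : A →ₐc[R] B) (S : Type u) [CommRing S] [Algebra R S] :
    Subgroup (Points R A S) :=
  (Points.comap φ S).range

/-- The set `G(S)/H(S)`. -/
abbrev Cosets (φ : A →ₐc[R] B) (S : Type u) [CommRing S] [Algebra R S] : Type u :=
  Points R A S ⧸ subgroupPoints φ S

/-- `G(S)/H(S) → G(S')/H(S')` for an `R`-algebra homomorphism `S → S'`. -/
def Cosets.map (φ : A →ₐc[R] B) (j : S →ₐ[R] S') : Cosets φ S → Cosets φ S' :=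
  Quotient.map' (Points.map j) (by
    intro g g' h
    rw [QuotientGroup.leftRel_apply] at h ⊢
    obtain ⟨b, hb⟩ := h
    refine ⟨Points.map j b, ?_⟩
    rw [← map_inv, ← map_mul, ← hb]
    rfl)

@[simp] lemma Cosets.map_mk (φ : A →ₐc[R] B) (j : S →ₐ[R] S') (g : Points R A S) :
    Cosets.map φ j (g : Cosets φ S) = (Points.map j g : Points R A S') := rfl

/-- The functions `f₁, …, f_N` on `G = Spec A` define a closed embedding of `G/H` into the affine
space `𝔸ᴺ` over `R`: if `C` is the subalgebra they generate, so that `Spec C` is closed in `𝔸ᴺ`,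
then `G → Spec C` is faithfully flat and induces
`G × H ≃ G ×_{Spec C} G`, `(g, h) ↦ (g, gh)`, i.e. `Spec C` is the quotient of `G` by `H` as a
sheaf. The second condition is expressed on points. -/
structure IsAffineEmbedding (φ : A →ₐc[R] B) {N : ℕ} (f : Fin N → A) : Prop where
  faithfullyFlat : Module.FaithfullyFlat (Algebra.adjoin R (Set.range f)) A
  fibers : ∀ (S : Type u) [CommRing S] [Algebra R S] (g g' : Points R A S),
    (∀ i, g.hom (f i) = g'.hom (f i)) ↔ (g : Cosets φ S) = (g' : Cosets φ S)

/-- For `x, y ∈ G(L)/H(L)`, the ideal of `A` of all functions that vanish on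
`T_{x,y} = {g ∈ G_L | g x = y}`. It is the ideal of the (scheme-theoretic) closure of `T_{x,y}`
in `G`. -/
def transporterIdeal (φ : A →ₐc[R] B) {L : Type u} [CommRing L] [Algebra R L]
    (x y : Cosets φ L) : Ideal A where
  carrier := {a | ∀ (S : Type u) [CommRing S] [Algebra R S] (j : L →ₐ[R] S) (g : Points R A S),
    g • Cosets.map φ j x = Cosets.map φ j y → g.hom a = 0}
  zero_mem' := fun S _ _ j g _ => map_zero g.hom
  add_mem' := fun {a b} ha hb S _ _ j g h => by rw [map_add, ha S j g h, hb S j g h, add_zero]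
  smul_mem' := fun c a ha S _ _ j g h => by rw [smul_eq_mul, map_mul, ha S j g h, mul_zero]

end Points

/-! ### Local fields over `(R, π)` -/

/-- An `(R, π)`-local field: a non-archimedean local field `K` with a surjection `R → 𝒪[K]` that
maps `π` to a uniformizer. -/
structure LocalFieldOver (R : Type u) [CommRing R] (π : R) where
  K : Type u
  [field : Field K]
  [valuativeRel : ValuativeRel K]
  [topologicalSpace : TopologicalSpace K]
  [isLocalField : IsNonarchimedeanLocalField K]
  toIntegers : R →+* 𝒪[K]
  surjective : Function.Surjective toIntegers
  irreducible : Irreducible (toIntegers π)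

namespace LocalFieldOver

attribute [instance] field valuativeRel topologicalSpace isLocalField

variable {R : Type u} [CommRing R] {π : R} (F : LocalFieldOver R π)

/-- The ring of integers. -/
abbrev O : Type u := 𝒪[F.K]

instance : Algebra R F.O := F.toIntegers.toAlgebra

instance : Algebra R F.K := ((algebraMap F.O F.K).comp F.toIntegers).toAlgebra

instance : IsScalarTower R F.O F.K := IsScalarTower.of_algebraMap_eq' rfl

/-- The inclusion of the ring of integers. -/
def incl : F.O →ₐ[R] F.K := IsScalarTower.toAlgHom R F.O F.K

lemma isUnit_algebraMap : IsUnit (algebraMap R F.K π) := by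
  have h : algebraMap R F.K π = algebraMap F.O F.K (F.toIntegers π) := rfl
  rw [h, isUnit_iff_ne_zero, Ne, FaithfulSMul.algebraMap_eq_zero_iff]
  exact F.irreducible.ne_zero

/-- The homomorphism `R[π⁻¹] → F`. -/
def ofAway : Localization.Away π →ₐ[R] F.K :=
  IsLocalization.Away.liftAlgHom (f := Algebra.ofId R F.K) π F.isUnit_algebraMap

/-- The valuation of a tuple, `max_i exp (-val_F(x_i))` where `val_F` is the normalized additive
valuation; it is `exp (-min_i val_F(x_i))`. -/
def val {N : ℕ} (x : Fin N → F.K) : WithZero (Multiplicative ℤ) :=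
  Finset.univ.sup fun i => (IsDiscreteValuationRing.maximalIdeal F.O).valuation F.K (x i)

variable (A : Type u) [CommRing A] [HopfAlgebra R A]

/-- `K_ℓ(F)`: the kernel of `G(O_F) → G(O_F/𝔪^ℓ)`, as a subgroup of `G(F)`. In particular
`K_0(F) = G(O_F)`. -/
def congruenceSubgroup (l : ℕ) : Subgroup (Points R A F.K) :=
  (Points.map (A := A) (Ideal.Quotient.mkₐ R
    (IsLocalRing.maximalIdeal F.O ^ l))).ker.map (Points.map F.incl)

end LocalFieldOver

/-! ### Split tori and cocharacters -/

section Torus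

variable (R : Type u) [CommRing R]

/-- The coordinate ring of the split torus `𝔾_m^r` over `R`. -/
abbrev TorusRing (r : ℕ) : Type u := AddMonoidAlgebra R (Fin r → ℤ)

/-- The cocharacters of the split torus `T = 𝔾_m^r`, i.e. the homomorphisms `𝔾_m → T` of group
schemes over `R`. -/
abbrev Cocharacter (r : ℕ) : Type u := TorusRing R r →ₐc[R] R[T;T⁻¹]

variable {R}

/-- `π` as a unit of `R[π⁻¹]`. -/
def awayUnit (π : R) : (Localization.Away π)ˣ :=
  (IsLocalization.Away.algebraMap_isUnit (S := Localization.Away π) π).unit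

/-- The point `π` of `𝔾_m(R[π⁻¹])`. -/
def evalUniformizer (π : R) : R[T;T⁻¹] →ₐ[R] Localization.Away π where
  __ := LaurentPolynomial.eval₂ (algebraMap R (Localization.Away π)) (awayUnit π)
  commutes' r := LaurentPolynomial.eval₂_C (algebraMap R (Localization.Away π)) (awayUnit π) r

variable {A : Type u} [CommRing A] [HopfAlgebra R A]

/-- `π^λ = λ(π) ∈ G(R[π⁻¹])` for a cocharacter `λ` of a torus `T → G`, where `T → G` is given on
coordinate rings by `τ`. -/
def piPow (π : R) {r : ℕ} (τ : A →ₐc[R] TorusRing R r) (c : Cocharacter R r) :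
    Points R A (Localization.Away π) :=
  Points.of ((evalUniformizer π).comp (c.toAlgHom.comp τ.toAlgHom))

end Torus

/-! ### Uniform spherical pairs -/

section Pair

variable {R : Type u} [CommRing R]
variable {A B : Type u} [CommRing A] [HopfAlgebra R A] [CommRing B] [HopfAlgebra R B]

/-- The set `π^Υ 𝔛 ⊆ G(R[π⁻¹])/H(R[π⁻¹])`. -/
def piOrbit (π : R) (φ : A →ₐc[R] B) {r : ℕ} (τ : A →ₐc[R] TorusRing R r)
    (Υ : Set (Cocharacter R r)) (X : Set (Cosets φ R)) : Set (Cosets φ (Localization.Away π)) :=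
  {z | ∃ c ∈ Υ, ∃ x ∈ X,
    z = piPow π τ c • Cosets.map φ (Algebra.ofId R (Localization.Away π)) x}

/-- Let `G = Spec A`, and let `H = Spec B → G` be given by `φ`. The pair `(G, H)` is uniform
spherical over `(R, π)` if `H` is a closed subgroup scheme of `G`, both are smooth over `R`, and
there are a split torus `T = 𝔾_m^r ⊆ G`, an affine embedding `f : G/H → 𝔸ᴺ`, a finite set
`𝔛 ⊆ G(R)/H(R)` and a set `Υ` of cocharacters of `T` with the four properties below. (The notion
is meant for `G` split reductive and `H` reductive.) -/
def IsUniformSpherical (π : R) (φ : A →ₐc[R] B) : Prop :=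
  Function.Surjective φ ∧ Algebra.Smooth R A ∧ Algebra.Smooth R B ∧
  ∃ (r : ℕ) (τ : A →ₐc[R] TorusRing R r) (N : ℕ) (f : Fin N → A) (X : Set (Cosets φ R))
    (Υ : Set (Cocharacter R r)),
    Function.Surjective τ ∧ IsAffineEmbedding φ f ∧ X.Finite ∧
    -- `π^Υ 𝔛 → K_0(F) \ G(F) / H(F)` is onto for every `F`
    (∀ (F : LocalFieldOver R π) (z : Cosets φ F.K), ∃ x ∈ piOrbit π φ τ Υ X,
      z ∈ MulAction.orbit (F.congruenceSubgroup A 0) (Cosets.map φ F.ofAway x)) ∧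
    -- the closure of `T_{x,y}` in `G` is smooth over `R`
    (∀ x ∈ piOrbit π φ τ Υ X, ∀ y ∈ piOrbit π φ τ Υ X,
      Algebra.Smooth R (A ⧸ transporterIdeal φ x y)) ∧
    -- `val_F(x)` does not depend on `F`
    (∀ g : Points R A (Localization.Away π),
      (g : Cosets φ (Localization.Away π)) ∈ piOrbit π φ τ Υ X →
      ∀ F F' : LocalFieldOver R π,
        F.val (fun i => (Points.map F.ofAway g).hom (f i)) =
          F'.val (fun i => (Points.map F'.ofAway g).hom (f i))) ∧
    -- `K_ℓ π^α K_ℓ x = K_ℓ π^α x` for all sufficiently large `ℓ`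
    (∃ l₀ : ℕ, ∀ l > l₀, ∀ (F : LocalFieldOver R π), ∀ x ∈ X, ∀ c ∈ Υ,
      (F.congruenceSubgroup A l : Set (Points R A F.K)) •
          (Points.map F.ofAway (piPow π τ c) •
            ((F.congruenceSubgroup A l : Set (Points R A F.K)) •
              ({Cosets.map φ (Algebra.ofId R F.K) x} : Set (Cosets φ F.K)))) =
        (F.congruenceSubgroup A l : Set (Points R A F.K)) •
          ({Points.map F.ofAway (piPow π τ c) •
            Cosets.map φ (Algebra.ofId R F.K) x} : Set (Cosets φ F.K)))

end Pair

/-! ### The group scheme `GL_n` -/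

section GeneralLinear

open Matrix

/-- The coordinate ring `R[x_ij][1/det]` of `GL_n`. -/
def GLRing (n : ℕ) (R : Type u) [CommRing R] : Type u :=
  Localization.Away (det (mvPolynomialX (Fin n) (Fin n) R))

variable (n : ℕ) (R : Type u) [CommRing R]

instance : CommRing (GLRing n R) :=
  inferInstanceAs (CommRing (Localization.Away (det (mvPolynomialX (Fin n) (Fin n) R))))

instance : Algebra R (GLRing n R) :=
  inferInstanceAs (Algebra R (Localization.Away (det (mvPolynomialX (Fin n) (Fin n) R))))

instance : Algebra (MvPolynomial (Fin n × Fin n) R) (GLRing n R) :=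
  inferInstanceAs (Algebra (MvPolynomial (Fin n × Fin n) R)
    (Localization.Away (det (mvPolynomialX (Fin n) (Fin n) R))))

instance : IsScalarTower R (MvPolynomial (Fin n × Fin n) R) (GLRing n R) :=
  inferInstanceAs (IsScalarTower R (MvPolynomial (Fin n × Fin n) R)
    (Localization.Away (det (mvPolynomialX (Fin n) (Fin n) R))))

instance : IsLocalization.Away (det (mvPolynomialX (Fin n) (Fin n) R)) (GLRing n R) :=
  inferInstanceAs (IsLocalization.Away (det (mvPolynomialX (Fin n) (Fin n) R))
    (Localization.Away (det (mvPolynomialX (Fin n) (Fin n) R))))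

namespace GLRing

lemma isUnit_det : IsUnit (det ((mvPolynomialX (Fin n) (Fin n) R).map
    (algebraMap (MvPolynomial (Fin n × Fin n) R) (GLRing n R)))) := by
  have h := IsLocalization.Away.algebraMap_isUnit (S := GLRing n R)
    (det (mvPolynomialX (Fin n) (Fin n) R))
  rwa [RingHom.map_det] at h

/-- The universal invertible matrix `(x_ij)`. -/
def gen : GL (Fin n) (GLRing n R) := nonsingInvUnit _ (isUnit_det n R)

variable {n R}
variable {S S' : Type u} [CommRing S] [Algebra R S] [CommRing S'] [Algebra R S']

/-- The matrix of a point of `GL_n`. -/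
def toGL (f : GLRing n R →ₐ[R] S) : GL (Fin n) S :=
  GeneralLinearGroup.map (f : GLRing n R →+* S) (gen n R)

/-- The homomorphism `x_ij ↦ g_ij` for an invertible matrix `g`. -/
def lift (g : GL (Fin n) S) : GLRing n R →ₐ[R] S :=
  IsLocalization.Away.liftAlgHom (f := MvPolynomial.aeval fun p : Fin n × Fin n => g.1 p.1 p.2)
    (det (mvPolynomialX (Fin n) (Fin n) R)) (by
      have h : MvPolynomial.aeval (fun p : Fin n × Fin n => g.1 p.1 p.2)
          (det (mvPolynomialX (Fin n) (Fin n) R)) = det g.1 := by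
        rw [AlgHom.map_det]
        congr 1
        ext i j
        simp
      rw [h]
      exact (isUnit_iff_isUnit_det _).1 g.isUnit)

@[simp] lemma gen_apply (i j : Fin n) : (gen n R).1 i j =
    algebraMap (MvPolynomial (Fin n × Fin n) R) (GLRing n R) (MvPolynomial.X (i, j)) := rfl

@[simp] lemma toGL_lift (g : GL (Fin n) S) : toGL (lift (R := R) g) = g := by
  ext i j
  simp [toGL, lift]

lemma toGL_injective : Function.Injective (toGL : (GLRing n R →ₐ[R] S) → GL (Fin n) S) := by
  intro f f' h
  apply IsLocalization.algHom_ext (Submonoid.powers (det (mvPolynomialX (Fin n) (Fin n) R)))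
  ext ⟨i, j⟩
  exact congrFun (congrFun (congrArg (fun g : GL (Fin n) S => g.1) h) i) j

lemma toGL_comp (j : S →ₐ[R] S') (f : GLRing n R →ₐ[R] S) :
    toGL (j.comp f) = GeneralLinearGroup.map (j : S →+* S') (toGL f) := rfl

lemma lift_gen : lift (gen n R) = AlgHom.id R (GLRing n R) :=
  toGL_injective (by rw [toGL_lift]; rfl)

lemma comp_lift (j : S →ₐ[R] S') (g : GL (Fin n) S) :
    j.comp (lift g) = lift (R := R) (GeneralLinearGroup.map (j : S →+* S') g) :=
  toGL_injective (by rw [toGL_comp, toGL_lift, toGL_lift])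

variable (n R)

/-- The comultiplication, `x_ij ↦ ∑ₖ x_ik ⊗ x_kj`. -/
def comulHom : GLRing n R →ₐ[R] GLRing n R ⊗[R] GLRing n R :=
  lift (toGL Algebra.TensorProduct.includeLeft * toGL Algebra.TensorProduct.includeRight)

/-- The counit, `x_ij ↦ δ_ij`. -/
def counitHom : GLRing n R →ₐ[R] R := lift 1

/-- The antipode, `x ↦ x⁻¹`. -/
def antipodeHom : GLRing n R →ₐ[R] GLRing n R := lift (gen n R)⁻¹

lemma toGL_comp_comulHom (f : GLRing n R ⊗[R] GLRing n R →ₐ[R] S) :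
    toGL (f.comp (comulHom n R)) =
      toGL (f.comp Algebra.TensorProduct.includeLeft) *
        toGL (f.comp Algebra.TensorProduct.includeRight) := by
  rw [toGL_comp, comulHom, toGL_lift, map_mul]
  rfl

lemma toGL_comp_counitHom (f : R →ₐ[R] S) : toGL (f.comp (counitHom n R)) = 1 := by
  rw [toGL_comp, counitHom, toGL_lift, map_one]

lemma toGL_comp_antipodeHom (f : GLRing n R →ₐ[R] S) :
    toGL (f.comp (antipodeHom n R)) = (toGL f)⁻¹ := by
  rw [toGL_comp, antipodeHom, toGL_lift, map_inv]
  rfl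

instance : Bialgebra R (GLRing n R) :=
  Bialgebra.ofAlgHom (comulHom n R) (counitHom n R)
    (by
      apply toGL_injective
      have h1 : ((Algebra.TensorProduct.assoc R R R (GLRing n R) (GLRing n R)
          (GLRing n R)).toAlgHom.comp (Algebra.TensorProduct.map (comulHom n R)
            (AlgHom.id R (GLRing n R)))).comp Algebra.TensorProduct.includeLeft =
          ((Algebra.TensorProduct.assoc R R R (GLRing n R) (GLRing n R)
            (GLRing n R)).toAlgHom.comp Algebra.TensorProduct.includeLeft).comp
              (comulHom n R) := by
        ext a; simp
      have h2 : (Algebra.TensorProduct.map (AlgHom.id R (GLRing n R)) (comulHom n R)).comp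
          Algebra.TensorProduct.includeRight =
          (Algebra.TensorProduct.includeRight (R := R) (A := GLRing n R)
            (B := GLRing n R ⊗[R] GLRing n R)).comp (comulHom n R) := by
        ext a; simp
      rw [← AlgHom.comp_assoc, toGL_comp_comulHom, toGL_comp_comulHom, h1, h2,
        toGL_comp_comulHom, toGL_comp_comulHom, mul_assoc]
      refine congrArg₂ _ (congrArg toGL ?_) (congrArg₂ _ (congrArg toGL ?_) (congrArg toGL ?_)) <;>
        (ext a; simp [Algebra.TensorProduct.one_def]))
    (by
      apply toGL_injective
      have h1 : (Algebra.TensorProduct.map (counitHom n R) (AlgHom.id R (GLRing n R))).comp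
          Algebra.TensorProduct.includeLeft =
          (Algebra.TensorProduct.includeLeft (R := R) (S := R) (A := R)
            (B := GLRing n R)).comp (counitHom n R) := by
        ext a; simp
      rw [toGL_comp_comulHom, h1, toGL_comp_counitHom, one_mul]
      refine congrArg toGL ?_
      ext a; simp)
    (by
      apply toGL_injective
      have h1 : (Algebra.TensorProduct.map (AlgHom.id R (GLRing n R)) (counitHom n R)).comp
          Algebra.TensorProduct.includeRight =
          (Algebra.TensorProduct.includeRight (R := R) (A := GLRing n R)
            (B := R)).comp (counitHom n R) := by
        ext a; simp
      rw [toGL_comp_comulHom, h1, toGL_comp_counitHom, mul_one]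
      refine congrArg toGL ?_
      ext a; simp)

lemma comulAlgHom_eq : Bialgebra.comulAlgHom R (GLRing n R) = comulHom n R := rfl

lemma counitAlgHom_eq : Bialgebra.counitAlgHom R (GLRing n R) = counitHom n R := rfl

instance : HopfAlgebra R (GLRing n R) where
  antipode := (antipodeHom n R).toLinearMap
  mul_antipode_rTensor_comul := by
    have h : ((Algebra.TensorProduct.lmul' R).comp (Algebra.TensorProduct.map (antipodeHom n R)
        (AlgHom.id R (GLRing n R)))).comp (comulHom n R) =
        (Algebra.ofId R (GLRing n R)).comp (counitHom n R) := by
      apply toGL_injective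
      rw [toGL_comp_comulHom, toGL_comp_counitHom, ← inv_mul_cancel (gen n R)]
      refine congrArg₂ _ ?_ ?_
      · rw [← toGL_lift (R := R) (gen n R)⁻¹]
        refine congrArg toGL ?_
        ext a; simp [antipodeHom]
      · rw [← toGL_lift (R := R) (gen n R), lift_gen]
        refine congrArg toGL ?_
        ext a; simp
    exact congrArg AlgHom.toLinearMap h
  mul_antipode_lTensor_comul := by
    have h : ((Algebra.TensorProduct.lmul' R).comp (Algebra.TensorProduct.map
        (AlgHom.id R (GLRing n R)) (antipodeHom n R))).comp (comulHom n R) =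
        (Algebra.ofId R (GLRing n R)).comp (counitHom n R) := by
      apply toGL_injective
      rw [toGL_comp_comulHom, toGL_comp_counitHom, ← mul_inv_cancel (gen n R)]
      refine congrArg₂ _ ?_ ?_
      · rw [← toGL_lift (R := R) (gen n R), lift_gen]
        refine congrArg toGL ?_
        ext a; simp
      · rw [← toGL_lift (R := R) (gen n R)⁻¹]
        refine congrArg toGL ?_
        ext a; simp [antipodeHom]
    exact congrArg AlgHom.toLinearMap h

end GLRing

/-- The homomorphism `M ↦ (1, 0; 0, M)` from `n × n` to `(n + 1) × (n + 1)` matrices. -/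
def iotaMatrix (n : ℕ) (S : Type u) [CommRing S] :
    Matrix (Fin n) (Fin n) S →* Matrix (Fin (n + 1)) (Fin (n + 1)) S where
  toFun M := Matrix.of (Fin.cons (Fin.cons 1 0) fun i => Fin.cons 0 (M i))
  map_one' := by
    ext i j
    refine Fin.cases ?_ (fun i => ?_) i <;> refine Fin.cases ?_ (fun j => ?_) j <;>
      simp [Matrix.one_apply, Fin.succ_ne_zero, (Fin.succ_ne_zero _).symm]
  map_mul' M N := by
    ext i j
    refine Fin.cases ?_ (fun i => ?_) i <;> refine Fin.cases ?_ (fun j => ?_) j <;>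
      simp [Matrix.mul_apply, Fin.sum_univ_succ]

/-- The embedding `ι : GL_n(S) → GL_{n+1}(S)`. -/
def iota (n : ℕ) (S : Type u) [CommRing S] : GL (Fin n) S →* GL (Fin (n + 1)) S :=
  Units.map (iotaMatrix n S)

lemma map_iota (n : ℕ) {S S' : Type u} [CommRing S] [CommRing S'] (j : S →+* S')
    (g : GL (Fin n) S) :
    GeneralLinearGroup.map j (iota n S g) = iota n S' (GeneralLinearGroup.map j g) := by
  ext i k
  refine Fin.cases ?_ (fun i => ?_) i <;> refine Fin.cases ?_ (fun k => ?_) k <;>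
    simp [iota, iotaMatrix]

open GLRing

lemma comulAlgHom_comp_includeLeft {R A B : Type u} [CommRing R] [CommRing A] [CommRing B]
    [Bialgebra R A] [Bialgebra R B] :
    (Bialgebra.comulAlgHom R (A ⊗[R] B)).comp Algebra.TensorProduct.includeLeft =
      (Algebra.TensorProduct.map Algebra.TensorProduct.includeLeft
        Algebra.TensorProduct.includeLeft).comp (Bialgebra.comulAlgHom R A) := by
  have h : (Algebra.TensorProduct.tensorTensorTensorComm R R R R A A B B).toAlgHom.comp
      Algebra.TensorProduct.includeLeft =
      Algebra.TensorProduct.map (Algebra.TensorProduct.includeLeft (R := R) (S := R) (A := A)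
        (B := B)) (Algebra.TensorProduct.includeLeft (R := R) (S := R) (A := A) (B := B)) := by
    ext a <;> simp [Algebra.TensorProduct.one_def]
  rw [← h, Bialgebra.TensorProduct.comulAlgHom_def]
  ext a
  simp

lemma comulAlgHom_comp_includeRight {R A B : Type u} [CommRing R] [CommRing A] [CommRing B]
    [Bialgebra R A] [Bialgebra R B] :
    (Bialgebra.comulAlgHom R (A ⊗[R] B)).comp Algebra.TensorProduct.includeRight =
      (Algebra.TensorProduct.map Algebra.TensorProduct.includeRight
        Algebra.TensorProduct.includeRight).comp (Bialgebra.comulAlgHom R B) := by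
  have h : (Algebra.TensorProduct.tensorTensorTensorComm R R R R A A B B).toAlgHom.comp
      Algebra.TensorProduct.includeRight =
      Algebra.TensorProduct.map (Algebra.TensorProduct.includeRight (R := R) (A := A)
        (B := B)) (Algebra.TensorProduct.includeRight (R := R) (A := A) (B := B)) := by
    ext a <;> simp [Algebra.TensorProduct.one_def]
  rw [← h, Bialgebra.TensorProduct.comulAlgHom_def]
  ext a
  simp

/-- The homomorphism `ι : GL_n → GL_{n+1}` on coordinate rings. -/
def iotaHom (n : ℕ) (R : Type u) [CommRing R] : GLRing (n + 1) R →ₐ[R] GLRing n R :=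
  lift (iota n _ (gen n R))

lemma toGL_comp_iotaHom (n : ℕ) {R S : Type u} [CommRing R] [CommRing S] [Algebra R S]
    (f : GLRing n R →ₐ[R] S) : toGL (f.comp (iotaHom n R)) = iota n S (toGL f) := by
  rw [toGL_comp, iotaHom, toGL_lift, map_iota]
  rfl

/-- The diagonal embedding `Δ = (ι, id) : GL_n → GL_{n+1} × GL_n` on coordinate rings. -/
def diag (n : ℕ) (R : Type u) [CommRing R] :
    GLRing (n + 1) R ⊗[R] GLRing n R →ₐc[R] GLRing n R :=
  BialgHom.ofAlgHom
    (Algebra.TensorProduct.lift (iotaHom n R) (AlgHom.id R _) fun _ _ => Commute.all _ _)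
    (by
      apply Algebra.TensorProduct.ext
      · have h : (Bialgebra.counitAlgHom R (GLRing (n + 1) R ⊗[R] GLRing n R)).comp
            Algebra.TensorProduct.includeLeft = counitHom (n + 1) R := by
          ext a
          simp
          rfl
        apply toGL_injective
        rw [h, AlgHom.comp_assoc, Algebra.TensorProduct.lift_comp_includeLeft,
          toGL_comp_iotaHom, counitAlgHom_eq, counitHom, toGL_lift, counitHom, toGL_lift, map_one]
      · ext a
        simp)
    (by
      apply Algebra.TensorProduct.ext
      · apply toGL_injective
        rw [AlgHom.comp_assoc, comulAlgHom_comp_includeLeft, ← AlgHom.comp_assoc,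
          ← Algebra.TensorProduct.map_comp, Algebra.TensorProduct.lift_comp_includeLeft,
          AlgHom.comp_assoc, Algebra.TensorProduct.lift_comp_includeLeft, comulAlgHom_eq,
          comulAlgHom_eq, toGL_comp_comulHom, toGL_comp_iotaHom, comulHom, toGL_lift, map_mul,
          Algebra.TensorProduct.map_comp_includeLeft, Algebra.TensorProduct.map_comp_includeRight,
          toGL_comp_iotaHom, toGL_comp_iotaHom]
      · have h : (Algebra.TensorProduct.lift (iotaHom n R) (AlgHom.id R (GLRing n R))
            fun _ _ => Commute.all _ _).comp Algebra.TensorProduct.includeRight =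
            AlgHom.id R (GLRing n R) := by
          ext a; simp
        have h1 := comulAlgHom_comp_includeRight (R := R) (A := GLRing (n + 1) R)
          (B := GLRing n R)
        have h2 {C D : Type u} [CommRing C] [CommRing D] [Algebra R C] [Algebra R D]
            (q : C →ₐ[R] D) : q.restrictScalars R = q := rfl
        rw [h2, h2, AlgHom.comp_assoc, h1, ← AlgHom.comp_assoc, ← Algebra.TensorProduct.map_comp,
          AlgHom.comp_assoc, h, Algebra.TensorProduct.map_id, AlgHom.id_comp, AlgHom.comp_id])

end GeneralLinear

end UniformSpherical

end

/-! The map (g₁, g₂) ↦ g₁ ι(g₂)⁻¹ (`Points.mu`) identifies G/H with GL_{n+1}, on which G acts by x ↦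
g₁ x ι(g₂)⁻¹; matrix entries and inverse determinant embed it in affine space
(`isAffineEmbedding_embedding`). One base point suffices for 𝔛: the unipotent matrix u with first
column all ones. Its translates by the diagonal torus are the matrices (ϖ^b, 0; ϖ^c, diag ϖ^(c+d))
(`repGL`), and Υ consists of the exponents with c and d monotone and c ≤ b.

Orbits: over a discrete valuation ring, row operations bring the first row to (p, 0), Smith's normal
form makes the lower right block diagonal, and further operations preserving that shape replace the
first column by powers of ϖ with the required inequalities (`exists_sameOrbit_diagonal`,
`sameOrbit_repGL`).

Valuations: every coordinate of a representative is 0 or a power of π, so its valuation is the same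
in all fields.

Contraction: an element K ≡ 1 modulo 𝔪^ℓ with ℓ > 0 satisfies K u = P u ι(Q), with P and Q congruent
to 1 and in triangular subgroups which conjugation by π^α contracts
(`exists_lower_mul_unipGL_mul_upper`, `exists_conj_diagGL`). Hence ℓ₀ = 0 works.

Smoothness: a transporter is cut out by explicit equations (`mul_repGL_eq_iff`). Either they force
π⁻¹ to be a function on the closure, which is then GL_n over R[π⁻¹] (`smooth_of_ne`,
`smooth_of_lt`), or each row of the equations can be solved for one unknown with coefficients in R,
and the closure is a principal open subscheme of an affine space (`smooth_of_forall_not_lt`). The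
second case needs π to be a nonzerodivisor on polynomial rings, which follows from R being a domain
(`isDomain_of_isRegularLocalRing`). -/

noncomputable section

namespace UniformSpherical

/-! ### Regular local rings are domains -/

section RegularDomain
open IsLocalRing

/-- If `x ∈ 𝔪 ∖ 𝔪²`, then `R ⧸ (x)` is regular local of smaller embedding dimension. -/
lemma isRegularLocalRing_quotient_span_singleton {R : Type u} [CommRing R] [IsRegularLocalRing R]
    {x : R} (hx : x ∈ maximalIdeal R) (hx' : x ∉ maximalIdeal R ^ 2) :
    IsRegularLocalRing (R ⧸ Ideal.span {x}) ∧ ∀ _ : IsLocalRing (R ⧸ Ideal.span {x}),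
      (maximalIdeal (R ⧸ Ideal.span {x})).spanFinrank + 1 = (maximalIdeal R).spanFinrank := by
  classical
  have hnt : Nontrivial (R ⧸ Ideal.span {x}) := by
    rw [Ideal.Quotient.nontrivial_iff]
    exact fun h => (Ideal.ne_top_iff_one _).1 (maximalIdeal.isMaximal R).ne_top
      ((Ideal.span_singleton_le_iff_mem _).2 hx (h ▸ Submodule.mem_top))
  have hloc : IsLocalRing (R ⧸ Ideal.span {x}) :=
    IsLocalRing.of_surjective' _ Ideal.Quotient.mk_surjective
  have hfg := (maximalIdeal R).fg_of_isNoetherianRing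
  have hfin := Submodule.FG.finite_generators hfg
  obtain ⟨G, hG⟩ := hfin.exists_finset_coe
  have hspan : Ideal.span (G : Set R) = maximalIdeal R := by
    rw [hG]; exact (maximalIdeal R).span_generators
  have hcard : G.card = (maximalIdeal R).spanFinrank := by
    rw [← Submodule.FG.generators_ncard hfg, ← hG, Set.ncard_coe_finset]
  have hx1 : x ∈ Ideal.span (G : Set R) := hspan ▸ hx
  obtain ⟨a, -, ha⟩ := Submodule.mem_span_finset.1 hx1
  have hGm : ∀ g ∈ G, g ∈ maximalIdeal R := fun g hg => hspan ▸ Ideal.subset_span hg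
  -- If all coefficients were in 𝔪, then x would lie in 𝔪². The generator g with unit coefficient
  -- becomes redundant modulo x, so the embedding dimension drops by at least one.
  obtain ⟨g, hg, hag⟩ : ∃ g ∈ G, IsUnit (a g) := by
    by_contra! h
    apply hx'
    rw [← ha, pow_two]
    exact Ideal.sum_mem _ fun g hg => Ideal.mul_mem_mul ((mem_maximalIdeal _).2 (h g hg)) (hGm g hg)
  have hmap : maximalIdeal (R ⧸ Ideal.span {x}) =
      (maximalIdeal R).map (Ideal.Quotient.mk (Ideal.span {x})) :=
    (map_maximalIdeal_of_surjective _ Ideal.Quotient.mk_surjective).symm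
  have hle : (maximalIdeal (R ⧸ Ideal.span {x})).spanFinrank + 1 ≤
      (maximalIdeal R).spanFinrank := by
    have h1 : maximalIdeal (R ⧸ Ideal.span {x}) =
        Ideal.span (((G.erase g).image (Ideal.Quotient.mk (Ideal.span {x})) : Finset _) :
          Set (R ⧸ Ideal.span {x})) := by
      apply le_antisymm
      · rw [hmap, ← hspan, Ideal.map_span, Ideal.span_le]
        rintro _ ⟨y, hy, rfl⟩
        have h3 : ∀ y ∈ G.erase g, Ideal.Quotient.mk (Ideal.span {x}) y ∈
            Ideal.span (((G.erase g).image (Ideal.Quotient.mk (Ideal.span {x})) : Finset _) :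
              Set (R ⧸ Ideal.span {x})) := fun y hy =>
          Ideal.subset_span (Finset.mem_coe.2 (Finset.mem_image_of_mem _ hy))
        by_cases hyg : y = g
        · subst hyg
          have h2 : Ideal.Quotient.mk (Ideal.span {x}) x = 0 :=
            Ideal.Quotient.eq_zero_iff_mem.2 (Ideal.mem_span_singleton_self x)
          have h5 : Ideal.Quotient.mk (Ideal.span {x}) (∑ z ∈ G, a z • z) = 0 :=
            (congrArg _ ha).trans h2
          rw [← Finset.add_sum_erase _ _ hg, map_add, smul_eq_mul, map_mul,
            add_eq_zero_iff_eq_neg] at h5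
          have h4 : Ideal.Quotient.mk (Ideal.span {x}) (a y) * Ideal.Quotient.mk (Ideal.span {x}) y
              ∈ Ideal.span (((G.erase y).image (Ideal.Quotient.mk (Ideal.span {x})) : Finset _) :
                Set (R ⧸ Ideal.span {x})) := by
            rw [h5, map_sum]
            refine Submodule.neg_mem _ (Ideal.sum_mem _ fun z hz => ?_)
            rw [smul_eq_mul, map_mul]
            exact Ideal.mul_mem_left _ _ (h3 z hz)
          exact (Ideal.unit_mul_mem_iff_mem _ (hag.map _)).1 h4
        · exact h3 y (Finset.mem_erase.2 ⟨hyg, hy⟩)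
      · rw [Ideal.span_le]
        intro z hz
        obtain ⟨y, hy, rfl⟩ := Finset.mem_image.1 (Finset.mem_coe.1 hz)
        rw [hmap]
        exact Ideal.mem_map_of_mem _ (hGm y (Finset.mem_of_mem_erase hy))
    have h2 : (maximalIdeal (R ⧸ Ideal.span {x})).spanFinrank ≤ (G.erase g).card := by
      rw [h1]
      refine (Submodule.spanFinrank_span_le_ncard_of_finite (Finset.finite_toSet _)).trans ?_
      rw [Set.ncard_coe_finset]
      exact Finset.card_image_le
    rw [Finset.card_erase_of_mem hg] at h2
    have := Finset.card_pos.2 ⟨g, hg⟩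
    omega
  -- The dimension drops by at most one, and embedding dimension bounds dimension from above;
  -- together these force equality everywhere.
  have hdim : ringKrullDim R ≤ ringKrullDim (R ⧸ Ideal.span {x}) + 1 := by
    have := ringKrullDim_le_ringKrullDim_quotient_add_card ({x} : Finset R) (by
      simpa [IsLocalRing.ringJacobson_eq_maximalIdeal] using hx)
    rwa [Finset.coe_singleton, Finset.card_singleton, Nat.cast_one] at this
  have hd := (isRegularLocalRing_iff R).1 ‹_›
  have hd' := ringKrullDim_le_spanFinrank_maximalIdeal (R ⧸ Ideal.span {x})
  rw [← hd] at hdim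
  have hge : (maximalIdeal R).spanFinrank ≤
      (maximalIdeal (R ⧸ Ideal.span {x})).spanFinrank + 1 := by
    have := hdim.trans (add_le_add_left hd' 1)
    exact_mod_cast this
  refine ⟨?_, fun _ => le_antisymm hle hge⟩
  apply IsRegularLocalRing.of_spanFinrank_maximalIdeal_le
  have h5 := ((Nat.cast_le (α := WithBot ℕ∞)).2 hle).trans hdim
  revert h5 hd'
  generalize ringKrullDim (R ⧸ Ideal.span {x}) = D
  intro hd' h5
  -- Cancelling the 1 in `WithBot ℕ∞` requires the dimension to be an honest natural number.
  obtain ⟨m, rfl⟩ : ∃ m : ℕ, D = m := by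
    induction D with
    | bot =>
      rw [WithBot.bot_add] at h5
      exact absurd h5 (by simp)
    | coe D =>
      refine ⟨D.toNat, ?_⟩
      have h6 : D ≠ ⊤ := by
        rintro rfl
        exact absurd hd' (by
          rw [not_le]
          exact WithBot.coe_lt_coe.2 (ENat.natCast_lt_top _))
      exact congrArg _ (ENat.natCast_toNat h6).symm
  norm_cast at h5 ⊢
  omega

/-- A regular local ring is a domain. -/
theorem isDomain_of_isRegularLocalRing_aux (k : ℕ) : ∀ (R : Type u) [CommRing R]
    [IsRegularLocalRing R], (maximalIdeal R).spanFinrank = k → IsDomain R := by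
  induction k with
  | zero =>
    intro R _ _ h
    rw [Submodule.spanFinrank_eq_zero_iff_eq_bot (maximalIdeal R).fg_of_isNoetherianRing] at h
    exact (IsLocalRing.isField_iff_maximalIdeal_eq.2 h).isDomain
  | succ k ih =>
    intro R _ _ h
    have hd := (isRegularLocalRing_iff R).1 ‹_›
    have hfin := Ideal.finite_minimalPrimes_of_isNoetherianRing R ⊥
    -- Prime avoidance, with 𝔪² as the one permitted non-prime ideal: 𝔪 ⊆ 𝔪² would give 𝔪 = 0 by
    -- Nakayama, and 𝔪 inside a minimal prime would give dimension 0.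
    have hnot : ¬ ((maximalIdeal R : Set R) ⊆
        ⋃ I ∈ ((insert (maximalIdeal R ^ 2) hfin.toFinset : Finset (Ideal R)) :
          Set (Ideal R)), (I : Set R)) := by
      rw [Ideal.subset_union_prime (f := fun I : Ideal R => I) (maximalIdeal R ^ 2)
        (maximalIdeal R ^ 2)]
      · rintro ⟨I, hI, hle⟩
        rcases Finset.mem_insert.1 hI with rfl | hI
        · have h0 : maximalIdeal R = ⊥ :=
            Submodule.eq_bot_of_le_smul_of_le_jacobson_bot (maximalIdeal R) _
              (maximalIdeal R).fg_of_isNoetherianRing (by rwa [pow_two] at hle)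
              (IsLocalRing.maximalIdeal_le_jacobson ⊥)
          rw [← Submodule.spanFinrank_eq_zero_iff_eq_bot
            (maximalIdeal R).fg_of_isNoetherianRing] at h0
          omega
        · have hI' := hfin.mem_toFinset.1 hI
          have hp := hI'.1.1
          have hIe : I = maximalIdeal R := le_antisymm (le_maximalIdeal hp.ne_top) hle
          have h0 : I.height = 0 := Ideal.height_eq_zero_iff.2 hI'
          have h1 := maximalIdeal_height_eq_ringKrullDim (R := R)
          rw [← hIe, h0, ← hd, h] at h1
          norm_cast at h1
      · intro I hI hne _
        rcases Finset.mem_insert.1 hI with rfl | hI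
        · exact absurd rfl hne
        · exact (hfin.mem_toFinset.1 hI).1.1
    obtain ⟨x, hx, hxn⟩ := Set.not_subset.1 hnot
    have hxn' : ∀ I ∈ insert (maximalIdeal R ^ 2) hfin.toFinset, x ∉ I := fun I hI hxI =>
      hxn (Set.mem_biUnion (Finset.mem_coe.2 hI) hxI)
    obtain ⟨hreg, hrank⟩ := isRegularLocalRing_quotient_span_singleton hx
      (hxn' _ (Finset.mem_insert_self _ _))
    have hdom := ih (R ⧸ Ideal.span {x}) (by have := hrank inferInstance; omega)
    have hprime : (Ideal.span {x}).IsPrime := (Ideal.Quotient.isDomain_iff_prime _).1 hdom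
    obtain ⟨q, hq, hqx⟩ := Ideal.exists_minimalPrimes_le (bot_le (a := Ideal.span {x}))
    have hxq : x ∉ q := hxn' q (Finset.mem_insert_of_mem (hfin.mem_toFinset.2 hq))
    have hqp := hq.1.1
    -- Since q ⊆ (x) with q prime and x ∉ q, every element of q is x times an element of q. So q ⊆
    -- 𝔪q, and Nakayama applies.
    have hq0 : q = ⊥ := by
      refine Submodule.eq_bot_of_le_smul_of_le_jacobson_bot (maximalIdeal R) q
        q.fg_of_isNoetherianRing ?_ (IsLocalRing.maximalIdeal_le_jacobson ⊥)
      intro y hy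
      obtain ⟨a, rfl⟩ := Ideal.mem_span_singleton'.1 (hqx hy)
      rw [mul_comm]
      exact Submodule.smul_mem_smul hx ((hqp.mem_or_mem hy).resolve_right hxq)
    rw [hq0] at hqp
    exact IsDomain.of_bot_isPrime R

theorem isDomain_of_isRegularLocalRing (R : Type u) [CommRing R] [IsRegularLocalRing R] :
    IsDomain R :=
  isDomain_of_isRegularLocalRing_aux _ R rfl

end RegularDomain

/-! ### Points of GL_{n+1} × GL_n as pairs of matrices -/

section PairPoints
open Matrix GLRing

/-- The coordinate ring of `GL_{n+1} × GL_n`. -/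
abbrev PairRing (n : ℕ) (R : Type u) [CommRing R] : Type u := GLRing (n + 1) R ⊗[R] GLRing n R

variable {n : ℕ} {R : Type u} [CommRing R]
variable {S S' : Type u} [CommRing S] [Algebra R S] [CommRing S'] [Algebra R S']

namespace Points

/-- The homomorphism `GL_n(S) → GL_n(S')` induced by an algebra homomorphism. -/
abbrev mapGL {m : ℕ} (j : S →ₐ[R] S') : GL (Fin m) S →* GL (Fin m) S' :=
  GeneralLinearGroup.map (j : S →+* S')

/-- The first component of a point of `GL_{n+1} × GL_n`. -/
def fst (g : Points R (PairRing n R) S) : GL (Fin (n + 1)) S :=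
  toGL (g.hom.comp Algebra.TensorProduct.includeLeft)

/-- The second component of a point of `GL_{n+1} × GL_n`. -/
def snd (g : Points R (PairRing n R) S) : GL (Fin n) S :=
  toGL (g.hom.comp Algebra.TensorProduct.includeRight)

/-- The point of `GL_{n+1} × GL_n` with given components. -/
def pair (a : GL (Fin (n + 1)) S) (b : GL (Fin n) S) : Points R (PairRing n R) S :=
  of (Algebra.TensorProduct.lift (lift a) (lift b) fun _ _ => Commute.all _ _)

@[simp] lemma hom_of {A : Type u} [CommRing A] [HopfAlgebra R A] (f : A →ₐ[R] S) :
    (of f).hom = f := rfl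

@[simp] lemma fst_pair (a : GL (Fin (n + 1)) S) (b : GL (Fin n) S) :
    (pair (R := R) a b).fst = a := by
  rw [fst, pair, hom_of, Algebra.TensorProduct.lift_comp_includeLeft, toGL_lift]

@[simp] lemma snd_pair (a : GL (Fin (n + 1)) S) (b : GL (Fin n) S) :
    (pair (R := R) a b).snd = b := by
  have h : (Algebra.TensorProduct.lift (lift a) (lift b) fun _ _ => Commute.all _ _).comp
      Algebra.TensorProduct.includeRight = lift (R := R) b := by
    ext x; simp
  rw [snd, pair, hom_of, h, toGL_lift]

lemma pair_ext {g h : Points R (PairRing n R) S} (h1 : g.fst = h.fst) (h2 : g.snd = h.snd) :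
    g = h :=
  WithConv.ofConv_injective
    (Algebra.TensorProduct.ext (toGL_injective h1) (toGL_injective h2))

lemma pair_fst_snd (g : Points R (PairRing n R) S) : pair g.fst g.snd = g :=
  pair_ext (fst_pair _ _) (snd_pair _ _)

lemma hom_mul {A : Type u} [CommRing A] [HopfAlgebra R A] (g h : Points R A S) :
    (g * h).hom = ((Algebra.TensorProduct.lmul' R).comp
      (Algebra.TensorProduct.map g.hom h.hom)).comp (Bialgebra.comulAlgHom R A) := rfl

lemma fst_mul (g h : Points R (PairRing n R) S) : (g * h).fst = g.fst * h.fst := by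
  rw [fst, hom_mul, AlgHom.comp_assoc, comulAlgHom_comp_includeLeft, comulAlgHom_eq,
    ← AlgHom.comp_assoc, toGL_comp_comulHom]
  refine congrArg₂ _ (congrArg toGL ?_) (congrArg toGL ?_) <;>
    (ext x; simp [← Algebra.TensorProduct.one_def])

lemma snd_mul (g h : Points R (PairRing n R) S) : (g * h).snd = g.snd * h.snd := by
  rw [snd, hom_mul, AlgHom.comp_assoc, comulAlgHom_comp_includeRight, comulAlgHom_eq,
    ← AlgHom.comp_assoc, toGL_comp_comulHom]
  refine congrArg₂ _ (congrArg toGL ?_) (congrArg toGL ?_) <;>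
    (ext x; simp [← Algebra.TensorProduct.one_def])

/-- The first projection as a homomorphism. -/
def fstHom : Points R (PairRing n R) S →* GL (Fin (n + 1)) S := MonoidHom.mk' fst fst_mul

/-- The second projection as a homomorphism. -/
def sndHom : Points R (PairRing n R) S →* GL (Fin n) S := MonoidHom.mk' snd snd_mul

lemma fst_inv (g : Points R (PairRing n R) S) : (g⁻¹).fst = g.fst⁻¹ := map_inv fstHom g
lemma snd_inv (g : Points R (PairRing n R) S) : (g⁻¹).snd = g.snd⁻¹ := map_inv sndHom g
lemma fst_one : (1 : Points R (PairRing n R) S).fst = 1 := map_one fstHom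
lemma snd_one : (1 : Points R (PairRing n R) S).snd = 1 := map_one sndHom

lemma fst_map (j : S →ₐ[R] S') (g : Points R (PairRing n R) S) :
    (map j g).fst = mapGL j g.fst := rfl
lemma snd_map (j : S →ₐ[R] S') (g : Points R (PairRing n R) S) :
    (map j g).snd = mapGL j g.snd := rfl

/-- The map `(g₁, g₂) ↦ g₁ ι(g₂)⁻¹`, whose fibres are the cosets of the diagonal `GL_n`. -/
def mu (g : Points R (PairRing n R) S) : GL (Fin (n + 1)) S := g.fst * (iota n S g.snd)⁻¹

lemma mu_mul (g h : Points R (PairRing n R) S) :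
    (g * h).mu = g.fst * h.mu * (iota n S g.snd)⁻¹ := by
  simp only [mu, fst_mul, snd_mul, map_mul]
  group

lemma mapGL_iota (j : S →ₐ[R] S') (g : GL (Fin n) S) :
    mapGL j (iota n S g) = iota n S' (mapGL j g) := map_iota n (j : S →+* S') g

lemma mu_map (j : S →ₐ[R] S') (g : Points R (PairRing n R) S) :
    (map j g).mu = mapGL j g.mu := by
  rw [mu, mu, map_mul, map_inv, mapGL_iota, fst_map, snd_map]

lemma mu_pair_one (a : GL (Fin (n + 1)) S) : (pair (R := R) a 1).mu = a := by
  rw [mu, fst_pair, snd_pair, map_one, inv_one, mul_one]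

lemma mem_subgroupPoints_diag (g : Points R (PairRing n R) S) :
    g ∈ subgroupPoints (diag n R) S ↔ g.fst = iota n S g.snd := by
  have hl : (diag n R).toAlgHom.comp Algebra.TensorProduct.includeLeft = iotaHom n R :=
    Algebra.TensorProduct.lift_comp_includeLeft _ _ fun _ _ => Commute.all _ _
  have hr : (diag n R).toAlgHom.comp Algebra.TensorProduct.includeRight =
      AlgHom.id R (GLRing n R) := by
    ext x; simp [diag]
  have h1 (h : Points R (GLRing n R) S) : (comap (diag n R) S h).fst = iota n S (toGL h.hom) := by
    rw [← toGL_comp_iotaHom, ← hl]; rfl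
  have h2 (h : Points R (GLRing n R) S) : (comap (diag n R) S h).snd = toGL h.hom := by
    rw [← AlgHom.comp_id h.hom, ← hr]; rfl
  constructor
  · rintro ⟨h, rfl⟩
    rw [h1, h2]
  · intro h
    refine ⟨of (lift g.snd), pair_ext ?_ ?_⟩
    · rw [h1, h, hom_of, toGL_lift]
    · rw [h2, hom_of, toGL_lift]

/-- Turns every later question about `Cosets` into a matrix equation in GL_{n+1}; in particular the
quotient on points needs no sheafification. -/
lemma coset_eq_iff (g h : Points R (PairRing n R) S) :
    (g : Cosets (diag n R) S) = (h : Cosets (diag n R) S) ↔ g.mu = h.mu := by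
  rw [QuotientGroup.eq, mem_subgroupPoints_diag, fst_mul, snd_mul, fst_inv, snd_inv, map_mul,
    map_inv, mu, mu, inv_mul_eq_iff_eq_mul, ← mul_assoc, mul_inv_eq_iff_eq_mul, eq_comm,
    ← mul_inv_eq_iff_eq_mul, eq_comm]
  constructor <;> intro h'
  · rw [h', mul_inv_cancel_right]
  · rw [h', inv_mul_cancel_right]

end Points
end PairPoints

/-! ### The quotient as GL_{n+1}, embedded in affine space -/

section Embedding
open Matrix GLRing Points

variable (n : ℕ) (R : Type u) [CommRing R]

instance GLRing.smooth : Algebra.Smooth R (GLRing n R) := by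
  have : Algebra.Smooth (MvPolynomial (Fin n × Fin n) R) (GLRing n R) :=
    Algebra.Smooth.of_isLocalization_Away (det (mvPolynomialX (Fin n) (Fin n) R))
  have : Algebra.Smooth R (MvPolynomial (Fin n × Fin n) R) := {}
  exact Algebra.Smooth.comp R (MvPolynomial (Fin n × Fin n) R) (GLRing n R)

instance PairRing.smooth : Algebra.Smooth R (PairRing n R) :=
  Algebra.Smooth.comp R (GLRing (n + 1) R) (PairRing n R)

instance GLRing.flat : Module.Flat R (GLRing n R) := by
  have : Module.Flat (MvPolynomial (Fin n × Fin n) R) (GLRing n R) :=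
    IsLocalization.flat _ (Submonoid.powers (det (mvPolynomialX (Fin n) (Fin n) R)))
  exact Module.Flat.trans R (MvPolynomial (Fin n × Fin n) R) (GLRing n R)

instance GLRing.faithfullyFlat : Module.FaithfullyFlat R (GLRing n R) := by
  apply Module.FaithfullyFlat.of_comap_surjective
  intro p
  refine ⟨PrimeSpectrum.comap (counitHom n R : GLRing n R →+* R) p, ?_⟩
  rw [← PrimeSpectrum.comap_comp_apply]
  have : (counitHom n R : GLRing n R →+* R).comp (algebraMap R (GLRing n R)) = RingHom.id R := by
    ext x
    exact (counitHom n R).commutes x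
  rw [this]
  rfl

/-- The morphism `(g₁, g₂) ↦ g₁ ι(g₂)⁻¹` on coordinate rings. -/
def muHom : GLRing (n + 1) R →ₐ[R] PairRing n R :=
  lift (mu (of (AlgHom.id R (PairRing n R))))

variable {n R}

/-- Yoneda: every point is the image of the universal point, where the claim is the definition of
`muHom`, and `mu` is natural. -/
lemma toGL_comp_muHom {S : Type u} [CommRing S] [Algebra R S] (g : Points R (PairRing n R) S) :
    toGL (g.hom.comp (muHom n R)) = g.mu := by
  have h : g = map g.hom (of (AlgHom.id R (PairRing n R))) := rfl
  rw [toGL_comp, muHom, toGL_lift]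
  conv_rhs => rw [h, mu_map]

variable (n R)

/-- The automorphism `(g₁, g₂) ↦ (g₁ ι(g₂)⁻¹, g₂)` of `GL_{n+1} × GL_n` on coordinate rings. -/
def shear : PairRing n R →ₐ[R] PairRing n R :=
  hom (pair (mu (of (AlgHom.id R (PairRing n R)))) (snd (of (AlgHom.id R (PairRing n R)))))

/-- The inverse automorphism `(g₁, g₂) ↦ (g₁ ι(g₂), g₂)`. -/
def unshear : PairRing n R →ₐ[R] PairRing n R :=
  hom (pair (fst (of (AlgHom.id R (PairRing n R))) *
    iota n _ (snd (of (AlgHom.id R (PairRing n R))))) (snd (of (AlgHom.id R (PairRing n R)))))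

lemma hom_comp_shear {S : Type u} [CommRing S] [Algebra R S] (g : Points R (PairRing n R) S) :
    g.hom.comp (shear n R) = hom (pair g.mu g.snd) := by
  have h : map g.hom (of (AlgHom.id R (PairRing n R))) = g := rfl
  refine congrArg hom (pair_ext (g := map g.hom (of (shear n R))) ?_ ?_)
  · rw [fst_map, fst_pair, ← congrArg mu h, mu_map]
    exact congrArg _ (fst_pair _ _)
  · rw [snd_map, snd_pair, ← congrArg snd h, snd_map]
    exact congrArg _ (snd_pair _ _)

lemma hom_comp_unshear {S : Type u} [CommRing S] [Algebra R S] (g : Points R (PairRing n R) S) :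
    g.hom.comp (unshear n R) = hom (pair (g.fst * iota n S g.snd) g.snd) := by
  have h : map g.hom (of (AlgHom.id R (PairRing n R))) = g := rfl
  refine congrArg hom (pair_ext (g := map g.hom (of (unshear n R))) ?_ ?_)
  · rw [fst_map, fst_pair, ← congrArg snd h, ← congrArg fst h, fst_map, snd_map, ← mapGL_iota,
      ← map_mul]
    exact congrArg _ (fst_pair _ _)
  · rw [snd_map, snd_pair, ← congrArg snd h, snd_map]
    exact congrArg _ (snd_pair _ _)

lemma shear_comp_unshear : (shear n R).comp (unshear n R) = AlgHom.id R _ := by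
  have h := hom_comp_unshear n R (of (shear n R))
  rw [hom_of] at h
  rw [h]
  refine congrArg hom (pair_ext (h := of (AlgHom.id R (PairRing n R))) ?_ ?_)
  · rw [fst_pair]
    exact (congrArg₂ (fun a b => a * iota n _ b) (fst_pair _ _) (snd_pair _ _)).trans
      (inv_mul_cancel_right _ _)
  · rw [snd_pair]
    exact snd_pair _ _

lemma unshear_comp_shear : (unshear n R).comp (shear n R) = AlgHom.id R _ := by
  have h := hom_comp_shear n R (of (unshear n R))
  rw [hom_of] at h
  rw [h]
  refine congrArg hom (pair_ext (h := of (AlgHom.id R (PairRing n R))) ?_ ?_)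
  · rw [fst_pair]
    exact (congrArg₂ (fun a b => a * (iota n _ b)⁻¹) (fst_pair _ _) (snd_pair _ _)).trans
      (mul_inv_cancel_right _ _)
  · rw [snd_pair]
    exact snd_pair _ _

lemma shear_comp_includeLeft :
    (shear n R).comp Algebra.TensorProduct.includeLeft = muHom n R :=
  toGL_injective ((fst_pair _ _).trans (toGL_comp_muHom (of (AlgHom.id R (PairRing n R)))).symm)

/-- The shear automorphism carries the first projection to `mu`, and that projection is a base
change of GL_n over R, which is faithfully flat because it has the identity section. -/
lemma muHom_faithfullyFlat : (muHom n R : GLRing (n + 1) R →+* PairRing n R).FaithfullyFlat := by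
  have h1 : (algebraMap (GLRing (n + 1) R) (PairRing n R)).FaithfullyFlat :=
    (RingHom.faithfullyFlat_algebraMap_iff).2 inferInstance
  have h2 : (shear n R : PairRing n R →+* PairRing n R).FaithfullyFlat := by
    refine RingHom.FaithfullyFlat.of_bijective
      (AlgEquiv.ofAlgHom _ _ (shear_comp_unshear n R) (unshear_comp_shear n R)).bijective
  have h3 := RingHom.FaithfullyFlat.stableUnderComposition _ _ h1 h2
  rwa [← shear_comp_includeLeft]

lemma muHom_injective : Function.Injective (muHom n R) := (muHom_faithfullyFlat n R).injective

/-- The entries and the inverse determinant of the universal invertible matrix. -/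
def GLRing.coords (m : ℕ) (R : Type u) [CommRing R] : Option (Fin m × Fin m) → GLRing m R
  | none => ((GeneralLinearGroup.det (gen m R))⁻¹ : (GLRing m R)ˣ)
  | some p => (gen m R).1 p.1 p.2

lemma GLRing.adjoin_coords (m : ℕ) : Algebra.adjoin R (Set.range (coords m R)) = ⊤ := by
  rw [eq_top_iff]
  rintro x -
  have hX (p : MvPolynomial (Fin m × Fin m) R) :
      algebraMap _ (GLRing m R) p ∈ Algebra.adjoin R (Set.range (coords m R)) := by
    induction p using MvPolynomial.induction_on with
    | C a => 
      rw [← MvPolynomial.algebraMap_eq, ← IsScalarTower.algebraMap_apply]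
      exact Subalgebra.algebraMap_mem _ _
    | add p q hp hq => rw [map_add]; exact add_mem hp hq
    | mul_X p i hp =>
      rw [map_mul]
      exact mul_mem hp (Algebra.subset_adjoin ⟨some i, rfl⟩)
  obtain ⟨⟨p, s, k, rfl⟩, hk⟩ := IsLocalization.surj (Submonoid.powers
    (det (mvPolynomialX (Fin m) (Fin m) R))) x
  have hd : algebraMap _ (GLRing m R) (det (mvPolynomialX (Fin m) (Fin m) R)) =
      (GeneralLinearGroup.det (gen m R) : (GLRing m R)ˣ) := by
    rw [RingHom.map_det]; rfl
  -- The denominator of an element of the localization is a power of the determinant, whose inverse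
  -- is the coordinate `none`.
  have hx : x = algebraMap _ (GLRing m R) p * coords m R none ^ k := by
    rw [← hk]
    simp only [map_pow, hd]
    have : ((GeneralLinearGroup.det (gen m R) : (GLRing m R)ˣ) : GLRing m R) *
        coords m R none = 1 := Units.mul_inv _
    rw [mul_assoc, ← mul_pow, this, one_pow, mul_one]
  rw [hx]
  exact mul_mem (hX p) (pow_mem (Algebra.subset_adjoin (Set.mem_range_self none)) k)

/-- The number of coordinates on `GL_{n+1}`. -/
abbrev coordCount (n : ℕ) : ℕ := Fintype.card (Option (Fin (n + 1) × Fin (n + 1)))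

/-- The functions on `GL_{n+1} × GL_n` that embed the quotient by the diagonal `GL_n` into an
affine space: the entries and the inverse determinant of `g₁ ι(g₂)⁻¹`. -/
def embedding (i : Fin (coordCount n)) : PairRing n R :=
  muHom n R (coords (n + 1) R ((Fintype.equivFin _).symm i))

lemma adjoin_range_embedding :
    Algebra.adjoin R (Set.range (embedding n R)) = (muHom n R).range := by
  have : Set.range (embedding n R) = muHom n R '' Set.range (coords (n + 1) R) := by
    rw [← Set.range_comp]
    exact (Fintype.equivFin (Option (Fin (n + 1) × Fin (n + 1)))).symm.surjective.range_comp
      (muHom n R ∘ coords (n + 1) R)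
  rw [this, ← AlgHom.map_adjoin, adjoin_coords, Algebra.map_top]

lemma hom_embedding_eq_iff {S : Type u} [CommRing S] [Algebra R S]
    (g h : Points R (PairRing n R) S) :
    (∀ i, g.hom (embedding n R i) = h.hom (embedding n R i)) ↔ g.mu = h.mu := by
  rw [← toGL_comp_muHom, ← toGL_comp_muHom]
  constructor
  · intro H
    ext i j
    have := H (Fintype.equivFin _ (some (i, j)))
    simp only [embedding, Equiv.symm_apply_apply] at this
    exact this
  · intro H i
    exact DFunLike.congr_fun (toGL_injective H) _

lemma isAffineEmbedding_embedding : IsAffineEmbedding (diag n R) (embedding n R) where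
  faithfullyFlat := by
    rw [adjoin_range_embedding]
    have h1 : ((muHom n R).range.val : (muHom n R).range →+* PairRing n R).FaithfullyFlat := by
      -- Faithful flatness makes `muHom` injective, so the subalgebra generated by the coordinates
      -- is a copy of the coordinate ring of GL_{n+1}.
      let e := AlgEquiv.ofInjective (muHom n R) (muHom_injective n R)
      have h2 : (e.symm.toAlgHom : (muHom n R).range →+* GLRing (n + 1) R).FaithfullyFlat :=
        RingHom.FaithfullyFlat.of_bijective e.symm.bijective
      have h3 := RingHom.FaithfullyFlat.stableUnderComposition _ _ h2 (muHom_faithfullyFlat n R)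
      convert h3 using 1
      ext x
      exact (congrArg Subtype.val (e.apply_symm_apply x)).symm
    exact h1
  fibers S _ _ g h := by rw [hom_embedding_eq_iff, coset_eq_iff]

lemma diag_surjective : Function.Surjective (diag n R) := fun x =>
  ⟨1 ⊗ₜ x, by simp [diag]⟩

end Embedding

/-! ### The diagonal torus and its cocharacters -/

section DiagonalTorus
open Matrix GLRing Points

lemma Points.hom_map {R A S S' : Type u} [CommRing R] [CommRing A] [HopfAlgebra R A] [CommRing S]
    [Algebra R S] [CommRing S'] [Algebra R S'] (j : S →ₐ[R] S') (g : Points R A S) :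
    (Points.map j g).hom = j.comp g.hom := rfl

/-- The diagonal matrix of a family of units. -/
def diagGL {k : ℕ} {S : Type u} [CommRing S] : (Fin k → Sˣ) →* GL (Fin k) S :=
  (Units.map (Matrix.diagonalRingHom (Fin k) S).toMonoidHom).comp
    MulEquiv.piUnits.symm.toMonoidHom

@[simp] lemma coe_diagGL {k : ℕ} {S : Type u} [CommRing S] (f : Fin k → Sˣ) :
    (diagGL f : Matrix (Fin k) (Fin k) S) = diagonal fun i => (f i : S) := rfl

lemma map_diagGL {k : ℕ} {S S' : Type u} [CommRing S] [CommRing S'] (j : S →+* S')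
    (f : Fin k → Sˣ) : GeneralLinearGroup.map j (diagGL f) = diagGL fun i => Units.map j (f i) := by
  ext i l
  by_cases h : i = l
  · subst h; simp
  · simp [h]

variable (R : Type u) [CommRing R]

/-- The character `v` of the torus, as a unit of its coordinate ring. -/
def torusUnit {r : ℕ} (v : Fin r → ℤ) : (TorusRing R r)ˣ where
  val := AddMonoidAlgebra.single v 1
  inv := AddMonoidAlgebra.single (-v) 1
  val_inv := by
    rw [AddMonoidAlgebra.single_mul_single, add_neg_cancel, one_mul]; rfl
  inv_val := by
    rw [AddMonoidAlgebra.single_mul_single, neg_add_cancel, one_mul]; rfl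

@[simp] lemma coe_torusUnit {r : ℕ} (v : Fin r → ℤ) :
    (torusUnit R v : TorusRing R r) = AddMonoidAlgebra.single v 1 := rfl

variable (n : ℕ)

/-- The universal point of the maximal torus of pairs of diagonal matrices. -/
def torusPoint : Points R (PairRing n R) (TorusRing R (n + 1 + n)) :=
  pair (diagGL fun i => torusUnit R (Pi.single (Fin.castAdd n i) 1))
    (diagGL fun i => torusUnit R (Pi.single (Fin.natAdd (n + 1) i) 1))

/-- With the counit identity below, this makes the universal diagonal point a homomorphism of group
schemes: the characters on the diagonal are group-like. -/
lemma torusPoint_comul :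
    Points.map (Algebra.TensorProduct.includeLeft (R := R) (S := R) (B := TorusRing R (n + 1 + n)))
      (torusPoint R n) * Points.map Algebra.TensorProduct.includeRight (torusPoint R n) =
    Points.map (Bialgebra.comulAlgHom R (TorusRing R (n + 1 + n))) (torusPoint R n) := by
  refine pair_ext ?_ ?_
  · rw [fst_mul, fst_map, fst_map, fst_map, torusPoint, fst_pair, mapGL, mapGL, mapGL, map_diagGL,
      map_diagGL, map_diagGL, ← map_mul]
    refine congrArg _ (funext fun i => Units.ext ?_)
    simp
  · rw [snd_mul, snd_map, snd_map, snd_map, torusPoint, snd_pair, mapGL, mapGL, mapGL, map_diagGL,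
      map_diagGL, map_diagGL, ← map_mul]
    refine congrArg _ (funext fun i => Units.ext ?_)
    simp

lemma torusPoint_counit :
    Points.map (Bialgebra.counitAlgHom R (TorusRing R (n + 1 + n))) (torusPoint R n) = 1 := by
  refine pair_ext ?_ ?_
  · rw [fst_map, torusPoint, fst_pair, mapGL, map_diagGL, fst_one, ← map_one diagGL]
    refine congrArg _ (funext fun i => Units.ext ?_)
    simp
  · rw [snd_map, torusPoint, snd_pair, mapGL, map_diagGL, snd_one, ← map_one diagGL]
    refine congrArg _ (funext fun i => Units.ext ?_)
    simp

/-- The embedding of the maximal torus of pairs of diagonal matrices, on coordinate rings. -/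
def torusHom : PairRing n R →ₐc[R] TorusRing R (n + 1 + n) :=
  BialgHom.ofAlgHom (torusPoint R n).hom
    (by
      refine (congrArg hom (torusPoint_counit R n)).trans ?_
      ext x <;> rfl)
    (by
      refine Eq.trans ?_ (congrArg hom (torusPoint_comul R n))
      rw [hom_mul]
      refine congrArg (fun q => AlgHom.comp q (Bialgebra.comulAlgHom R (PairRing n R))) ?_
      apply Algebra.TensorProduct.ext
      · refine AlgHom.ext fun x => ?_
        simp [hom_map]
      · refine AlgHom.ext fun x => ?_
        simp [hom_map])

/-- The exponents whose monomials lie in the image form a submonoid of ℤ^r. It contains each basis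
vector, read off from a diagonal entry, and its negative, read off from the inverse matrix, so it is
everything. -/
lemma torusHom_surjective : Function.Surjective (torusHom R n) := by
  have hfst (i j) : ((torusPoint R n).fst.1 i j) ∈ (torusPoint R n).hom.range :=
    ⟨((gen (n + 1) R).1 i j) ⊗ₜ 1, rfl⟩
  have hsnd (i j) : ((torusPoint R n).snd.1 i j) ∈ (torusPoint R n).hom.range :=
    ⟨1 ⊗ₜ ((gen n R).1 i j), rfl⟩
  have hfst' (i j) : ((torusPoint R n).fst⁻¹.1 i j) ∈ (torusPoint R n).hom.range := by
    rw [fst, toGL, ← map_inv]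
    exact ⟨((gen (n + 1) R)⁻¹.1 i j) ⊗ₜ 1, rfl⟩
  have hsnd' (i j) : ((torusPoint R n).snd⁻¹.1 i j) ∈ (torusPoint R n).hom.range := by
    rw [snd, toGL, ← map_inv]
    exact ⟨1 ⊗ₜ ((gen n R)⁻¹.1 i j), rfl⟩
  let H : AddSubmonoid (Fin (n + 1 + n) → ℤ) :=
    { carrier := {v | AddMonoidAlgebra.single v 1 ∈ (torusPoint R n).hom.range}
      zero_mem' := (torusPoint R n).hom.range.one_mem
      add_mem' := fun {v w} hv hw => by
        have := (torusPoint R n).hom.range.mul_mem hv hw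
        rwa [AddMonoidAlgebra.single_mul_single, one_mul] at this }
  have hpos (i) : Pi.single i 1 ∈ H := by
    refine Fin.addCases (fun i => ?_) (fun i => ?_) i
    · have := hfst i i
      rw [torusPoint, fst_pair, coe_diagGL, diagonal_apply_eq] at this
      exact this
    · have := hsnd i i
      rw [torusPoint, snd_pair, coe_diagGL, diagonal_apply_eq] at this
      exact this
  have hneg (i) : -Pi.single i 1 ∈ H := by
    refine Fin.addCases (fun i => ?_) (fun i => ?_) i
    · have := hfst' i i
      rw [torusPoint, fst_pair, ← map_inv, coe_diagGL, diagonal_apply_eq] at this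
      exact this
    · have := hsnd' i i
      rw [torusPoint, snd_pair, ← map_inv, coe_diagGL, diagonal_apply_eq] at this
      exact this
  have hall (v) : v ∈ H := by
    rw [← Finset.univ_sum_single v]
    refine sum_mem fun i _ => ?_
    obtain ⟨k, hk | hk⟩ := Int.eq_nat_or_neg (v i)
    · have : (Pi.single i (v i) : Fin (n + 1 + n) → ℤ) = k • Pi.single i 1 := by
        rw [hk, ← Pi.single_smul]; simp
      rw [this]
      exact nsmul_mem (hpos i) k
    · have : (Pi.single i (v i) : Fin (n + 1 + n) → ℤ) = k • -Pi.single i 1 := by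
        rw [hk, ← Pi.single_neg, ← Pi.single_smul]; simp
      rw [this]
      exact nsmul_mem (hneg i) k
  intro x
  change x ∈ (torusPoint R n).hom.range
  induction x using AddMonoidAlgebra.induction_linear with
  | zero => exact zero_mem _
  | add f g hf hg => exact add_mem hf hg
  | single v a =>
    have : (AddMonoidAlgebra.single v a : TorusRing R (n + 1 + n)) =
        a • AddMonoidAlgebra.single v 1 := by simp
    rw [this]
    exact Subalgebra.smul_mem _ (hall v) a

/-- The cocharacter `t ↦ (t ^ m₁, …, t ^ m_r)` of the split torus. -/
def cochar {r : ℕ} (m : Fin r → ℤ) : Cocharacter R r :=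
  AddMonoidAlgebra.mapDomainBialgHom R
    (∑ i, m i • Pi.evalAddMonoidHom (fun _ : Fin r => ℤ) i)

variable {R n}

lemma evalUniformizer_cochar (π : R) {r : ℕ} (m : Fin r → ℤ) (i : Fin r) :
    Units.map ((evalUniformizer π).comp (cochar R m).toAlgHom : TorusRing R r →* _)
      (torusUnit R (Pi.single i 1)) = awayUnit π ^ m i := by
  have h : (cochar R m) (AddMonoidAlgebra.single (Pi.single i 1) 1) =
      LaurentPolynomial.T (m i) := by
    rw [cochar, AddMonoidAlgebra.mapDomainBialgHom_single]
    refine congrArg (fun k : ℤ => (AddMonoidAlgebra.single k 1 : R[T;T⁻¹])) ?_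
    simp [Pi.single_apply]
  ext
  change evalUniformizer π ((cochar R m) (AddMonoidAlgebra.single (Pi.single i 1) 1)) = _
  rw [h]
  change LaurentPolynomial.eval₂ (algebraMap R (Localization.Away π)) (awayUnit π) _ = _
  rw [LaurentPolynomial.eval₂_T]

lemma fst_piPow (π : R) (m : Fin (n + 1 + n) → ℤ) :
    (piPow π (torusHom R n) (cochar R m)).fst =
      diagGL fun i => awayUnit π ^ m (Fin.castAdd n i) := by
  have h : piPow π (torusHom R n) (cochar R m) =
    Points.map ((evalUniformizer π).comp (cochar R m).toAlgHom) (torusPoint R n) := rfl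
  rw [h, fst_map, torusPoint, fst_pair, mapGL, map_diagGL]
  exact congrArg _ (funext fun i => evalUniformizer_cochar π m _)

lemma snd_piPow (π : R) (m : Fin (n + 1 + n) → ℤ) :
    (piPow π (torusHom R n) (cochar R m)).snd =
      diagGL fun i => awayUnit π ^ m (Fin.natAdd (n + 1) i) := by
  have h : piPow π (torusHom R n) (cochar R m) =
    Points.map ((evalUniformizer π).comp (cochar R m).toAlgHom) (torusPoint R n) := rfl
  rw [h, snd_map, torusPoint, snd_pair, mapGL, map_diagGL]
  exact congrArg _ (funext fun i => evalUniformizer_cochar π m _)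

end DiagonalTorus

/-! ### The orbit representatives and their coordinates -/

section Representatives
open Matrix GLRing Points

section Block

variable {n : ℕ} {S : Type u}

/-- The matrix `(p, r; w, k)` in block form. -/
def block (p : S) (r w : Fin n → S) (k : Matrix (Fin n) (Fin n) S) :
    Matrix (Fin (n + 1)) (Fin (n + 1)) S :=
  Matrix.of (Fin.cons (Fin.cons p r) fun i => Fin.cons (w i) (k i))

section
variable (p : S) (r w : Fin n → S) (k : Matrix (Fin n) (Fin n) S) (i j : Fin n)
@[simp] lemma block_zero_zero : block p r w k 0 0 = p := rfl
@[simp] lemma block_zero_succ : block p r w k 0 j.succ = r j := rfl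
@[simp] lemma block_succ_zero : block p r w k i.succ 0 = w i := rfl
@[simp] lemma block_succ_succ : block p r w k i.succ j.succ = k i j := rfl
end

lemma eq_block_iff {M : Matrix (Fin (n + 1)) (Fin (n + 1)) S} {p : S} {r w : Fin n → S}
    {k : Matrix (Fin n) (Fin n) S} : M = block p r w k ↔ M 0 0 = p ∧ (∀ j, M 0 j.succ = r j) ∧
      (∀ i, M i.succ 0 = w i) ∧ ∀ i j, M i.succ j.succ = k i j := by
  constructor
  · rintro rfl
    simp
  · rintro ⟨h1, h2, h3, h4⟩
    ext i j
    refine Fin.cases ?_ (fun i => ?_) i <;> refine Fin.cases ?_ (fun j => ?_) j <;>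
      simp [*]

lemma eq_block (M : Matrix (Fin (n + 1)) (Fin (n + 1)) S) :
    M = block (M 0 0) (fun j => M 0 j.succ) (fun i => M i.succ 0) (M.submatrix Fin.succ Fin.succ) :=
  eq_block_iff.2 ⟨rfl, fun _ => rfl, fun _ => rfl, fun _ _ => rfl⟩

variable [CommRing S]

lemma block_mul (p p' : S) (r w r' w' : Fin n → S) (k k' : Matrix (Fin n) (Fin n) S) :
    block p r w k * block p' r' w' k' =
      block (p * p' + r ⬝ᵥ w') (p • r' + r ᵥ* k') (p' • w + k *ᵥ w') (vecMulVec w r' + k * k') := by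
  rw [eq_block_iff]
  simp [Matrix.mul_apply, Fin.sum_univ_succ, dotProduct, vecMul, mulVec, vecMulVec_apply, mul_comm]

lemma coe_iota (k : GL (Fin n) S) : (iota n S k).1 = block 1 0 0 k.1 := rfl

lemma block_one : block (1 : S) 0 0 (1 : Matrix (Fin n) (Fin n) S) = 1 :=
  map_one (iotaMatrix n S)

lemma diagonal_cons (p : S) (d : Fin n → S) :
    diagonal (Fin.cons p d : Fin (n + 1) → S) = block p 0 0 (diagonal d) := by
  rw [eq_block_iff]
  refine ⟨by simp, fun j => ?_, fun i => ?_, fun i j => ?_⟩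
  · simp [(Fin.succ_ne_zero _).symm]
  · simp [Fin.succ_ne_zero]
  · simp [diagonal_apply]

lemma det_block_zero (p : S) (w : Fin n → S) (k : Matrix (Fin n) (Fin n) S) :
    det (block p 0 w k) = p * det k := by
  rw [det_succ_row_zero, Fin.sum_univ_succ]
  have : (block p 0 w k).submatrix Fin.succ Fin.succ = k := by
    ext i j; simp
  simp [this]

lemma map_block {S' : Type u} [CommRing S'] (f : S →+* S') (p : S) (r w : Fin n → S)
    (k : Matrix (Fin n) (Fin n) S) :
    (block p r w k).map f = block (f p) (f ∘ r) (f ∘ w) (k.map f) := by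
  rw [eq_block_iff]
  simp

variable (n S) in
/-- The unipotent matrix whose first column consists of ones. -/
def unipGL : GL (Fin (n + 1)) S where
  val := block 1 0 1 1
  inv := block 1 0 (-1) 1
  val_inv := by rw [block_mul, ← block_one]; simp
  inv_val := by rw [block_mul, ← block_one]; simp

/-- The matrix `(ϖ^b, 0; ϖ^c, ϖ^(c+d))`, written as a product. -/
def repGL (ϖ : Sˣ) (b : ℤ) (c d : Fin n → ℤ) : GL (Fin (n + 1)) S :=
  diagGL (fun i => ϖ ^ (Fin.cons b c : Fin (n + 1) → ℤ) i) * unipGL n S *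
    iota n S (diagGL fun i => ϖ ^ d i)

lemma coe_repGL (ϖ : Sˣ) (b : ℤ) (c d : Fin n → ℤ) :
    (repGL ϖ b c d).1 = block ((ϖ ^ b : Sˣ) : S) 0 (fun i => ((ϖ ^ c i : Sˣ) : S))
      (diagonal fun i => ((ϖ ^ (c i + d i) : Sˣ) : S)) := by
  have h1 : (diagGL (fun i => ϖ ^ (Fin.cons b c : Fin (n + 1) → ℤ) i)).1 =
      block ((ϖ ^ b : Sˣ) : S) 0 0 (diagonal fun i => ((ϖ ^ c i : Sˣ) : S)) := by
    rw [coe_diagGL, ← diagonal_cons]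
    congr 1
    ext i
    refine Fin.cases ?_ (fun i => ?_) i <;> simp
  have h2 : (unipGL n S).1 = block 1 0 1 1 := rfl
  rw [repGL, Units.val_mul, Units.val_mul, h1, h2, coe_iota, coe_diagGL, block_mul, block_mul]
  congr 1
  · simp
  · simp
  · ext i
    simp [mulVec, dotProduct, diagonal_apply]
  · simp [_root_.zpow_add]

lemma det_repGL (ϖ : Sˣ) (b : ℤ) (c d : Fin n → ℤ) :
    GeneralLinearGroup.det (repGL ϖ b c d) = ϖ ^ (b + ∑ i, (c i + d i)) := by
  have hs (s : Finset (Fin n)) (f : Fin n → ℤ) : ϖ ^ (∑ i ∈ s, f i) = ∏ i ∈ s, ϖ ^ f i := by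
    classical
    induction s using Finset.induction_on with
    | empty => simp
    | insert a s ha ih => rw [Finset.sum_insert ha, Finset.prod_insert ha, _root_.zpow_add, ih]
  ext
  change det (repGL ϖ b c d).1 = _
  rw [coe_repGL, det_block_zero, det_diagonal, _root_.zpow_add, hs]
  simp

lemma map_unipGL {S' : Type u} [CommRing S'] (j : S →+* S') :
    GeneralLinearGroup.map j (unipGL n S) = unipGL n S' := by
  ext i k
  refine Fin.cases ?_ (fun i => ?_) i <;> refine Fin.cases ?_ (fun k => ?_) k
  · simp [unipGL]
  · simp [unipGL]
  · simp [unipGL]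
  · by_cases h : i = k
    · subst h; simp [unipGL]
    · simp [unipGL, h]

lemma map_repGL {S' : Type u} [CommRing S'] (j : S →+* S') (ϖ : Sˣ) (b : ℤ) (c d : Fin n → ℤ) :
    GeneralLinearGroup.map j (repGL ϖ b c d) = repGL (Units.map j ϖ) b c d := by
  rw [repGL, repGL, map_mul, map_mul, map_iota, map_diagGL, map_diagGL, map_unipGL]
  simp only [map_zpow]

end Block

variable {n : ℕ} {R : Type u} [CommRing R]

/-- The base point of `G/H`. -/
def baseCoset (n : ℕ) (R : Type u) [CommRing R] : Cosets (diag n R) R :=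
  (pair (unipGL n R) 1 : Points R (PairRing n R) R)

/-- The exponents `(b, c, -d)` of a cocharacter. -/
def exponents (b : ℤ) (c d : Fin n → ℤ) : Fin (n + 1 + n) → ℤ :=
  Fin.append (Fin.cons b c) (-d)

/-- The cocharacters used to represent the orbits. -/
def dominant (n : ℕ) (R : Type u) [CommRing R] : Set (Cocharacter R (n + 1 + n)) :=
  {m | ∃ (b : ℤ) (c d : Fin n → ℤ), Monotone c ∧ (∀ i, c i ≤ b) ∧ Monotone d ∧
    m = cochar R (exponents b c d)}

/-- The coset with representative `repGL`. -/
def repCoset {S : Type u} [CommRing S] [Algebra R S] (ϖ : Sˣ) (b : ℤ) (c d : Fin n → ℤ) :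
    Cosets (diag n R) S :=
  (pair (repGL ϖ b c d) 1 : Points R (PairRing n R) S)

lemma map_baseCoset {S : Type u} [CommRing S] [Algebra R S] (j : R →ₐ[R] S) :
    Cosets.map (diag n R) j (baseCoset n R) =
      (pair (unipGL n S) 1 : Points R (PairRing n R) S) := by
  rw [baseCoset, Cosets.map_mk, coset_eq_iff, mu_map, mu_pair_one, mu_pair_one]
  exact map_unipGL (j : R →+* S)

lemma map_repCoset {S S' : Type u} [CommRing S] [Algebra R S] [CommRing S'] [Algebra R S']
    (j : S →ₐ[R] S') (ϖ : Sˣ) (b : ℤ) (c d : Fin n → ℤ) :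
    Cosets.map (diag n R) j (repCoset ϖ b c d) =
      repCoset (Units.map (j : S →* S') ϖ) b c d := by
  rw [repCoset, repCoset, Cosets.map_mk, coset_eq_iff, mu_map, mu_pair_one, mu_pair_one]
  exact map_repGL (j : S →+* S') ϖ b c d

/-- The second torus component acts on the right through its inverse; this is why `exponents`
carries -d. -/
lemma piPow_smul_baseCoset (π : R) (b : ℤ) (c d : Fin n → ℤ) :
    piPow π (torusHom R n) (cochar R (exponents b c d)) •
      Cosets.map (diag n R) (Algebra.ofId R (Localization.Away π)) (baseCoset n R) =
    repCoset (awayUnit π) b c d := by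
  rw [map_baseCoset, repCoset, MulAction.Quotient.smul_coe, smul_eq_mul, coset_eq_iff, mu_mul,
    mu_pair_one, mu_pair_one, fst_piPow, snd_piPow, repGL, ← map_inv, ← map_inv]
  congr 2
  · simp [exponents]
  · congr 1
    ext i
    simp [exponents]

lemma mem_piOrbit_iff (π : R) (z : Cosets (diag n R) (Localization.Away π)) :
    z ∈ piOrbit π (diag n R) (torusHom R n) (dominant n R) {baseCoset n R} ↔
      ∃ (b : ℤ) (c d : Fin n → ℤ), Monotone c ∧ (∀ i, c i ≤ b) ∧ Monotone d ∧
        z = repCoset (awayUnit π) b c d := by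
  constructor
  · rintro ⟨_, ⟨b, c, d, hc, hb, hd, rfl⟩, _, rfl, rfl⟩
    exact ⟨b, c, d, hc, hb, hd, piPow_smul_baseCoset π b c d⟩
  · rintro ⟨b, c, d, hc, hb, hd, rfl⟩
    exact ⟨_, ⟨b, c, d, hc, hb, hd, rfl⟩, _, rfl, (piPow_smul_baseCoset π b c d).symm⟩

lemma smul_coset_eq_iff {S : Type u} [CommRing S] [Algebra R S] (g : Points R (PairRing n R) S)
    (x y : GL (Fin (n + 1)) S) :
    g • ((pair x 1 : Points R (PairRing n R) S) : Cosets (diag n R) S) =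
      ((pair y 1 : Points R (PairRing n R) S) : Cosets (diag n R) S) ↔
    g.fst * x = y * iota n S g.snd := by
  rw [MulAction.Quotient.smul_coe, smul_eq_mul, coset_eq_iff, mu_mul, mu_pair_one, mu_pair_one,
    mul_inv_eq_iff_eq_mul]

lemma smul_repCoset_eq_iff {S : Type u} [CommRing S] [Algebra R S]
    (g : Points R (PairRing n R) S) (ϖ : Sˣ) (b b' : ℤ) (c d c' d' : Fin n → ℤ) :
    g • (repCoset ϖ b c d : Cosets (diag n R) S) = repCoset ϖ b' c' d' ↔
    g.fst * repGL ϖ b c d = repGL ϖ b' c' d' * iota n S g.snd :=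
  smul_coset_eq_iff g _ _

/-! ### Valuations -/

/-- The coordinates of a representative are zero or powers of the uniformizer. -/
lemma exists_embedding_repGL (b : ℤ) (c d : Fin n → ℤ) (i : Fin (coordCount n)) :
    ∃ e : Option ℤ, ∀ (S : Type u) [CommRing S] [Algebra R S] (ϖ : Sˣ)
      (g : Points R (PairRing n R) S), g.mu = repGL ϖ b c d →
      g.hom (embedding n R i) = e.elim 0 fun m => ((ϖ ^ m : Sˣ) : S) := by
  rcases h : (Fintype.equivFin (Option (Fin (n + 1) × Fin (n + 1)))).symm i with _ | ⟨k, l⟩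
  -- The coordinate `none` is the inverse determinant, and a representative is lower triangular with
  -- powers of ϖ on the diagonal.
  · refine ⟨some (-(b + ∑ i, (c i + d i))), fun S _ _ ϖ g hg => ?_⟩
    rw [← toGL_comp_muHom] at hg
    rw [embedding, h, Option.elim_some, _root_.zpow_neg, ← det_repGL, ← hg, toGL,
      GeneralLinearGroup.map_det, ← map_inv]
    rfl
  · have h1 : ∃ e : Option ℤ, ∀ (S : Type u) [CommRing S] (ϖ : Sˣ),
        (repGL ϖ b c d).1 k l = e.elim 0 fun m => ((ϖ ^ m : Sˣ) : S) := by
      simp only [coe_repGL]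
      refine Fin.cases ?_ (fun k => ?_) k <;> refine Fin.cases ?_ (fun l => ?_) l
      · exact ⟨some b, fun S _ ϖ => rfl⟩
      · exact ⟨none, fun S _ ϖ => rfl⟩
      · exact ⟨some (c k), fun S _ ϖ => rfl⟩
      · by_cases hkl : k = l
        · subst hkl
          exact ⟨some (c k + d k), fun S _ ϖ => by simp⟩
        · exact ⟨none, fun S _ ϖ => by simp [hkl]⟩
    obtain ⟨e, he⟩ := h1
    refine ⟨e, fun S _ _ ϖ g hg => ?_⟩
    rw [← he, ← hg, ← toGL_comp_muHom, embedding, h]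
    rfl

variable {π : R}

/-- The image of `π` in a local field over `(R, π)`, as a unit. -/
def LocalFieldOver.unif (F : LocalFieldOver R π) : F.Kˣ :=
  Units.map (F.ofAway : Localization.Away π →* F.K) (awayUnit π)

lemma LocalFieldOver.coe_unif (F : LocalFieldOver R π) :
    (F.unif : F.K) = algebraMap F.O F.K (F.toIntegers π) :=
  F.ofAway.commutes π

lemma LocalFieldOver.valuation_unif (F : LocalFieldOver R π) :
    (IsDiscreteValuationRing.maximalIdeal F.O).valuation F.K (F.unif : F.K) =
      WithZero.exp (-1 : ℤ) := by
  rw [coe_unif, IsDedekindDomain.HeightOneSpectrum.valuation_of_algebraMap]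
  exact IsDedekindDomain.HeightOneSpectrum.intValuation_singleton _ F.irreducible.ne_zero
    ((IsDiscreteValuationRing.irreducible_iff_uniformizer _).1 F.irreducible)

/-- The coordinates depend only on the coset. Each is 0 or ϖ^m with m independent of the field, and
ϖ has normalized valuation 1 in all of them. -/
lemma val_eq_of_mem_piOrbit (g : Points R (PairRing n R) (Localization.Away π))
    (hg : (g : Cosets (diag n R) (Localization.Away π)) ∈
      piOrbit π (diag n R) (torusHom R n) (dominant n R) {baseCoset n R})
    (F F' : LocalFieldOver R π) :
    F.val (fun i => (Points.map F.ofAway g).hom (embedding n R i)) =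
      F'.val (fun i => (Points.map F'.ofAway g).hom (embedding n R i)) := by
  obtain ⟨b, c, d, -, -, -, h⟩ := (mem_piOrbit_iff π _).1 hg
  rw [repCoset, coset_eq_iff, mu_pair_one] at h
  refine Finset.sup_congr rfl fun i _ => ?_
  obtain ⟨e, he⟩ := exists_embedding_repGL (R := R) b c d i
  have hF (F : LocalFieldOver R π) : (Points.map F.ofAway g).mu = repGL F.unif b c d := by
    rw [mu_map, h]
    exact map_repGL _ _ b c d
  simp only [he _ _ _ (hF F), he _ _ _ (hF F')]
  rcases e with _ | m
  · simp
  · simp [LocalFieldOver.valuation_unif]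

end Representatives

/-! ### Triangular factorization in congruence subgroups -/

section Congruence
open Matrix GLRing Points

variable {O : Type u} [CommRing O] (I : Ideal O)

/-- The matrix `M` is congruent to the identity modulo `I`. -/
def CongOne {m : ℕ} (M : Matrix (Fin m) (Fin m) O) : Prop :=
  M.map (Ideal.Quotient.mk I) = 1

variable {I} {m n : ℕ}

lemma CongOne.mul {M N : Matrix (Fin m) (Fin m) O} (hM : CongOne I M) (hN : CongOne I N) :
    CongOne I (M * N) := by
  rw [CongOne, Matrix.map_mul, hM, hN, mul_one]

lemma CongOne.of_mul_eq_one {M N : Matrix (Fin m) (Fin m) O} (hM : CongOne I M) (h : N * M = 1) :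
    CongOne I N := by
  have h1 := congrArg (fun A : Matrix (Fin m) (Fin m) O => A.map (Ideal.Quotient.mk I)) h
  simp only [Matrix.map_mul] at h1
  rw [hM, mul_one] at h1
  rw [CongOne, h1]
  exact Matrix.map_one _ (map_zero _) (map_one _)

lemma congOne_iff {M : Matrix (Fin m) (Fin m) O} :
    CongOne I M ↔ (∀ i, M i i - 1 ∈ I) ∧ ∀ i j, i ≠ j → M i j ∈ I := by
  rw [CongOne, ← Matrix.ext_iff]
  constructor
  · intro h
    refine ⟨fun i => ?_, fun i j hij => ?_⟩
    · rw [← Ideal.Quotient.mk_eq_mk_iff_sub_mem, map_one]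
      simpa using h i i
    · rw [← Ideal.Quotient.eq_zero_iff_mem]
      simpa [hij] using h i j
  · rintro ⟨h1, h2⟩ i j
    by_cases hij : i = j
    · subst hij
      have := h1 i
      rw [← Ideal.Quotient.mk_eq_mk_iff_sub_mem, map_one] at this
      simpa using this
    · simpa [hij] using Ideal.Quotient.eq_zero_iff_mem.2 (h2 i j hij)

lemma congOne_diagonal_iff {t : Fin m → O} :
    CongOne I (diagonal t) ↔ ∀ i, t i - 1 ∈ I := by
  rw [congOne_iff]
  refine ⟨fun h i => by simpa using h.1 i, fun h => ⟨fun i => by simpa using h i, ?_⟩⟩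
  intro i j hij
  simp [hij]

lemma congOne_block_iff {p : O} {r w : Fin n → O} {k : Matrix (Fin n) (Fin n) O} :
    CongOne I (block p r w k) ↔ p - 1 ∈ I ∧ (∀ j, r j ∈ I) ∧ (∀ i, w i ∈ I) ∧ CongOne I k := by
  rw [congOne_iff, congOne_iff]
  constructor
  · rintro ⟨h1, h2⟩
    exact ⟨h1 0, fun j => h2 0 j.succ (Fin.succ_ne_zero j).symm,
      fun i => h2 i.succ 0 (Fin.succ_ne_zero i), fun i => h1 i.succ,
      fun i j hij => h2 i.succ j.succ (by simpa using hij)⟩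
  · rintro ⟨h1, h2, h3, h4, h5⟩
    refine ⟨Fin.cases h1 h4, ?_⟩
    intro i j
    refine Fin.cases ?_ (fun i => ?_) i <;> refine Fin.cases ?_ (fun j => ?_) j
    · simp
    · exact fun _ => h2 j
    · exact fun _ => h3 i
    · exact fun h => h5 i j (by simpa using h)

lemma isUnit_of_sub_one_mem (hI : ∀ x ∈ I, IsUnit (1 + x)) {x : O} (hx : x - 1 ∈ I) : IsUnit x := by
  have := hI _ hx
  rwa [add_sub_cancel] at this

lemma CongOne.exists_GL (hI : ∀ x ∈ I, IsUnit (1 + x))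
    {M : Matrix (Fin m) (Fin m) O} (hM : CongOne I M) :
    ∃ g : GL (Fin m) O, g.1 = M ∧ GeneralLinearGroup.map (Ideal.Quotient.mk I) g = 1 := by
  have hdet : IsUnit (det M) := by
    apply isUnit_of_sub_one_mem hI
    rw [← Ideal.Quotient.mk_eq_mk_iff_sub_mem, map_one, RingHom.map_det]
    have : (Ideal.Quotient.mk I).mapMatrix M = 1 := hM
    rw [this, det_one]
  refine ⟨nonsingInvUnit M hdet, rfl, Units.ext hM⟩

lemma congOne_of_map_eq_one {g : GL (Fin m) O}
    (h : GeneralLinearGroup.map (Ideal.Quotient.mk I) g = 1) : CongOne I g.1 :=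
  congrArg Units.val h

/-- Gaussian elimination without pivoting: the corner entry is ≡ 1 modulo I, hence a unit, and the
Schur complement is again ≡ 1, so the induction continues. -/
lemma CongOne.exists_lower_mul_upper (hI : ∀ x ∈ I, IsUnit (1 + x)) :
    ∀ {m : ℕ} {K : Matrix (Fin m) (Fin m) O}, CongOne I K →
    ∃ L U : Matrix (Fin m) (Fin m) O, L * U = K ∧ CongOne I L ∧ CongOne I U ∧
      (∀ i j, i < j → L i j = 0) ∧ ∀ i j, j < i → U i j = 0
  | 0, K, hK => ⟨K, K, Subsingleton.elim _ _, hK, hK, fun i => i.elim0, fun i => i.elim0⟩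
  | m + 1, K, hK => by
    rw [eq_block K] at hK ⊢
    generalize K 0 0 = p at hK ⊢
    generalize (fun j => K 0 (Fin.succ j)) = r at hK ⊢
    generalize (fun i => K (Fin.succ i) 0) = w at hK ⊢
    generalize K.submatrix Fin.succ Fin.succ = k at hK ⊢
    obtain ⟨hp, hr, hw, hk⟩ := congOne_block_iff.1 hK
    obtain ⟨p, rfl⟩ := isUnit_of_sub_one_mem hI hp
    have hk' : CongOne I (k - vecMulVec w ((p⁻¹ : Oˣ) • r)) := by
      rw [congOne_iff] at hk ⊢
      have h0 (i j) : vecMulVec w ((p⁻¹ : Oˣ) • r) i j ∈ I :=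
        Ideal.mul_mem_right _ _ (hw i)
      refine ⟨fun i => ?_, fun i j hij => ?_⟩
      · rw [Matrix.sub_apply, sub_right_comm]
        exact I.sub_mem (hk.1 i) (h0 i i)
      · exact I.sub_mem (hk.2 i j hij) (h0 i j)
    obtain ⟨L, U, h1, hL, hU, hL', hU'⟩ := CongOne.exists_lower_mul_upper hI hk'
    refine ⟨block p 0 w L, block 1 ((p⁻¹ : Oˣ) • r) 0 U, ?_, ?_, ?_, ?_, ?_⟩
    · rw [block_mul, h1]
      congr 1
      · simp
      · ext j; simp [Units.smul_def]
      · simp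
      · simp
    · exact congOne_block_iff.2 ⟨hp, fun _ => I.zero_mem, hw, hL⟩
    · refine congOne_block_iff.2 ⟨by simp, fun j => ?_, fun _ => I.zero_mem, hU⟩
      exact Ideal.mul_mem_left _ _ (hr j)
    · refine Fin.cases (Fin.cases (by simp) (by simp)) fun i => Fin.cases (by simp) fun j => ?_
      simpa using hL' i j
    · refine Fin.cases (Fin.cases (by simp) (by simp)) fun i => Fin.cases (by simp) fun j => ?_
      simpa using hU' i j

/-- A factorization along the open orbit of a pair of opposite Borel subgroups. -/
lemma exists_lower_mul_unipGL_mul_upper (hI : ∀ x ∈ I, IsUnit (1 + x)) 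
    {K : GL (Fin (n + 1)) O}
    (hK : GeneralLinearGroup.map (Ideal.Quotient.mk I) K = 1) :
    ∃ (P : GL (Fin (n + 1)) O) (Q : GL (Fin n) O),
      K * unipGL n O = P * unipGL n O * iota n O Q ∧ CongOne I P.1 ∧ CongOne I Q.1 ∧
      (∀ i j : Fin n, i < j → P.1 i.succ j.succ = 0) ∧ (∀ i : Fin n, P.1 i.succ 0 = 0) ∧
      ∀ i j, j < i → Q.1 i j = 0 := by
  have hK1 := congOne_of_map_eq_one hK
  obtain ⟨p, r, w, k, hKb⟩ : ∃ p r w k, K.1 = block p r w k := ⟨_, _, _, _, eq_block _⟩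
  rw [hKb] at hK1
  obtain ⟨hp, hr, hw, hk⟩ := congOne_block_iff.1 hK1
  obtain ⟨L, U, hLU, hL, hU, hL', hU'⟩ := CongOne.exists_lower_mul_upper hI hk
  obtain ⟨gL, rfl, -⟩ := hL.exists_GL hI
  have hLi : CongOne I (gL⁻¹).1 := hL.of_mul_eq_one (by rw [← Units.val_mul]; simp)
  have hmem {M : Matrix (Fin n) (Fin n) O} (v : Fin n → O) (hv : ∀ i, v i ∈ I) (i : Fin n) :
      (M *ᵥ v) i ∈ I := by
    rw [mulVec, dotProduct]
    exact I.sum_mem fun j _ => Ideal.mul_mem_left _ _ (hv j)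
  have hmem' {M : Matrix (Fin n) (Fin n) O} (v : Fin n → O) (hv : ∀ i, v i ∈ I) (i : Fin n) :
      (v ᵥ* M) i ∈ I := by
    rw [vecMul, dotProduct]
    exact I.sum_mem fun j _ => Ideal.mul_mem_right _ _ (hv j)
  have hU1 (i : Fin n) : (U *ᵥ 1) i - 1 ∈ I := by
    have h1 : (U *ᵥ 1) i - 1 = (U i i - 1) + ∑ j ∈ Finset.univ.erase i, U i j := by
      rw [mulVec, dotProduct, ← Finset.add_sum_erase _ _ (Finset.mem_univ i)]
      simp only [Pi.one_apply, mul_one]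
      ring
    rw [congOne_iff] at hU
    rw [h1]
    exact I.add_mem (hU.1 i) (I.sum_mem fun j hj => hU.2 i j (Finset.ne_of_mem_erase hj).symm)
  -- With k = LU, the first column of K u below the corner is w + k·1 = L·(L⁻¹w + U·1). This vector
  -- t is put on a diagonal, so that P has lower block L·diag(t) and Q = diag(t)⁻¹U; then both the
  -- first column and the lower block match.
  have ht (i : Fin n) : ((gL⁻¹).1 *ᵥ w + U *ᵥ 1) i - 1 ∈ I := by
    rw [Pi.add_apply, add_sub_assoc]
    exact I.add_mem (hmem w hw i) (hU1 i)
  choose t htt using fun i => isUnit_of_sub_one_mem hI (ht i)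
  have htc : CongOne I (diagGL t).1 := by
    rw [coe_diagGL, congOne_diagonal_iff]
    intro i
    rw [htt]
    exact ht i
  have htc' : CongOne I ((diagGL t)⁻¹).1 := htc.of_mul_eq_one (by rw [← Units.val_mul]; simp)
  obtain ⟨gU, rfl, -⟩ := hU.exists_GL hI
  have hQc : CongOne I ((diagGL t)⁻¹ * gU).1 := htc'.mul hU
  set Q := (diagGL t)⁻¹ * gU with hQ
  -- Chosen so that r'Q = r. The corner of P below is then fixed by comparing the corners of K u and
  -- P u ι(Q).
  set r' : Fin n → O := r ᵥ* (Q⁻¹).1 with hr'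
  have hP : CongOne I (block (p + r ⬝ᵥ 1 - r' ⬝ᵥ 1) r' 0 (gL * diagGL t).1) := by
    rw [congOne_block_iff]
    refine ⟨?_, hmem' r hr, fun _ => I.zero_mem, hL.mul htc⟩
    rw [show p + r ⬝ᵥ 1 - r' ⬝ᵥ 1 - 1 = (p - 1) + r ⬝ᵥ 1 - r' ⬝ᵥ 1 by ring]
    exact I.sub_mem (I.add_mem hp (I.sum_mem fun j _ => Ideal.mul_mem_right _ _ (hr j)))
      (I.sum_mem fun j _ => Ideal.mul_mem_right _ _ (hmem' r hr j))
  obtain ⟨P, hPe, -⟩ := hP.exists_GL hI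
  refine ⟨P, Q, Units.ext ?_, by rwa [hPe], hQc, ?_, ?_, ?_⟩
  · have hu : (unipGL n O).1 = block 1 0 1 1 := rfl
    have h2 : (gL * diagGL t).1 * Q.1 = k := by
      rw [← hLU, ← Units.val_mul, ← Units.val_mul, hQ]
      congr 1
      group
    have h3 : (gL * diagGL t).1 *ᵥ 1 = w + k *ᵥ 1 := by
      have h4 : (diagGL t).1 *ᵥ 1 = (gL⁻¹).1 *ᵥ w + gU.1 *ᵥ 1 := by
        ext i
        rw [← htt, coe_diagGL, mulVec_diagonal]
        simp
      rw [Units.val_mul, ← mulVec_mulVec, h4, mulVec_add, mulVec_mulVec, mulVec_mulVec, hLU,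
        ← Units.val_mul, mul_inv_cancel, Units.val_one, one_mulVec]
    have h5 : r' ᵥ* Q.1 = r := by
      rw [hr', vecMul_vecMul, ← Units.val_mul, inv_mul_cancel, Units.val_one, vecMul_one]
    rw [Units.val_mul, Units.val_mul, Units.val_mul, hKb, hPe, hu, coe_iota, block_mul, block_mul,
      block_mul]
    congr 1
    · simp
    · simp [h5]
    · simpa using h3.symm
    · simpa using h2.symm
  · intro i j hij
    rw [hPe, block_succ_succ, Units.val_mul, coe_diagGL, mul_diagonal, hL' i j hij, zero_mul]
  · intro i
    rw [hPe]; rfl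
  · intro i j hij
    rw [hQ, ← map_inv, Units.val_mul, coe_diagGL, diagonal_mul, hU' i j hij, mul_zero]

/-- Conjugation by a power of the uniformizer contracts a parabolic congruence subgroup. -/
lemma exists_conj_diagGL (hI : ∀ x ∈ I, IsUnit (1 + x)) 
    {F : Type u} [Field F] [Algebra O F] (ϖ : Fˣ) (ϖ' : O)
    (hϖ : algebraMap O F ϖ' = ϖ) (l : Fin m → ℤ) {P : GL (Fin m) O} (hP : CongOne I P.1)
    (hl : ∀ i j, P.1 i j ≠ 0 → l j ≤ l i) :
    ∃ P' : GL (Fin m) O, GeneralLinearGroup.map (Ideal.Quotient.mk I) P' = 1 ∧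
      GeneralLinearGroup.map (algebraMap O F) P' * diagGL (fun i => ϖ ^ l i) =
        diagGL (fun i => ϖ ^ l i) * GeneralLinearGroup.map (algebraMap O F) P := by
  -- These are the entries of the conjugate. Truncating a negative exponent to 0 is harmless,
  -- because `hl` makes the corresponding entry of P vanish.
  have hc : CongOne I (Matrix.of fun i j => P.1 i j * ϖ' ^ (l i - l j).toNat) := by
    rw [congOne_iff] at hP ⊢
    refine ⟨fun i => ?_, fun i j hij => ?_⟩
    · simpa using hP.1 i
    · exact Ideal.mul_mem_right _ _ (hP.2 i j hij)
  obtain ⟨P', hP', h1⟩ := hc.exists_GL hI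
  refine ⟨P', h1, Units.ext ?_⟩
  rw [Units.val_mul, Units.val_mul, coe_diagGL]
  ext i j
  rw [mul_diagonal, diagonal_mul]
  change algebraMap O F (P'.1 i j) * _ = _ * algebraMap O F (P.1 i j)
  rw [hP', Matrix.of_apply, map_mul, map_pow, hϖ]
  by_cases h0 : P.1 i j = 0
  · simp [h0]
  · have h2 : ((l i - l j).toNat : ℤ) = l i - l j := Int.toNat_of_nonneg (by linarith [hl i j h0])
    have h3 : (ϖ : F) ^ (l i - l j).toNat * ((ϖ ^ l j : Fˣ) : F) = ((ϖ ^ l i : Fˣ) : F) := by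
      rw [← Units.val_pow_eq_pow_val, ← Units.val_mul, ← zpow_natCast, h2, ← _root_.zpow_add,
        sub_add_cancel]
    rw [mul_assoc, h3, mul_comm]

end Congruence

/-! ### Moving a congruence subgroup past π^α -/

section Contraction
open Matrix GLRing Points

variable {n : ℕ} {R : Type u} [CommRing R] {π : R} (F : LocalFieldOver R π)

lemma LocalFieldOver.pair_mem_congruenceSubgroup (l : ℕ) {a : GL (Fin (n + 1)) F.O}
    {b : GL (Fin n) F.O}
    (ha : GeneralLinearGroup.map (Ideal.Quotient.mk (IsLocalRing.maximalIdeal F.O ^ l)) a = 1)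
    (hb : GeneralLinearGroup.map (Ideal.Quotient.mk (IsLocalRing.maximalIdeal F.O ^ l)) b = 1) :
    pair (mapGL F.incl a) (mapGL F.incl b) ∈ F.congruenceSubgroup (PairRing n R) l := by
  refine ⟨pair a b, ?_, pair_ext ?_ ?_⟩
  · rw [SetLike.mem_coe, MonoidHom.mem_ker]
    refine pair_ext ?_ ?_
    · rw [fst_map, fst_pair, fst_one]; exact ha
    · rw [snd_map, snd_pair, snd_one]; exact hb
  · rw [fst_map, fst_pair, fst_pair]
  · rw [snd_map, snd_pair, snd_pair]

lemma LocalFieldOver.exists_of_mem_congruenceSubgroup {l : ℕ} {g : Points R (PairRing n R) F.K}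
    (hg : g ∈ F.congruenceSubgroup (PairRing n R) l) :
    ∃ (a : GL (Fin (n + 1)) F.O) (b : GL (Fin n) F.O),
      GeneralLinearGroup.map (Ideal.Quotient.mk (IsLocalRing.maximalIdeal F.O ^ l)) a = 1 ∧
      GeneralLinearGroup.map (Ideal.Quotient.mk (IsLocalRing.maximalIdeal F.O ^ l)) b = 1 ∧
      g = pair (mapGL F.incl a) (mapGL F.incl b) := by
  obtain ⟨h, hh, rfl⟩ := hg
  rw [SetLike.mem_coe, MonoidHom.mem_ker] at hh
  refine ⟨h.fst, h.snd, ?_, ?_, ?_⟩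
  · exact (congrArg fst hh).trans fst_one
  · exact (congrArg snd hh).trans snd_one
  · rw [← fst_map, ← snd_map, pair_fst_snd]

lemma LocalFieldOver.fst_map_piPow (b : ℤ) (c d : Fin n → ℤ) :
    (Points.map F.ofAway (piPow π (torusHom R n) (cochar R (exponents b c d)))).fst =
      diagGL fun i => F.unif ^ (Fin.cons b c : Fin (n + 1) → ℤ) i := by
  rw [fst_map, fst_piPow, mapGL, map_diagGL]
  congr 1
  ext i
  simp [exponents, unif]

lemma LocalFieldOver.snd_map_piPow (b : ℤ) (c d : Fin n → ℤ) :
    (Points.map F.ofAway (piPow π (torusHom R n) (cochar R (exponents b c d)))).snd =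
      diagGL fun i => F.unif ^ (-d i) := by
  rw [snd_map, snd_piPow, mapGL, map_diagGL]
  congr 1
  ext i
  simp [exponents, unif]

/-- The element g moves u to K u = P u ι(Q). Conjugation by the torus element keeps P and Q integral
and congruent to 1: P may be nonzero only in its first row and on or below the diagonal, where c ≤ b
and monotonicity of c apply, and Q is upper triangular, where monotonicity of d applies. -/
lemma LocalFieldOver.exists_smul_comm {l : ℕ} (hl : 0 < l) {b : ℤ} {c d : Fin n → ℤ}
    (hc : Monotone c) (hb : ∀ i, c i ≤ b) (hd : Monotone d) {g : Points R (PairRing n R) F.K}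
    (hg : g ∈ F.congruenceSubgroup (PairRing n R) l) :
    ∃ g' ∈ F.congruenceSubgroup (PairRing n R) l,
      Points.map F.ofAway (piPow π (torusHom R n) (cochar R (exponents b c d))) •
        (g • Cosets.map (diag n R) (Algebra.ofId R F.K) (baseCoset n R)) =
      g' • (Points.map F.ofAway (piPow π (torusHom R n) (cochar R (exponents b c d))) •
        Cosets.map (diag n R) (Algebra.ofId R F.K) (baseCoset n R)) := by
  -- Positivity of l enters here: it places the ideal inside 𝔪.
  have hI : ∀ x ∈ IsLocalRing.maximalIdeal F.O ^ l, IsUnit (1 + x) := by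
    intro x hx
    have hx' := Ideal.pow_le_self hl.ne' hx
    by_contra h
    have h1 := Ideal.sub_mem _ ((IsLocalRing.mem_maximalIdeal _).2 h) hx'
    rw [add_sub_cancel_right] at h1
    exact (Ideal.ne_top_iff_one _).1 (IsLocalRing.maximalIdeal.isMaximal F.O).ne_top h1
  obtain ⟨a, a', ha, ha', rfl⟩ := F.exists_of_mem_congruenceSubgroup hg
  -- K is chosen so that K u is the translate of u by (a, a'); it is ≡ 1 because a and a' are.
  obtain ⟨P, Q, hPQ, hP, hQ, hP1, hP2, hQ1⟩ := exists_lower_mul_unipGL_mul_upper hI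
    (K := a * unipGL n F.O * (iota n F.O a')⁻¹ * (unipGL n F.O)⁻¹) (by
      rw [map_mul, map_mul, map_mul, map_inv, map_inv, map_iota, ha, ha', map_one, inv_one, mul_one,
        one_mul, mul_inv_cancel])
  rw [inv_mul_cancel_right] at hPQ
  obtain ⟨P', hP', hPe⟩ := exists_conj_diagGL hI F.unif _ F.coe_unif.symm
    (Fin.cons b c : Fin (n + 1) → ℤ) hP (by
      refine Fin.cases (Fin.cases (fun _ => le_rfl) fun j _ => hb j)
        fun i => Fin.cases (fun h => absurd (hP2 i) h) fun j h => ?_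
      exact hc (not_lt.1 fun hij => h (hP1 i j hij)))
  obtain ⟨Q', hQ', hQe⟩ := exists_conj_diagGL hI F.unif _ F.coe_unif.symm (fun i => -d i) hQ
    fun i j h => neg_le_neg (hd (not_lt.1 fun hij => h (hQ1 i j hij)))
  refine ⟨pair (mapGL F.incl P') (mapGL F.incl Q'⁻¹), F.pair_mem_congruenceSubgroup l hP' ?_, ?_⟩
  · rw [map_inv, hQ', inv_one]
  have hPQF := congrArg (mapGL F.incl) hPQ
  have hu : mapGL F.incl (unipGL n F.O) = unipGL n F.K := map_unipGL _
  simp only [map_mul, map_inv, mapGL_iota, hu] at hPQF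
  have hPe' : mapGL F.incl P' * _ = _ * mapGL F.incl P := hPe
  have hQe' : mapGL F.incl Q' * _ = _ * mapGL F.incl Q := hQe
  rw [map_baseCoset]
  simp only [MulAction.Quotient.smul_coe, smul_eq_mul]
  rw [coset_eq_iff]
  simp only [mu_mul, mu_pair_one, fst_pair, snd_pair, F.fst_map_piPow, F.snd_map_piPow]
  rw [hPQF, map_inv, map_inv, inv_inv, ← mul_assoc, ← mul_assoc, ← hPe',
    eq_mul_inv_iff_mul_eq.2 hQe']
  simp only [map_mul, map_inv]
  group

end Contraction

/-! ### Reduction of matrices over a discretely valued field -/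

section OrbitRepresentatives
open Matrix GLRing Points

section Elementary

variable {n : ℕ} {O : Type u} [CommRing O]

/-- The lower triangular unipotent matrix with first column `(1, s)`. -/
def lowGL (s : Fin n → O) : GL (Fin (n + 1)) O where
  val := block 1 0 s 1
  inv := block 1 0 (-s) 1
  val_inv := by rw [block_mul, ← block_one]; simp
  inv_val := by rw [block_mul, ← block_one]; simp

/-- The upper triangular unipotent matrix with first row `(1, s)`. -/
def upGL (s : Fin n → O) : GL (Fin (n + 1)) O where
  val := block 1 s 0 1
  inv := block 1 (-s) 0 1
  val_inv := by rw [block_mul, ← block_one]; simp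
  inv_val := by rw [block_mul, ← block_one]; simp

/-- The matrix of a permutation. -/
def permGL {m : ℕ} (σ : Equiv.Perm (Fin m)) : GL (Fin m) O where
  val := σ.permMatrix O
  inv := σ⁻¹.permMatrix O
  val_inv := by rw [← permMatrix_mul, inv_mul_cancel, permMatrix_one]
  inv_val := by rw [← permMatrix_mul, mul_inv_cancel, permMatrix_one]

/-- The unipotent matrix `1 + N` for a matrix `N` of square zero. -/
def unipotentGL {m : ℕ} (N : Matrix (Fin m) (Fin m) O) (hN : N * N = 0) : GL (Fin m) O where
  val := 1 + N
  inv := 1 - N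
  val_inv := by rw [add_mul, mul_sub, mul_sub, hN]; simp
  inv_val := by rw [sub_mul, mul_add, mul_add, hN]; simp

variable (K : Type u) [Field K] [Algebra O K]

/-- The matrix over `K` of an invertible matrix over `O`. -/
def toK {m : ℕ} (g : GL (Fin m) O) : Matrix (Fin m) (Fin m) K := g.1.map (algebraMap O K)

lemma toK_mul {m : ℕ} (g h : GL (Fin m) O) : toK K (g * h) = toK K g * toK K h :=
  Matrix.map_mul

lemma toK_one {m : ℕ} : toK K (1 : GL (Fin m) O) = 1 :=
  Matrix.map_one _ (map_zero _) (map_one _)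

lemma toK_iota (g : GL (Fin n) O) : toK K (iota n O g) = block 1 0 0 (toK K g) := by
  rw [toK, coe_iota, map_block, map_one]
  congr 1 <;> (ext; simp)

lemma toK_lowGL (s : Fin n → O) : toK K (lowGL s) = block 1 0 (algebraMap O K ∘ s) 1 := by
  rw [toK, lowGL, map_block, map_one, Matrix.map_one _ (map_zero _) (map_one _)]
  congr 1
  ext; simp

lemma toK_upGL (s : Fin n → O) : toK K (upGL s) = block 1 (algebraMap O K ∘ s) 0 1 := by
  rw [toK, upGL, map_block, map_one, Matrix.map_one _ (map_zero _) (map_one _)]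
  congr 1
  ext; simp

lemma toK_permGL {m : ℕ} (σ : Equiv.Perm (Fin m)) :
    toK K (permGL (O := O) σ) = σ.permMatrix K := by
  ext i j
  simp [toK, permGL, PEquiv.toMatrix_apply, apply_ite]

lemma toK_diagGL {m : ℕ} (t : Fin m → Oˣ) :
    toK K (diagGL t) = diagonal fun i => algebraMap O K (t i) := by
  rw [toK, coe_diagGL, diagonal_map (map_zero _)]

lemma toK_unipotentGL {m : ℕ} (N : Matrix (Fin m) (Fin m) O) (hN : N * N = 0) :
    toK K (unipotentGL N hN) = 1 + N.map (algebraMap O K) := by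
  rw [toK, unipotentGL, Matrix.map_add _ (map_add _), Matrix.map_one _ (map_zero _) (map_one _)]

variable (O) {K}

/-- Two matrices over `K` in the same double coset of `GL_{n+1}(O)` and `GL_n(O)`. -/
def SameOrbit (M N : Matrix (Fin (n + 1)) (Fin (n + 1)) K) : Prop :=
  ∃ (k : GL (Fin (n + 1)) O) (q : GL (Fin n) O), toK K k * M * block 1 0 0 (toK K q) = N

variable {O}

lemma SameOrbit.trans {M N P : Matrix (Fin (n + 1)) (Fin (n + 1)) K} (h : SameOrbit O M N)
    (h' : SameOrbit O N P) : SameOrbit O M P := by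
  obtain ⟨k, q, rfl⟩ := h
  obtain ⟨k', q', rfl⟩ := h'
  refine ⟨k' * k, q * q', ?_⟩
  rw [← toK_iota, ← toK_iota, ← toK_iota, map_mul, toK_mul, toK_mul]
  simp only [mul_assoc]

lemma sameOrbit_left (k : GL (Fin (n + 1)) O) (M : Matrix (Fin (n + 1)) (Fin (n + 1)) K) :
    SameOrbit O M (toK K k * M) :=
  ⟨k, 1, by rw [toK_one, block_one, mul_one]⟩

lemma sameOrbit_block (k q : GL (Fin n) O) (p : K) (w : Fin n → K) (N : Matrix (Fin n) (Fin n) K) :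
    SameOrbit O (block p 0 w N) (block p 0 (toK K k *ᵥ w) (toK K k * N * toK K q)) := by
  refine ⟨iota n O k, q, ?_⟩
  rw [toK_iota, block_mul, block_mul]
  congr 1
  · simp
  · simp
  · simp
  · simp

lemma SameOrbit.det_ne_zero {M N : Matrix (Fin (n + 1)) (Fin (n + 1)) K} (h : SameOrbit O M N)
    (hM : det M ≠ 0) : det N ≠ 0 := by
  obtain ⟨k, q, rfl⟩ := h
  have hdet {m : ℕ} (g : GL (Fin m) O) : det (toK K g) ≠ 0 :=
    ((isUnit_iff_isUnit_det _).1 (GeneralLinearGroup.map (algebraMap O K) g).isUnit).ne_zero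
  rw [← toK_iota, det_mul, det_mul]
  exact mul_ne_zero (mul_ne_zero (hdet k) hM) (hdet _)

end Elementary

section DiscreteValuationRing

variable {n : ℕ} {O : Type u} [CommRing O] [IsDomain O] [IsDiscreteValuationRing O]
variable {K : Type u} [Field K] [Algebra O K] {ϖ : Kˣ} {ϖ' : O}

/-- A sum of two terms of different valuation has the valuation of the smaller one: a multiple of
the uniformizer plus a unit is a unit. -/
lemma exists_unit_add (hirr : Irreducible ϖ') (hϖ : algebraMap O K ϖ' = ϖ) (s : O) (t : Oˣ)
    {m c : ℤ} (h : c < m) : ∃ t' : Oˣ, algebraMap O K s * ((ϖ ^ m : Kˣ) : K) +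
      algebraMap O K t * ((ϖ ^ c : Kˣ) : K) = algebraMap O K t' * ((ϖ ^ c : Kˣ) : K) := by
  obtain ⟨k, hk⟩ : ∃ k : ℕ, m = c + (k + 1) :=
    ⟨(m - c - 1).toNat, by rw [Int.toNat_of_nonneg (by omega)]; ring⟩
  have hu : IsUnit (s * ϖ' ^ (k + 1) + t) := by
    by_contra hn
    have h1 := Ideal.sub_mem _ ((IsLocalRing.mem_maximalIdeal _).2 hn)
      (Ideal.mul_mem_left _ s (Ideal.pow_mem_of_mem _
        ((IsLocalRing.mem_maximalIdeal _).2 hirr.not_isUnit) (k + 1) k.succ_pos))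
    rw [add_sub_cancel_left] at h1
    exact (IsLocalRing.mem_maximalIdeal _).1 h1 t.isUnit
  obtain ⟨t', ht'⟩ := hu
  refine ⟨t', ?_⟩
  have h2 : ((ϖ ^ m : Kˣ) : K) = (ϖ : K) ^ (k + 1) * ((ϖ ^ c : Kˣ) : K) := by
    rw [hk, _root_.zpow_add, Units.val_mul, mul_comm, ← Units.val_pow_eq_pow_val, ← zpow_natCast]
    norm_cast
  rw [ht', map_add, map_mul, map_pow, hϖ, h2]
  ring

variable [IsFractionRing O K]

/-- An entry of least additive valuation, which is the maximum of the multiplicative valuation,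
divides all others; if it is zero, so are they. -/
lemma exists_forall_dvd {ι : Type*} [Finite ι] [Nonempty ι] (f : ι → K) :
    ∃ i₀, ∀ i, ∃ o : O, algebraMap O K o * f i₀ = f i := by
  obtain ⟨i₀, h⟩ := Finite.exists_max fun i =>
    (IsDiscreteValuationRing.maximalIdeal O).valuation K (f i)
  refine ⟨i₀, fun i => ?_⟩
  by_cases h0 : f i₀ = 0
  · have := h i
    rw [h0, map_zero, le_zero_iff, map_eq_zero] at this
    exact ⟨0, by rw [this, h0, mul_zero]⟩
  · obtain ⟨o, ho⟩ := IsDiscreteValuationRing.exists_lift_of_le_one (A := O) (K := K)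
      (x := f i / f i₀) (by
        rw [map_div₀]
        exact div_le_one_of_le₀ (h i) zero_le)
    exact ⟨o, by rw [ho, div_mul_cancel₀ _ h0]⟩

variable (O) in
/-- Smith normal form over the fraction field of a discrete valuation ring. -/
lemma exists_smith : ∀ {n : ℕ} (N : Matrix (Fin n) (Fin n) K),
    ∃ (k q : GL (Fin n) O) (δ : Fin n → K), toK K k * N * toK K q = diagonal δ
  | 0, N => ⟨1, 1, 0, Subsingleton.elim _ _⟩
  | n + 1, N => by
    -- The pivot is an entry dividing all the others. Swapped to the corner, it clears its row and
    -- column by integral operations.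
    obtain ⟨⟨i₀, j₀⟩, h⟩ := exists_forall_dvd (O := O)
      fun x : Fin (n + 1) × Fin (n + 1) => N x.1 x.2
    let σ := Equiv.swap 0 i₀
    let τ := Equiv.swap 0 j₀
    have h1 : toK K (permGL (O := O) σ) * N * toK K (permGL (O := O) τ) = N.submatrix σ τ := by
      rw [toK_permGL, toK_permGL, PEquiv.toMatrix_toPEquiv_mul, PEquiv.mul_toMatrix_toPEquiv,
        submatrix_submatrix]
      rfl
    have h2 (i j) : ∃ o : O, algebraMap O K o * N.submatrix σ τ 0 0 = N.submatrix σ τ i j := by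
      simpa [σ, τ] using h (σ i, τ j)
    rw [eq_block (N.submatrix σ τ)] at h1
    choose s hs using fun i : Fin n => h2 i.succ 0
    choose t ht using fun j : Fin n => h2 0 j.succ
    generalize N.submatrix σ τ 0 0 = p at *
    have hr : (fun j => N.submatrix σ τ 0 (Fin.succ j)) = p • (algebraMap O K ∘ t) := by
      ext j
      rw [← ht, mul_comm]
      rfl
    have hw : (fun i => N.submatrix σ τ (Fin.succ i) 0) = p • (algebraMap O K ∘ s) := by
      ext i
      rw [← hs, mul_comm]
      rfl
    rw [hw, hr] at h1
    obtain ⟨k, q, δ, hδ⟩ := exists_smith ((N.submatrix σ τ).submatrix Fin.succ Fin.succ -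
      p • vecMulVec (algebraMap O K ∘ s) (algebraMap O K ∘ t))
    refine ⟨iota n O k * lowGL (-s) * permGL σ, permGL τ * upGL (-t) * iota n O q, Fin.cons p δ, ?_⟩
    have hneg (x : Fin n → O) : algebraMap O K ∘ (-x) = - (algebraMap O K ∘ x) := by
      ext; simp
    calc _ = toK K (iota n O k) * (toK K (lowGL (-s)) *
          (toK K (permGL (O := O) σ) * N * toK K (permGL (O := O) τ)) * toK K (upGL (-t))) *
          toK K (iota n O q) := by simp only [toK_mul, mul_assoc]
      _ = _ := by
        rw [h1, toK_iota, toK_iota, toK_lowGL, toK_upGL, hneg, hneg, block_mul, block_mul,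
          block_mul, block_mul, diagonal_cons, ← hδ]
        congr 1
        · simp
        · simp
        · simp
        · simp [sub_eq_add_neg, add_comm]

lemma exists_unit_mul_zpow (hirr : Irreducible ϖ') (hϖ : algebraMap O K ϖ' = ϖ) {x : K}
    (hx : x ≠ 0) : ∃ (t : Oˣ) (m : ℤ), x = algebraMap O K t * ((ϖ ^ m : Kˣ) : K) := by
  obtain ⟨a, b, hb, rfl⟩ := IsFractionRing.div_surjective (A := O) x
  have hb0 : b ≠ 0 := nonZeroDivisors.ne_zero hb
  have ha0 : a ≠ 0 := by
    rintro rfl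
    simp at hx
  obtain ⟨i, s, rfl⟩ := IsDiscreteValuationRing.eq_unit_mul_pow_irreducible ha0 hirr
  obtain ⟨j, t, rfl⟩ := IsDiscreteValuationRing.eq_unit_mul_pow_irreducible hb0 hirr
  refine ⟨s * t⁻¹, i - j, ?_⟩
  have ht : algebraMap O K (t⁻¹ : Oˣ) = (algebraMap O K t)⁻¹ :=
    eq_inv_of_mul_eq_one_left (by rw [← map_mul]; simp)
  rw [Units.val_mul, map_mul, map_mul, map_mul, map_pow, map_pow, hϖ, ht, _root_.zpow_sub,
    Units.val_mul, Units.val_inv_eq_inv_val, zpow_natCast, zpow_natCast, Units.val_pow_eq_pow_val,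
    Units.val_pow_eq_pow_val, div_eq_mul_inv, mul_inv]
  ring

variable (O) in
-- Row 0 of x⁻¹ annihilates all columns of x except column 0. Divided by an entry of least valuation
-- it is integral with one entry equal to 1, so after a permutation it is the first row of a
-- unipotent matrix over O, and left multiplication by that matrix clears the first row of x beyond
-- the corner.
lemma exists_sameOrbit_block (x : GL (Fin (n + 1)) K) :
    ∃ (p : K) (w : Fin n → K) (N : Matrix (Fin n) (Fin n) K), SameOrbit O x.1 (block p 0 w N) := by
  obtain ⟨i₀, h⟩ := exists_forall_dvd (O := O) fun i => (x⁻¹).1 0 i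
  choose o ho using h
  have hx (j : Fin (n + 1)) : ∑ i, (x⁻¹).1 0 i * x.1 i j =
      (1 : Matrix (Fin (n + 1)) (Fin (n + 1)) K) 0 j := by
    rw [← Matrix.mul_apply, ← Units.val_mul, inv_mul_cancel, Units.val_one]
  have h0 : (x⁻¹).1 0 i₀ ≠ 0 := by
    intro h0
    have h1 := hx 0
    have h2 (i) : (x⁻¹).1 0 i = 0 := by rw [← ho, h0, mul_zero]
    simp only [h2, zero_mul, Finset.sum_const_zero, one_apply_eq] at h1
    exact zero_ne_one h1
  have ho1 : algebraMap O K (o i₀) = 1 := mul_right_cancel₀ h0 (by rw [ho, one_mul])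
  let σ := Equiv.swap 0 i₀
  have h3 := (sameOrbit_left (permGL (O := O) σ) x.1).trans
    (sameOrbit_left (upGL fun i => o (σ i.succ)) _)
  have h4 : (fun j => (toK K (upGL fun i => o (σ (Fin.succ i))) *
      (toK K (permGL (O := O) σ) * x.1)) 0 (Fin.succ j)) = 0 := by
    ext j
    refine mul_left_cancel₀ h0 ?_
    have h1 := hx j.succ
    rw [one_apply_ne (Fin.succ_ne_zero j).symm, ← Equiv.sum_comp σ, Fin.sum_univ_succ] at h1
    rw [Pi.zero_apply, mul_zero, ← h1, toK_permGL, PEquiv.toMatrix_toPEquiv_mul, toK_upGL,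
      Matrix.mul_apply, Fin.sum_univ_succ, mul_add, Finset.mul_sum]
    have h2 (i) : (x⁻¹).1 0 i = algebraMap O K (o i) * (x⁻¹).1 0 i₀ := (ho i).symm
    congr 1
    · simp [σ]
    · refine Finset.sum_congr rfl fun i _ => ?_
      rw [h2 (σ i.succ)]
      simp
      ring
  rw [eq_block (toK K (upGL _) * _), h4] at h3
  exact ⟨_, _, _, h3⟩

variable (O) in
-- Smith's form acts on the lower block while preserving the shape. The determinant keeps all
-- diagonal entries nonzero; their units are then absorbed by diagonal matrices and the exponents
-- sorted by a permutation.
lemma exists_sameOrbit_diagonal (hirr : Irreducible ϖ') (hϖ : algebraMap O K ϖ' = ϖ)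
    (x : GL (Fin (n + 1)) K) :
    ∃ (b : ℤ) (w : Fin n → K) (a : Fin n → ℤ), Monotone a ∧
      SameOrbit O x.1 (block ((ϖ ^ b : Kˣ) : K) 0 w (diagonal fun i => ((ϖ ^ a i : Kˣ) : K))) := by
  obtain ⟨p, w, N, h⟩ := exists_sameOrbit_block O x
  obtain ⟨k, q, δ, hδ⟩ := exists_smith O N
  have h1 := h.trans (sameOrbit_block k q _ _ _)
  rw [hδ] at h1
  have hdet := h1.det_ne_zero ((isUnit_iff_isUnit_det _).1 x.isUnit).ne_zero
  rw [det_block_zero, det_diagonal, mul_ne_zero_iff, Finset.prod_ne_zero_iff] at hdet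
  obtain ⟨s, b, rfl⟩ := exists_unit_mul_zpow hirr hϖ hdet.1
  choose t a hta using fun i => exists_unit_mul_zpow hirr hϖ (hdet.2 i (Finset.mem_univ i))
  let σ := Tuple.sort a
  have h2 := (h1.trans (sameOrbit_block (permGL σ) (permGL σ⁻¹) _ _ _)).trans
    (sameOrbit_block 1 (diagGL fun i => (t (σ i))⁻¹) _ _ _)
  have h3 := h2.trans (sameOrbit_left (diagGL (Fin.cons s⁻¹ 1)) _)
  have hinv (t : Oˣ) : algebraMap O K (t⁻¹ : Oˣ) * algebraMap O K t = 1 := by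
    rw [← map_mul]; simp
  have h4 : toK K (diagGL (S := O) (Fin.cons s⁻¹ (1 : Fin n → Oˣ))) =
      block (algebraMap O K (s⁻¹ : Oˣ)) 0 0 1 := by
    rw [toK_diagGL, ← diagonal_one, ← diagonal_cons]
    congr 1
    ext i
    refine Fin.cases ?_ (fun i => ?_) i <;> simp
  have h5 : toK K (1 : GL (Fin n) O) * (toK K (permGL (O := O) σ) * diagonal δ *
      toK K (permGL (O := O) σ⁻¹)) * toK K (diagGL fun i => (t (σ i))⁻¹) =
      diagonal fun i => ((ϖ ^ (a ∘ σ) i : Kˣ) : K) := by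
    rw [toK_one, one_mul, toK_permGL, toK_permGL, PEquiv.toMatrix_toPEquiv_mul,
      PEquiv.mul_toMatrix_toPEquiv, toK_diagGL]
    ext i j
    rw [mul_diagonal, submatrix_apply, submatrix_apply]
    by_cases hij : i = j
    · subst hij
      have h6 : (Equiv.symm σ⁻¹) i = σ i := rfl
      rw [h6, id, id, diagonal_apply_eq, diagonal_apply_eq, hta, mul_right_comm,
        mul_comm (algebraMap O K _), hinv, one_mul]
      rfl
    · have h6 : σ i ≠ (Equiv.symm σ⁻¹) j := fun h => hij (σ.injective h)
      rw [id, id, diagonal_apply_ne _ h6, diagonal_apply_ne _ hij, zero_mul]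
  rw [h5, h4, block_mul] at h3
  simp only [zero_dotProduct, add_zero, smul_zero, zero_vecMul, ← mul_assoc, hinv, one_mul,
    vecMulVec_zero, zero_add] at h3
  exact ⟨b, _, a ∘ σ, Tuple.monotone_sort a, h3⟩

/-- Adding ϖ^max(a_i - a_l, 0) times row l to row i can be undone on the diagonal block by an
integral column operation. The least valuation obtainable this way in row i is c_i = min_l (m_l +
max(a_i - a_l, 0)), and its subadditivity makes both c and a - c monotone. -/
lemma sameOrbit_repGL (hirr : Irreducible ϖ') (hϖ : algebraMap O K ϖ' = ϖ)
    (b : ℤ) (w : Fin n → K) (a : Fin n → ℤ) (ha : Monotone a) :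
    ∃ (c d : Fin n → ℤ), Monotone c ∧ (∀ i, c i ≤ b) ∧ Monotone d ∧
      SameOrbit O (block ((ϖ ^ b : Kˣ) : K) 0 w (diagonal fun i => ((ϖ ^ a i : Kˣ) : K)))
        (repGL ϖ b c d).1 := by
  -- the first column can be given nonzero entries of valuation at most `b`
  obtain ⟨s, t, m, hm, hs⟩ : ∃ (s : Fin n → O) (t : Fin n → Oˣ) (m : Fin n → ℤ), (∀ i, m i ≤ b) ∧
      ∀ i, algebraMap O K (s i) * ((ϖ ^ b : Kˣ) : K) + w i =
        algebraMap O K (t i) * ((ϖ ^ m i : Kˣ) : K) := by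
    have h (i) : ∃ (s : O) (t : Oˣ) (m : ℤ), m ≤ b ∧ algebraMap O K s * ((ϖ ^ b : Kˣ) : K) + w i =
        algebraMap O K t * ((ϖ ^ m : Kˣ) : K) := by
      -- Row 0 is added exactly when the entry is zero or has valuation above b; the result then has
      -- valuation b.
      by_cases h0 : w i = 0
      · exact ⟨1, 1, b, le_rfl, by simp [h0]⟩
      · obtain ⟨t, m, htm⟩ := exists_unit_mul_zpow hirr hϖ h0
        rcases le_or_gt m b with hmb | hmb
        · exact ⟨0, t, m, hmb, by simp [htm]⟩
        · obtain ⟨t', ht'⟩ := exists_unit_add hirr hϖ t 1 hmb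
          refine ⟨1, t', b, le_rfl, ?_⟩
          rw [← ht', htm]
          simp [add_comm]
    choose s t m hm hs using h
    exact ⟨s, t, m, hm, hs⟩
  have h1 : SameOrbit O (block ((ϖ ^ b : Kˣ) : K) 0 w (diagonal fun i => ((ϖ ^ a i : Kˣ) : K)))
      (block ((ϖ ^ b : Kˣ) : K) 0 (fun i => algebraMap O K (t i) * ((ϖ ^ m i : Kˣ) : K))
        (diagonal fun i => ((ϖ ^ a i : Kˣ) : K))) := by
    have := sameOrbit_left (lowGL s)
      (block ((ϖ ^ b : Kˣ) : K) 0 w (diagonal fun i => ((ϖ ^ a i : Kˣ) : K)))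
    rw [toK_lowGL, block_mul] at this
    convert this using 2
    · simp
    · simp
    · ext i
      refine (hs i).symm.trans ?_
      simp [mul_comm]
    · simp
  -- minimal valuations reachable by row operations compatible with `a`
  have hmin (i : Fin n) : ∃ j, ∀ l, m j + max (a i - a j) 0 ≤ m l + max (a i - a l) 0 :=
    haveI : Nonempty (Fin n) := ⟨i⟩
    Finite.exists_min _
  choose j hj using hmin
  set c : Fin n → ℤ := fun i => m (j i) + max (a i - a (j i)) 0 with hc
  have hci (i l) : c i ≤ m l + max (a i - a l) 0 := hj i l
  have hcm (i) : c i ≤ m i := by simpa using hci i i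
  have hcc (i l) : c i ≤ c l + max (a i - a l) 0 := by
    have := hci i (j l)
    simp only [hc]
    simp only [hc] at this
    omega
  -- A row realizing a minimum is already minimal for itself. Rows used as sources are thus never
  -- modified, which is why N and N' square to zero.
  have hgood (i) : c (j i) = m (j i) := by
    refine le_antisymm (hcm _) ?_
    have := hcc i (j i)
    simp only [hc] at this ⊢
    omega
  let N : Matrix (Fin n) (Fin n) O := Matrix.of fun i l =>
    if c i < m i ∧ l = j i then ϖ' ^ (a i - a l).toNat else 0
  let N' : Matrix (Fin n) (Fin n) O := Matrix.of fun i l =>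
    if c i < m i ∧ l = j i then ϖ' ^ (a l - a i).toNat else 0
  have hN : N * N = 0 := by
    ext i l
    rw [Matrix.mul_apply]
    refine Finset.sum_eq_zero fun r _ => ?_
    by_cases hr : r = j i
    · subst hr
      simp [N, hgood]
    · simp [N, hr]
  have hN' : N' * N' = 0 := by
    ext i l
    rw [Matrix.mul_apply]
    refine Finset.sum_eq_zero fun r _ => ?_
    by_cases hr : r = j i
    · subst hr
      simp [N', hgood]
    · simp [N', hr]
  have hpow (k : ℕ) : algebraMap O K (ϖ' ^ k) = ((ϖ ^ (k : ℤ) : Kˣ) : K) := by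
    rw [map_pow, hϖ, zpow_natCast, Units.val_pow_eq_pow_val]
  have hcomm : toK K (unipotentGL N hN) * (diagonal fun i => ((ϖ ^ a i : Kˣ) : K)) =
      (diagonal fun i => ((ϖ ^ a i : Kˣ) : K)) * toK K (unipotentGL N' hN') := by
    rw [toK_unipotentGL, toK_unipotentGL, add_mul, mul_add, one_mul, mul_one]
    congr 1
    ext i l
    rw [mul_diagonal, diagonal_mul, Matrix.map_apply, Matrix.map_apply]
    simp only [N, N', Matrix.of_apply]
    split_ifs with h
    · rw [hpow, hpow, ← Units.val_mul, ← Units.val_mul, ← _root_.zpow_add, ← _root_.zpow_add]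
      congr 2
      omega
    · simp
  obtain ⟨t', ht'⟩ : ∃ t' : Fin n → Oˣ, toK K (unipotentGL N hN) *ᵥ
      (fun i => algebraMap O K (t i) * ((ϖ ^ m i : Kˣ) : K)) =
      fun i => algebraMap O K (t' i) * ((ϖ ^ c i : Kˣ) : K) := by
    have h (i) : ∃ t' : Oˣ, (toK K (unipotentGL N hN) *ᵥ
        (fun i => algebraMap O K (t i) * ((ϖ ^ m i : Kˣ) : K))) i =
        algebraMap O K t' * ((ϖ ^ c i : Kˣ) : K) := by
      rw [toK_unipotentGL, add_mulVec, one_mulVec, Pi.add_apply, mulVec, dotProduct]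
      by_cases hi : c i < m i
      · rw [Finset.sum_eq_single (j i)]
        · obtain ⟨t', h'⟩ := exists_unit_add hirr hϖ (t i) (t (j i)) hi
          refine ⟨t', ?_⟩
          rw [← h']
          congr 1
          simp only [N, Matrix.map_apply, Matrix.of_apply, hi, true_and, if_true]
          rw [hpow, mul_left_comm, ← Units.val_mul, ← _root_.zpow_add]
          congr 3
          simp only [hc]
          omega
        · intro l _ hl
          simp [N, hl]
        · simp
      · refine ⟨t i, ?_⟩
        rw [Finset.sum_eq_zero, add_zero, le_antisymm (hcm i) (not_lt.1 hi)]
        intro l _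
        simp [N, hi]
    choose t' ht' using h
    exact ⟨t', funext ht'⟩
  have h2 := h1.trans (sameOrbit_block (unipotentGL N hN) (unipotentGL N' hN')⁻¹ _ _ _)
  rw [hcomm, mul_assoc, ← toK_mul, mul_inv_cancel, toK_one, mul_one, ht'] at h2
  have h3 := h2.trans (sameOrbit_block (diagGL t'⁻¹) (diagGL t') _ _ _)
  have hinv (t : Oˣ) : algebraMap O K (t⁻¹ : Oˣ) * algebraMap O K t = 1 := by
    rw [← map_mul]; simp
  -- For i ≤ l one has a_i ≤ a_l. Then `hcc i l` gives c_i ≤ c_l, and `hcc l i` gives c_l - c_i ≤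
  -- a_l - a_i.
  refine ⟨c, a - c, fun i l hil => ?_, fun i => (hcm i).trans (hm i), fun i l hil => ?_, ?_⟩
  · have := hcc i l
    rw [max_eq_right (by linarith [ha hil])] at this
    linarith
  · have := hcc l i
    rw [max_eq_left (by linarith [ha hil])] at this
    simp only [Pi.sub_apply]
    linarith
  · rw [coe_repGL]
    convert h3 using 2
    · ext i
      rw [toK_diagGL, mulVec_diagonal, ← mul_assoc, Pi.inv_apply, hinv, one_mul]
    · rw [toK_diagGL, toK_diagGL, diagonal_mul_diagonal, diagonal_mul_diagonal]
      congr 1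
      ext i
      rw [mul_right_comm, Pi.inv_apply, hinv, one_mul]
      simp

end DiscreteValuationRing

variable {n : ℕ} {R : Type u} [CommRing R] {π : R}

lemma LocalFieldOver.exists_mem_piOrbit (F : LocalFieldOver R π) (z : Cosets (diag n R) F.K) :
    ∃ x ∈ piOrbit π (diag n R) (torusHom R n) (dominant n R) {baseCoset n R},
      z ∈ MulAction.orbit (F.congruenceSubgroup (PairRing n R) 0)
        (Cosets.map (diag n R) F.ofAway x) := by
  obtain ⟨g, rfl⟩ := QuotientGroup.mk_surjective z
  obtain ⟨b, w, a, ha, h1⟩ := exists_sameOrbit_diagonal F.O F.irreducible F.coe_unif.symm g.mu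
  obtain ⟨c, d, hc, hb, hd, h2⟩ := sameOrbit_repGL F.irreducible F.coe_unif.symm b w a ha
  obtain ⟨k, q, hkq⟩ := h1.trans h2
  refine ⟨repCoset (awayUnit π) b c d, (mem_piOrbit_iff π _).2 ⟨b, c, d, hc, hb, hd, rfl⟩, ?_⟩
  -- K_0 imposes no congruence: 𝔪⁰ is the unit ideal.
  have htriv (m : ℕ) (x : GL (Fin m) F.O) :
      GeneralLinearGroup.map (Ideal.Quotient.mk (IsLocalRing.maximalIdeal F.O ^ 0)) x = 1 := by
    have : Subsingleton (F.O ⧸ IsLocalRing.maximalIdeal F.O ^ 0) := by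
      rw [pow_zero, Ideal.one_eq_top]; exact Ideal.Quotient.subsingleton_iff.2 rfl
    exact Subsingleton.elim _ _
  have hmem := F.pair_mem_congruenceSubgroup (R := R) 0 (htriv _ k⁻¹) (htriv _ q)
  refine ⟨⟨_, hmem⟩, ?_⟩
  have h3 : mapGL F.incl k * g.mu * iota n F.K (mapGL F.incl q) = repGL F.unif b c d :=
    Units.ext (by
      rw [Units.val_mul, Units.val_mul, coe_iota]
      exact hkq)
  change _ • Cosets.map (diag n R) F.ofAway (repCoset (awayUnit π) b c d) = _
  rw [map_repCoset]
  change (pair (mapGL F.incl k⁻¹) (mapGL F.incl q) : Points R (PairRing n R) F.K) •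
    ((pair (repGL F.unif b c d) 1 : Points R (PairRing n R) F.K) : Cosets (diag n R) F.K) = _
  rw [MulAction.Quotient.smul_coe, smul_eq_mul, coset_eq_iff, mu_mul, mu_pair_one,
    fst_pair, snd_pair, ← h3, map_inv]
  group

end OrbitRepresentatives

/-! ### A smoothness criterion for closures of transporters -/

section TransporterGeneral

variable {R : Type u} [CommRing R] {A B : Type u} [CommRing A] [HopfAlgebra R A] [CommRing B]
  [HopfAlgebra R B]

/-- A criterion for the closure of a transporter to be smooth: it suffices to find a smooth closed
subscheme `Spec Q` of `G` that contains the transporter and whose coordinate ring embeds into the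
functions on the transporter. -/
lemma smooth_quotient_transporterIdeal (φ : A →ₐc[R] B) {L : Type u} [CommRing L] [Algebra R L]
    (x y : Cosets φ L) {Q Q' : Type u} [CommRing Q] [Algebra R Q] [Algebra.Smooth R Q]
    [CommRing Q'] [Algebra R Q'] (q : A →ₐ[R] Q) (hq : Function.Surjective q) (i : Q →ₐ[R] Q')
    (hi : Function.Injective i) (j : L →ₐ[R] Q')
    (hT : Points.of (i.comp q) • Cosets.map φ j x = Cosets.map φ j y)
    (huniv : ∀ (S : Type u) [CommRing S] [Algebra R S] (j : L →ₐ[R] S) (g : Points R A S),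
      g • Cosets.map φ j x = Cosets.map φ j y → ∃ e : Q →ₐ[R] S, g.hom = e.comp q) :
    Algebra.Smooth R (A ⧸ transporterIdeal φ x y) := by
  -- Functions killed by q vanish on every transporter point because such points factor through q;
  -- conversely, testing on the single point over Q' and using injectivity of i gives the other
  -- inclusion.
  have hker : RingHom.ker q = transporterIdeal φ x y := by
    ext a
    constructor
    · intro ha S _ _ j g hg
      obtain ⟨e, he⟩ := huniv S j g hg
      rw [he, AlgHom.comp_apply, (RingHom.mem_ker).1 ha, map_zero]
    · intro ha
      refine (RingHom.mem_ker).2 (hi ?_)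
      rw [map_zero]
      exact ha Q' j _ hT
  exact Algebra.Smooth.of_equiv ((Ideal.quotientKerAlgEquivOfSurjective hq).symm.trans
    (Ideal.quotientEquivAlgOfEq R hker))

end TransporterGeneral

/-! ### Equations and closures of the transporters -/

section Transporter
open Matrix GLRing Points

variable {n : ℕ} {R : Type u} [CommRing R] {π : R}

/-- Both representatives have first row (unit, 0), which forces the same shape on g; the rest is
comparison of blocks. -/
lemma mul_repGL_eq_iff {S : Type u} [CommRing S] (ϖ : Sˣ) (b b' : ℤ) (c d c' d' : Fin n → ℤ)
    (g : GL (Fin (n + 1)) S) (h : GL (Fin n) S) :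
    g * repGL ϖ b c d = repGL ϖ b' c' d' * iota n S h ↔
      ∃ (p : S) (w : Fin n → S) (k : Matrix (Fin n) (Fin n) S), g.1 = block p 0 w k ∧
        p * ((ϖ ^ b : Sˣ) : S) = ((ϖ ^ b' : Sˣ) : S) ∧
        (∀ i, w i * ((ϖ ^ b : Sˣ) : S) + ∑ j, k i j * ((ϖ ^ c j : Sˣ) : S) =
          ((ϖ ^ c' i : Sˣ) : S)) ∧
        ∀ i j, k i j * ((ϖ ^ (c j + d j) : Sˣ) : S) = ((ϖ ^ (c' i + d' i) : Sˣ) : S) * h.1 i j := by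
  rw [Units.ext_iff, Units.val_mul, Units.val_mul, coe_repGL, coe_repGL, coe_iota]
  obtain ⟨p, r, w, k, hg⟩ : ∃ p r w k, g.1 = block p r w k := ⟨_, _, _, _, eq_block _⟩
  rw [hg, block_mul, block_mul, eq_block_iff]
  have hw (i) : (((ϖ ^ b : Sˣ) : S) • w + k *ᵥ fun i => ((ϖ ^ c i : Sˣ) : S)) i =
      w i * ((ϖ ^ b : Sˣ) : S) + ∑ j, k i j * ((ϖ ^ c j : Sˣ) : S) := by
    rw [Pi.add_apply, Pi.smul_apply, smul_eq_mul, mul_comm]; rfl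
  simp only [block_zero_zero, block_zero_succ, block_succ_zero, block_succ_succ, hw]
  constructor
  · rintro ⟨h1, h2, h3, h4⟩
    obtain rfl : r = 0 := by
      ext j
      have := h2 j
      simp only [smul_zero, zero_add, vecMul_diagonal, zero_vecMul, add_zero, Pi.zero_apply] at this
      exact (Units.mul_left_eq_zero _).1 this
    refine ⟨p, w, k, rfl, ?_, fun i => ?_, fun i j => ?_⟩
    · simpa using h1
    · simpa using h3 i
    · have := h4 i j
      simpa [mul_diagonal, diagonal_mul, vecMulVec_apply] using this
  · rintro ⟨p', w', k', he, h1, h2, h3⟩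
    obtain ⟨e1, e2, e3, e4⟩ := eq_block_iff.1 he
    simp only [block_zero_zero, block_zero_succ, block_succ_zero, block_succ_succ] at e1 e2 e3 e4
    obtain rfl : p = p' := e1
    obtain rfl : r = 0 := funext e2
    obtain rfl : w = w' := funext e3
    obtain rfl : k = k' := Matrix.ext e4
    refine ⟨?_, fun j => ?_, fun i => ?_, fun i j => ?_⟩
    · simpa using h1
    · simp
    · simpa using h2 i
    · simpa [mul_diagonal, diagonal_mul, vecMulVec_apply] using h3 i j

/-- The homomorphism from `R[π⁻¹]` to an algebra in which `π` is a unit. -/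
def awayHom {S : Type u} [CommRing S] [Algebra R S] (h : IsUnit (algebraMap R S π)) :
    Localization.Away π →ₐ[R] S :=
  IsLocalization.Away.liftAlgHom (f := Algebra.ofId R S) π h

lemma val_map_awayUnit {S : Type u} [CommRing S] [Algebra R S] (j : Localization.Away π →ₐ[R] S) :
    (Units.map (j : Localization.Away π →* S) (awayUnit π) : S) = algebraMap R S π :=
  j.commutes π

lemma coe_toNat_pow {S : Type u} [CommRing S] [Algebra R S] {ϖ : Sˣ}
    (hϖ : algebraMap R S π = ϖ) (k : ℤ) :
    algebraMap R S (π ^ k.toNat) = ((ϖ ^ max k 0 : Sˣ) : S) := by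
  rw [map_pow, hϖ, ← Int.toNat_eq_max, zpow_natCast, Units.val_pow_eq_pow_val]

/-! ### The case where `π` is invertible on the closure -/

section Invertible

/-- Where π is invertible, g₁ is determined by g₂, so the transporter is GL_n over R[π⁻¹]. If π⁻¹ is
a restriction of a function on G, the transporter is already closed in G, and its coordinate ring is
a localization of that of GL_n. -/
lemma smooth_of_inverse_mem_range_aux (b b' : ℤ) (c d c' d' : Fin n → ℤ)
    (h : ∀ (S : Type u) [CommRing S] [Algebra R S] (ϖ : Sˣ) (g : Points R (PairRing n R) S),
      algebraMap R S π = ϖ → g.fst * repGL ϖ b c d = repGL ϖ b' c' d' * iota n S g.snd →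
      ((ϖ⁻¹ : Sˣ) : S) ∈ g.hom.range)
    {Q : Type u} [CommRing Q] [Algebra R Q] [Algebra (GLRing n R) Q]
    [IsScalarTower R (GLRing n R) Q] [IsLocalization.Away (algebraMap R (GLRing n R) π) Q]
    [Algebra.Smooth R Q] :
    Algebra.Smooth R (PairRing n R ⧸ transporterIdeal (diag n R)
      (repCoset (awayUnit π) b c d) (repCoset (awayUnit π) b' c' d')) := by
  have hunit : IsUnit (algebraMap R Q π) := by
    have := IsLocalization.Away.algebraMap_isUnit (S := Q) (algebraMap R (GLRing n R) π)
    rwa [← IsScalarTower.algebraMap_apply] at this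
  obtain ⟨j⟩ : Nonempty (Localization.Away π →ₐ[R] Q) := ⟨awayHom hunit⟩
  obtain ⟨ϖ, hϖd⟩ : ∃ ϖ : Qˣ, ϖ = Units.map (j : Localization.Away π →* Q) (awayUnit π) := ⟨_, rfl⟩
  have hϖ : algebraMap R Q π = ϖ := by rw [hϖd]; exact (val_map_awayUnit j).symm
  obtain ⟨i, hi⟩ : ∃ i : GLRing n R →ₐ[R] Q, ∀ a, i a = algebraMap _ Q a :=
    ⟨IsScalarTower.toAlgHom R _ _, fun _ => rfl⟩
  obtain ⟨q, hq1, hq2⟩ : ∃ q : Points R (PairRing n R) Q,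
      q.fst = repGL ϖ b' c' d' * iota n _ (toGL i) * (repGL ϖ b c d)⁻¹ ∧ q.snd = toGL i :=
    ⟨pair _ _, fst_pair _ _, snd_pair _ _⟩
  have hT : q.fst * repGL ϖ b c d = repGL ϖ b' c' d' * iota n _ q.snd := by
    rw [hq1, hq2, inv_mul_cancel_right]
  refine smooth_quotient_transporterIdeal (diag n R) _ _ q.hom ?_ (AlgHom.id R Q)
    Function.injective_id j ?_ ?_
  · have hmem := h _ ϖ q hϖ hT
    intro x
    change x ∈ q.hom.range
    obtain ⟨k, a, hk⟩ := IsLocalization.Away.surj (algebraMap R (GLRing n R) π) x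
    have hx : x = i a * ((ϖ⁻¹ : Qˣ) : Q) ^ k := by
      have h1 : x * (ϖ : Q) ^ k = i a := by
        rw [hi, ← hϖ, ← hk, IsScalarTower.algebraMap_apply R (GLRing n R) Q]
      rw [← h1, mul_assoc, ← mul_pow, Units.mul_inv, one_pow, mul_one]
    rw [hx]
    refine mul_mem ⟨1 ⊗ₜ a, ?_⟩ (pow_mem hmem k)
    have h2 : q.hom.comp Algebra.TensorProduct.includeRight = i := toGL_injective hq2
    exact DFunLike.congr_fun h2 a
  · rw [AlgHom.id_comp, map_repCoset, map_repCoset, smul_repCoset_eq_iff, ← hϖd]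
    exact hT
  · intro S _ _ j' g hg
    rw [map_repCoset, map_repCoset, smul_repCoset_eq_iff] at hg
    have hu : IsUnit ((g.hom.comp Algebra.TensorProduct.includeRight : GLRing n R →ₐ[R] S)
        (algebraMap R (GLRing n R) π)) := by
      rw [AlgHom.commutes, ← val_map_awayUnit j']
      exact Units.isUnit _
    obtain ⟨e, he⟩ : ∃ e : Q →ₐ[R] S, e.comp i =
        g.hom.comp Algebra.TensorProduct.includeRight := by
      refine ⟨IsLocalization.Away.liftAlgHom
        (f := g.hom.comp Algebra.TensorProduct.includeRight) _ hu, AlgHom.ext fun a => ?_⟩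
      rw [AlgHom.comp_apply, hi]
      exact IsLocalization.Away.lift_eq _ hu a
    have hsnd : mapGL e q.snd = g.snd := by
      rw [hq2, snd, ← he, toGL_comp e i]
    have heϖ : Units.map (e : Q →* S) ϖ =
        Units.map (j' : Localization.Away π →* S) (awayUnit π) := by
      ext
      rw [val_map_awayUnit, Units.coe_map, ← hϖ]
      exact e.commutes π
    have hT' := congrArg (mapGL e) hT
    have hmap (b : ℤ) (c d : Fin n → ℤ) : mapGL e (repGL ϖ b c d) =
        repGL (Units.map (j' : Localization.Away π →* S) (awayUnit π)) b c d := by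
      rw [← heϖ]; exact map_repGL _ _ _ _ _
    rw [map_mul, map_mul, mapGL_iota, hsnd, hmap, hmap, ← hg] at hT'
    refine ⟨e, congrArg hom (pair_ext (h := Points.map e q) ?_ ?_)⟩
    · rw [fst_map]
      exact (mul_right_cancel hT').symm
    · rw [snd_map, hsnd]

lemma smooth_of_inverse_mem_range (b b' : ℤ) (c d c' d' : Fin n → ℤ)
    (h : ∀ (S : Type u) [CommRing S] [Algebra R S] (ϖ : Sˣ) (g : Points R (PairRing n R) S),
      algebraMap R S π = ϖ → g.fst * repGL ϖ b c d = repGL ϖ b' c' d' * iota n S g.snd →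
      ((ϖ⁻¹ : Sˣ) : S) ∈ g.hom.range) :
    Algebra.Smooth R (PairRing n R ⧸ transporterIdeal (diag n R)
      (repCoset (awayUnit π) b c d) (repCoset (awayUnit π) b' c' d')) := by
  have : Algebra.Smooth (GLRing n R) (Localization.Away (algebraMap R (GLRing n R) π)) :=
    Algebra.Smooth.of_isLocalization_Away (algebraMap R (GLRing n R) π)
  have := Algebra.Smooth.comp R (GLRing n R) (Localization.Away (algebraMap R (GLRing n R) π))
  exact smooth_of_inverse_mem_range_aux b b' c d c' d' h
    (Q := Localization.Away (algebraMap R (GLRing n R) π))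

lemma fst_mem_range {S : Type u} [CommRing S] [Algebra R S] (g : Points R (PairRing n R) S)
    (i j) : g.fst.1 i j ∈ g.hom.range :=
  ⟨(gen (n + 1) R).1 i j ⊗ₜ 1, rfl⟩

lemma fst_inv_mem_range {S : Type u} [CommRing S] [Algebra R S] (g : Points R (PairRing n R) S)
    (i j) : (g.fst⁻¹).1 i j ∈ g.hom.range := by
  rw [fst, toGL, ← map_inv]
  exact ⟨(gen (n + 1) R)⁻¹.1 i j ⊗ₜ 1, rfl⟩

lemma snd_mem_range {S : Type u} [CommRing S] [Algebra R S] (g : Points R (PairRing n R) S)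
    (i j) : g.snd.1 i j ∈ g.hom.range :=
  ⟨1 ⊗ₜ (gen n R).1 i j, rfl⟩

/-- The corner of g₁ is ϖ^(b'-b) and that of g₁⁻¹ is its inverse, so one of them is a negative power
of ϖ. -/
lemma smooth_of_ne (b b' : ℤ) (c d c' d' : Fin n → ℤ) (hb : b ≠ b') :
    Algebra.Smooth R (PairRing n R ⧸ transporterIdeal (diag n R)
      (repCoset (awayUnit π) b c d) (repCoset (awayUnit π) b' c' d')) := by
  refine smooth_of_inverse_mem_range b b' c d c' d' fun S _ _ ϖ g hϖ hg => ?_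
  obtain ⟨p, w, k, hgb, h1, -, -⟩ := (mul_repGL_eq_iff _ _ _ _ _ _ _ _ _).1 hg
  have hπ : (ϖ : S) ∈ g.hom.range := hϖ ▸ g.hom.range.algebraMap_mem π
  have hp : p = ((ϖ ^ (b' - b) : Sˣ) : S) := by
    rw [_root_.zpow_sub, Units.val_mul, ← h1, mul_assoc, Units.mul_inv, mul_one]
  have hp1 : p ∈ g.hom.range := by
    have := fst_mem_range g 0 0
    rwa [hgb] at this
  have hp2 : ((ϖ ^ (b - b') : Sˣ) : S) ∈ g.hom.range := by
    have h2 := fst_inv_mem_range g 0 0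
    have h3 : (g.fst.1 * (g.fst⁻¹).1) 0 0 = 1 := by
      rw [← Units.val_mul, mul_inv_cancel, Units.val_one, one_apply_eq]
    rw [hgb, Matrix.mul_apply, Fin.sum_univ_succ] at h3
    simp only [block_zero_zero, block_zero_succ, Pi.zero_apply, zero_mul, Finset.sum_const_zero,
      add_zero] at h3
    rw [← neg_sub, _root_.zpow_neg]
    rw [hp] at h3
    rwa [← Units.inv_eq_of_mul_eq_one_right h3] at h2
  have key (m : ℤ) (hm : 0 < m) (h : ((ϖ ^ (-m) : Sˣ) : S) ∈ g.hom.range) :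
      ((ϖ⁻¹ : Sˣ) : S) ∈ g.hom.range := by
    -- Multiplying ϖ^(-m) by ϖ^(m-1) leaves exactly ϖ⁻¹.
    obtain ⟨l, rfl⟩ : ∃ l : ℕ, m = l + 1 := ⟨(m - 1).toNat, by omega⟩
    have h4 := mul_mem (pow_mem hπ l) h
    rwa [← Units.val_pow_eq_pow_val, ← Units.val_mul, ← zpow_natCast, ← _root_.zpow_add,
      show (l : ℤ) + -(l + 1) = -1 by ring, _root_.zpow_neg_one] at h4
  rcases lt_or_gt_of_ne hb with h | h
  · exact key (b' - b) (by omega) (by rwa [neg_sub])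
  · exact key (b - b') (by omega) (by rwa [neg_sub, ← hp])

/-- Multiply row i of the column equation by ϖ^(-c'_i - 1): the right side becomes ϖ⁻¹, while the
inequalities make each term on the left a function on G. -/
lemma smooth_of_lt (b : ℤ) (c d c' d' : Fin n → ℤ) (i : Fin n) (hi : c' i < b)
    (hlt : ∀ j, b - c j - max (c' i + d' i - (c j + d j)) 0 < b - c' i) :
    Algebra.Smooth R (PairRing n R ⧸ transporterIdeal (diag n R)
      (repCoset (awayUnit π) b c d) (repCoset (awayUnit π) b c' d')) := by
  refine smooth_of_inverse_mem_range b b c d c' d' fun S _ _ ϖ g hϖ hg => ?_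
  obtain ⟨p, w, k, hgb, -, h2, h3⟩ := (mul_repGL_eq_iff _ _ _ _ _ _ _ _ _).1 hg
  have hπ : (ϖ : S) ∈ g.hom.range := hϖ ▸ g.hom.range.algebraMap_mem π
  have hpow {m : ℤ} (hm : 0 ≤ m) : ((ϖ ^ m : Sˣ) : S) ∈ g.hom.range := by
    obtain ⟨l, rfl⟩ := Int.eq_ofNat_of_zero_le hm
    rw [zpow_natCast, Units.val_pow_eq_pow_val]
    exact pow_mem hπ l
  have hw : w i ∈ g.hom.range := by
    have := fst_mem_range g i.succ 0
    rwa [hgb] at this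
  have hk (j) : k i j * ((ϖ ^ (c j - c' i - 1) : Sˣ) : S) ∈ g.hom.range := by
    have := hlt j
    -- Of k_ij and h_ij, one is a nonnegative power of ϖ times the other; the term is written
    -- through the other one, so that the remaining exponent is nonnegative.
    rcases le_total (c' i + d' i - (c j + d j)) 0 with h0 | h0
    · rw [max_eq_right h0] at this
      refine mul_mem ?_ (hpow (by omega))
      have := fst_mem_range g i.succ j.succ
      rwa [hgb] at this
    · rw [max_eq_left h0] at this
      have h4 : k i j * ((ϖ ^ (c j - c' i - 1) : Sˣ) : S) =
          ((ϖ ^ (d' i - d j - 1) : Sˣ) : S) * g.snd.1 i j := by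
        have h5 : c j - c' i - 1 = (c j + d j) + (-c' i - d j - 1) := by ring
        rw [h5, _root_.zpow_add, Units.val_mul, ← mul_assoc, h3, mul_right_comm, ← Units.val_mul,
          ← _root_.zpow_add]
        congr 3
        ring_nf
      rw [h4]
      exact mul_mem (hpow (by omega)) (snd_mem_range g i j)
  have h4 : ((ϖ⁻¹ : Sˣ) : S) = w i * ((ϖ ^ (b - c' i - 1) : Sˣ) : S) +
      ∑ j, k i j * ((ϖ ^ (c j - c' i - 1) : Sˣ) : S) := by
    have h5 (m : ℤ) : ((ϖ ^ (m - c' i - 1) : Sˣ) : S) =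
        ((ϖ ^ m : Sˣ) : S) * ((ϖ ^ (-c' i - 1) : Sˣ) : S) := by
      rw [← Units.val_mul, ← _root_.zpow_add]
      congr 2
      ring
    simp only [h5, ← mul_assoc]
    rw [← Finset.sum_mul, ← add_mul, h2, ← Units.val_mul, ← _root_.zpow_add,
      show c' i + (-c' i - 1) = -1 by ring, _root_.zpow_neg_one]
  rw [h4]
  exact add_mem (mul_mem hw (hpow (by omega))) (sum_mem fun j _ => hk j)

end Invertible

end Transporter

section Transporter
open Matrix GLRing Points

variable {n : ℕ} {R : Type u} [CommRing R] {π : R}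

/-! ### The case where the closure is an open subscheme of an affine space -/

section Coordinates

lemma det_fst_inv_mem_range {S : Type u} [CommRing S] [Algebra R S]
    (g : Points R (PairRing n R) S) :
    (((GeneralLinearGroup.det g.fst)⁻¹ : Sˣ) : S) ∈ g.hom.range := by
  refine ⟨((GeneralLinearGroup.det (gen (n + 1) R))⁻¹ : (GLRing (n + 1) R)ˣ).1 ⊗ₜ 1, ?_⟩
  rw [fst, toGL, GeneralLinearGroup.map_det, ← map_inv]
  rfl

lemma det_snd_inv_mem_range {S : Type u} [CommRing S] [Algebra R S]
    (g : Points R (PairRing n R) S) :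
    (((GeneralLinearGroup.det g.snd)⁻¹ : Sˣ) : S) ∈ g.hom.range := by
  refine ⟨1 ⊗ₜ ((GeneralLinearGroup.det (gen n R))⁻¹ : (GLRing n R)ˣ).1, ?_⟩
  rw [snd, toGL, GeneralLinearGroup.map_det, ← map_inv]
  rfl

/-- The equations between `h`, `k` and `w` that describe the transporter if the first entries
agree. -/
structure TransporterEquations {S : Type u} [CommRing S] (ϖ : Sˣ) (b : ℤ) (c d c' d' : Fin n → ℤ)
    (h k : Matrix (Fin n) (Fin n) S) (w : Fin n → S) : Prop where
  column : ∀ i, w i * ((ϖ ^ b : Sˣ) : S) + ∑ j, k i j * ((ϖ ^ c j : Sˣ) : S) =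
    ((ϖ ^ c' i : Sˣ) : S)
  entry : ∀ i j, k i j * ((ϖ ^ (c j + d j) : Sˣ) : S) =
    ((ϖ ^ (c' i + d' i) : Sˣ) : S) * h i j

/-- If the solutions h, k, w are parametrized universally by P and generate it, the closure is the
locus Q in Spec P where det h · det k is invertible. The transporter is Q with π inverted, and Q
embeds into it because π is a nonzerodivisor. -/
lemma smooth_of_coordinates_aux (b : ℤ) (c d c' d' : Fin n → ℤ)
    {P : Type u} [CommRing P] [Algebra R P] (hπ : algebraMap R P π ∈ nonZeroDivisors P)
    (h k : Matrix (Fin n) (Fin n) P) (w : Fin n → P)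
    (heq : ∀ (S : Type u) [CommRing S] [Algebra R S] (ϖ : Sˣ) (ψ : P →ₐ[R] S),
      algebraMap R S π = ϖ →
      TransporterEquations ϖ b c d c' d' (h.map ψ) (k.map ψ) (fun i => ψ (w i)))
    (huniv : ∀ (S : Type u) [CommRing S] [Algebra R S] (ϖ : Sˣ) (h' k' : Matrix (Fin n) (Fin n) S)
      (w' : Fin n → S), algebraMap R S π = ϖ → TransporterEquations ϖ b c d c' d' h' k' w' →
      ∃ ψ : P →ₐ[R] S, h.map ψ = h' ∧ k.map ψ = k' ∧ ∀ i, ψ (w i) = w' i)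
    (hgen : ∀ T : Subalgebra R P, (∀ i j, h i j ∈ T) → (∀ i j, k i j ∈ T) → (∀ i, w i ∈ T) →
      T = ⊤)
    {Q : Type u} [CommRing Q] [Algebra R Q] [Algebra P Q] [IsScalarTower R P Q]
    [IsLocalization.Away (det h * det k) Q] [Algebra.Smooth R Q]
    {Q' : Type u} [CommRing Q'] [Algebra R Q'] [Algebra Q Q'] [IsScalarTower R Q Q']
    [IsLocalization.Away (algebraMap R Q π) Q'] :
    Algebra.Smooth R (PairRing n R ⧸ transporterIdeal (diag n R)
      (repCoset (awayUnit π) b c d) (repCoset (awayUnit π) b c' d')) := by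
  obtain ⟨α, hα⟩ : ∃ α : P →ₐ[R] Q, ∀ a, α a = algebraMap _ Q a :=
    ⟨IsScalarTower.toAlgHom R _ _, fun _ => rfl⟩
  obtain ⟨i, hi⟩ : ∃ i : Q →ₐ[R] Q', ∀ a, i a = algebraMap _ Q' a :=
    ⟨IsScalarTower.toAlgHom R _ _, fun _ => rfl⟩
  have hdet (M : Matrix (Fin n) (Fin n) P) {S : Type u} [CommRing S] [Algebra R S]
      (ψ : P →ₐ[R] S) : ψ (det M) = det (M.map ψ) := AlgHom.map_det ψ M
  have hδ : IsUnit (det (h.map α) * det (k.map α)) := by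
    rw [← hdet, ← hdet, ← map_mul, hα]
    exact IsLocalization.Away.algebraMap_isUnit _
  have hk : IsUnit (det (block 1 0 (fun i => α (w i)) (k.map α))) := by
    rw [det_block_zero, one_mul]
    exact isUnit_of_mul_isUnit_right hδ
  obtain ⟨q, hq1, hq2⟩ : ∃ q : Points R (PairRing n R) Q,
      q.fst.1 = block 1 0 (fun i => α (w i)) (k.map α) ∧ q.snd.1 = h.map α := by
    refine ⟨pair (GeneralLinearGroup.mk'' _ hk)
      (GeneralLinearGroup.mk'' _ (isUnit_of_mul_isUnit_left hδ)), ?_, ?_⟩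
    · rw [fst_pair]; rfl
    · rw [snd_pair]; rfl
  have hunit : IsUnit (algebraMap R Q' π) := by
    have := IsLocalization.Away.algebraMap_isUnit (S := Q') (algebraMap R Q π)
    rwa [← IsScalarTower.algebraMap_apply] at this
  obtain ⟨j⟩ : Nonempty (Localization.Away π →ₐ[R] Q') := ⟨awayHom hunit⟩
  refine smooth_quotient_transporterIdeal (diag n R) _ _ q.hom ?_ i ?_ j ?_ ?_
  · have hT : q.hom.range.comap α = ⊤ := by
      refine hgen _ (fun i j => ?_) (fun i j => ?_) (fun i => ?_)
      · have := snd_mem_range q i j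
        rwa [hq2] at this
      · have := fst_mem_range q i.succ j.succ
        rwa [hq1] at this
      · have := fst_mem_range q i.succ 0
        rwa [hq1] at this
    have hmem (a : P) : algebraMap P Q a ∈ q.hom.range := by
      rw [← hα]
      exact (hT ▸ Algebra.mem_top : a ∈ q.hom.range.comap α)
    intro x
    change x ∈ q.hom.range
    obtain ⟨m, a, hm⟩ := IsLocalization.Away.surj (det h * det k) x
    -- The inverse determinants of the two group components provide the denominators of Q.
    have hinv : algebraMap P Q (det h * det k) *
        ((((GeneralLinearGroup.det q.snd)⁻¹ : Qˣ) : Q) *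
          (((GeneralLinearGroup.det q.fst)⁻¹ : Qˣ) : Q)) = 1 := by
      have e1 : ((GeneralLinearGroup.det q.snd : Qˣ) : Q) = det (h.map α) := by
        rw [← hq2]; rfl
      have e2 : ((GeneralLinearGroup.det q.fst : Qˣ) : Q) = det (k.map α) := by
        change det q.fst.1 = _
        rw [hq1, det_block_zero, one_mul]
      rw [← hα, map_mul, hdet, hdet, ← e1, ← e2, mul_mul_mul_comm, Units.mul_inv, Units.mul_inv,
        one_mul]
    have hx : x = algebraMap P Q a * ((((GeneralLinearGroup.det q.snd)⁻¹ : Qˣ) : Q) *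
        (((GeneralLinearGroup.det q.fst)⁻¹ : Qˣ) : Q)) ^ m := by
      rw [← hm, mul_assoc, ← mul_pow, hinv, one_pow, mul_one]
    rw [hx]
    exact mul_mem (hmem a) (pow_mem (mul_mem (det_snd_inv_mem_range q)
      (det_fst_inv_mem_range q)) m)
  · have hinj : Function.Injective (algebraMap Q Q') := by
      refine IsLocalization.injective (M := Submonoid.powers (algebraMap R Q π)) Q' ?_
      rw [Submonoid.powers_le, IsScalarTower.algebraMap_apply R P Q]
      exact IsLocalization.map_nonZeroDivisors_le (Submonoid.powers (det h * det k)) Q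
        (Submonoid.mem_map_of_mem _ hπ)
    intro x y hxy
    rw [hi, hi] at hxy
    exact hinj hxy
  · have hϖ := (val_map_awayUnit j).symm
    have hE := heq _ _ (i.comp α) hϖ
    have : Points.of (i.comp q.hom) = Points.map i q := rfl
    rw [this, map_repCoset, map_repCoset, smul_repCoset_eq_iff, mul_repGL_eq_iff]
    refine ⟨1, fun l => i (α (w l)), k.map (i.comp α), ?_, one_mul _, hE.column, fun a b => ?_⟩
    · change q.fst.1.map (i : Q →+* Q') = _
      rw [hq1, map_block]
      congr 1
      · exact map_one i
      · exact funext fun _ => map_zero i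
    · rw [hE.entry, snd_map]
      change _ = _ * i (q.snd.1 a b)
      rw [hq2]
      rfl
  · intro S _ _ j' g hg
    rw [map_repCoset, map_repCoset, smul_repCoset_eq_iff, mul_repGL_eq_iff] at hg
    obtain ⟨p, w', k', hgb, hp, hw, hk'⟩ := hg
    obtain rfl : p = 1 := by
      rwa [← Units.eq_mul_inv_iff_mul_eq, Units.mul_inv] at hp
    obtain ⟨ψ, hψh, hψk, hψw⟩ := huniv S _ g.snd.1 k' w' (val_map_awayUnit j').symm ⟨hw, hk'⟩
    have hu : IsUnit (ψ (det h * det k)) := by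
      rw [map_mul, hdet, hdet, hψh, hψk, ← one_mul (det k'), ← det_block_zero 1 w' k', ← hgb]
      exact (Units.isUnit (GeneralLinearGroup.det g.snd)).mul
        (Units.isUnit (GeneralLinearGroup.det g.fst))
    obtain ⟨e, he⟩ : ∃ e : Q →ₐ[R] S, ∀ a, e (α a) = ψ a := by
      refine ⟨IsLocalization.Away.liftAlgHom (f := ψ) _ hu, fun a => ?_⟩
      rw [hα]
      exact IsLocalization.Away.lift_eq _ hu a
    refine ⟨e, congrArg hom (pair_ext (h := Points.map e q) ?_ ?_)⟩
    · rw [fst_map]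
      refine Units.ext ?_
      change _ = q.fst.1.map (e : Q →+* S)
      rw [hq1, map_block, hgb, ← hψk]
      congr 1
      · exact (map_one e).symm
      · exact funext fun _ => (map_zero e).symm
      · exact funext fun l => ((he _).trans (hψw l)).symm
      · ext a b
        exact (he _).symm
    · rw [snd_map]
      refine Units.ext ?_
      change _ = q.snd.1.map (e : Q →+* S)
      rw [hq2, ← hψh]
      ext a b
      exact (he _).symm

lemma smooth_of_coordinates (b : ℤ) (c d c' d' : Fin n → ℤ)
    {P : Type u} [CommRing P] [Algebra R P] [Algebra.Smooth R P]
    (hπ : algebraMap R P π ∈ nonZeroDivisors P)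
    (h k : Matrix (Fin n) (Fin n) P) (w : Fin n → P)
    (heq : ∀ (S : Type u) [CommRing S] [Algebra R S] (ϖ : Sˣ) (ψ : P →ₐ[R] S),
      algebraMap R S π = ϖ →
      TransporterEquations ϖ b c d c' d' (h.map ψ) (k.map ψ) (fun i => ψ (w i)))
    (huniv : ∀ (S : Type u) [CommRing S] [Algebra R S] (ϖ : Sˣ) (h' k' : Matrix (Fin n) (Fin n) S)
      (w' : Fin n → S), algebraMap R S π = ϖ → TransporterEquations ϖ b c d c' d' h' k' w' →
      ∃ ψ : P →ₐ[R] S, h.map ψ = h' ∧ k.map ψ = k' ∧ ∀ i, ψ (w i) = w' i)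
    (hgen : ∀ T : Subalgebra R P, (∀ i j, h i j ∈ T) → (∀ i j, k i j ∈ T) → (∀ i, w i ∈ T) →
      T = ⊤) :
    Algebra.Smooth R (PairRing n R ⧸ transporterIdeal (diag n R)
      (repCoset (awayUnit π) b c d) (repCoset (awayUnit π) b c' d')) := by
  have : Algebra.Smooth P (Localization.Away (det h * det k)) :=
    Algebra.Smooth.of_isLocalization_Away (det h * det k)
  have := Algebra.Smooth.comp R P (Localization.Away (det h * det k))
  exact smooth_of_coordinates_aux b c d c' d' hπ h k w heq huniv hgen
    (Q := Localization.Away (det h * det k))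
    (Q' := Localization.Away (algebraMap R (Localization.Away (det h * det k)) π))

end Coordinates

/-! ### Solving one row of the transporter equations -/

section Rows
open MvPolynomial

/-- The solutions of an equation `w = ϖ^(-e) - ∑ ϖ^(-f j) z j` can be parametrized linearly. -/
lemma exists_linear_parametrization (π : R) {e : ℤ} (he : 0 ≤ e) (f : Fin n → ℤ)
    (h : ¬(0 < e ∧ ∀ j, f j < e)) :
    ∃ (Z : Fin n → MvPolynomial (Fin n) R) (W : MvPolynomial (Fin n) R),
      (∀ (S : Type u) [CommRing S] [Algebra R S] (ϖ : Sˣ) (ζ : Fin n → S), algebraMap R S π = ϖ →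
        aeval ζ W = ((ϖ ^ (-e) : Sˣ) : S) - ∑ j, ((ϖ ^ (-f j) : Sˣ) : S) * aeval ζ (Z j)) ∧
      (∀ (S : Type u) [CommRing S] [Algebra R S] (ϖ : Sˣ) (z : Fin n → S) (w : S),
        algebraMap R S π = ϖ →
        w = ((ϖ ^ (-e) : Sˣ) : S) - ∑ j, ((ϖ ^ (-f j) : Sˣ) : S) * z j →
        ∃ ζ : Fin n → S, (∀ j, aeval ζ (Z j) = z j) ∧ aeval ζ W = w) ∧
      ∀ j, X j = W ∨ ∃ l, X j = Z l := by
  have hcoe (S : Type u) [CommRing S] [Algebra R S] (ϖ : Sˣ) (ζ : Fin n → S)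
      (hϖ : algebraMap R S π = ϖ) {m : ℤ} (hm : 0 ≤ m) :
      aeval ζ (C (π ^ m.toNat)) = ((ϖ ^ m : Sˣ) : S) := by
    rw [← algebraMap_eq, AlgHom.commutes, coe_toNat_pow hϖ, max_eq_left hm]
  -- If some f_j is at least e, multiplying the equation by ϖ^(f j₀), with f j₀ maximal, makes all
  -- coefficients integral and gives z_{j₀} coefficient 1; so z_{j₀} is eliminated and its variable
  -- is reused for w. Otherwise the hypothesis forces e = 0 and all f_j < 0, and w is itself a
  -- polynomial in z.
  by_cases hj : ∃ j, e ≤ f j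
  · obtain ⟨j₁, hj₁⟩ := hj
    have : Nonempty (Fin n) := ⟨j₁⟩
    obtain ⟨j₀, hj₀⟩ := Finite.exists_max f
    have hF : e ≤ f j₀ := hj₁.trans (hj₀ j₁)
    obtain ⟨Z₀, hZ₀d⟩ : ∃ Z₀ : MvPolynomial (Fin n) R, Z₀ = C (π ^ (f j₀ - e).toNat) -
      ∑ l ∈ Finset.univ.erase j₀, C (π ^ (f j₀ - f l).toNat) * X l -
        C (π ^ (f j₀).toNat) * X j₀ := ⟨_, rfl⟩
    have hZ₀ (S : Type u) [CommRing S] [Algebra R S] (ϖ : Sˣ) (ζ : Fin n → S)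
        (hϖ : algebraMap R S π = ϖ) :
        aeval ζ Z₀ = ((ϖ ^ (f j₀ - e) : Sˣ) : S) -
          ∑ l ∈ Finset.univ.erase j₀, ((ϖ ^ (f j₀ - f l) : Sˣ) : S) * ζ l -
          ((ϖ ^ f j₀ : Sˣ) : S) * ζ j₀ := by
      rw [hZ₀d, map_sub, map_sub, map_sum, map_mul, hcoe S ϖ ζ hϖ (by omega),
        hcoe S ϖ ζ hϖ (by omega), aeval_X]
      congr 2
      refine Finset.sum_congr rfl fun l _ => ?_
      rw [map_mul, hcoe S ϖ ζ hϖ (by have := hj₀ l; omega), aeval_X]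
    have hmul {S : Type u} [CommRing S] (ϖ : Sˣ) (a b : ℤ) :
        ((ϖ ^ (a - b) : Sˣ) : S) = ((ϖ ^ a : Sˣ) : S) * ((ϖ ^ (-b) : Sˣ) : S) := by
      rw [← Units.val_mul, ← _root_.zpow_add, sub_eq_add_neg]
    have hinv {S : Type u} [CommRing S] (ϖ : Sˣ) (a : ℤ) :
        ((ϖ ^ (-a) : Sˣ) : S) * ((ϖ ^ a : Sˣ) : S) = 1 := by
      rw [← Units.val_mul, ← _root_.zpow_add, neg_add_cancel, zpow_zero, Units.val_one]
    refine ⟨Function.update X j₀ Z₀, X j₀, fun S _ _ ϖ ζ hϖ => ?_, fun S _ _ ϖ z w hϖ hw => ?_,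
      fun j => ?_⟩
    · rw [← Finset.add_sum_erase _ _ (Finset.mem_univ j₀), Function.update_self, hZ₀ S ϖ ζ hϖ]
      have : ∑ l ∈ Finset.univ.erase j₀,
          ((ϖ ^ (-f l) : Sˣ) : S) * aeval ζ (Function.update X j₀ Z₀ l) =
          ∑ l ∈ Finset.univ.erase j₀, ((ϖ ^ (-f l) : Sˣ) : S) * ζ l := by
        refine Finset.sum_congr rfl fun l hl => ?_
        rw [Function.update_of_ne (Finset.ne_of_mem_erase hl), aeval_X]
      rw [this]
      simp only [hmul, mul_assoc]
      rw [← Finset.mul_sum, aeval_X]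
      linear_combination (((ϖ ^ (-e) : Sˣ) : S) - ζ j₀ -
        ∑ l ∈ Finset.univ.erase j₀, ((ϖ ^ (-f l) : Sˣ) : S) * ζ l) * hinv ϖ (f j₀)
    · refine ⟨Function.update z j₀ w, fun j => ?_, by rw [aeval_X, Function.update_self]⟩
      by_cases h : j = j₀
      · subst h
        rw [Function.update_self, hZ₀ S ϖ _ hϖ, Function.update_self]
        have : ∑ l ∈ Finset.univ.erase j,
            ((ϖ ^ (f j - f l) : Sˣ) : S) * Function.update z j w l =
            ((ϖ ^ f j : Sˣ) : S) * ∑ l ∈ Finset.univ.erase j, ((ϖ ^ (-f l) : Sˣ) : S) * z l := by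
          rw [Finset.mul_sum]
          refine Finset.sum_congr rfl fun l hl => ?_
          rw [Function.update_of_ne (Finset.ne_of_mem_erase hl), hmul, mul_assoc]
        rw [this, hmul]
        rw [← Finset.add_sum_erase _ _ (Finset.mem_univ j)] at hw
        linear_combination (-((ϖ ^ f j : Sˣ) : S)) * hw + z j * hinv ϖ (f j)
      · rw [Function.update_of_ne h, aeval_X, Function.update_of_ne h]
    · by_cases h : j = j₀
      · exact Or.inl (by rw [h])
      · exact Or.inr ⟨j, by rw [Function.update_of_ne h]⟩
  · push Not at hj
    obtain rfl : e = 0 := by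
      by_contra h0
      exact h ⟨by omega, hj⟩
    have hW (S : Type u) [CommRing S] [Algebra R S] (ϖ : Sˣ) (ζ : Fin n → S)
        (hϖ : algebraMap R S π = ϖ) :
        aeval ζ (1 - ∑ l, C (π ^ (-f l).toNat) * X l : MvPolynomial (Fin n) R) =
          ((ϖ ^ (-0 : ℤ) : Sˣ) : S) - ∑ l, ((ϖ ^ (-f l) : Sˣ) : S) * ζ l := by
      rw [map_sub, map_one, map_sum, neg_zero, zpow_zero, Units.val_one]
      congr 1
      refine Finset.sum_congr rfl fun l _ => ?_
      rw [map_mul, hcoe S ϖ ζ hϖ (by have := hj l; omega), aeval_X]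
    refine ⟨X, 1 - ∑ l, C (π ^ (-f l).toNat) * X l, fun S _ _ ϖ ζ hϖ => ?_,
      fun S _ _ ϖ z w hϖ hw => ⟨z, fun j => aeval_X _ _, ?_⟩, fun j => Or.inr ⟨j, rfl⟩⟩
    · simp only [hW S ϖ ζ hϖ, aeval_X]
    · rw [hW S ϖ z hϖ, hw]

end Rows

end Transporter

section Transporter
open Matrix GLRing Points

variable {n : ℕ} {R : Type u} [CommRing R] {π : R}

section Rows
open MvPolynomial

/-- With a = c + d and a' = c' + d', put k_ij = ϖ^max(a'_i - a_j, 0) z_ij and h_ij = ϖ^max(a_j -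
a'_i, 0) z_ij; this solves the entry equations. The column equations involve one row each and are
parametrized by `exists_linear_parametrization`, so P is a polynomial ring in n² variables. -/
lemma smooth_of_forall_not_lt [IsDomain R] (hπ : π ≠ 0) (b : ℤ) (c d c' d' : Fin n → ℤ)
    (hc' : ∀ i, c' i ≤ b)
    (hrow : ∀ i, ¬(c' i < b ∧
      ∀ j, b - c j - max (c' i + d' i - (c j + d j)) 0 < b - c' i)) :
    Algebra.Smooth R (PairRing n R ⧸ transporterIdeal (diag n R)
      (repCoset (awayUnit π) b c d) (repCoset (awayUnit π) b c' d')) := by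
  choose Z W hW hlift hX using fun i => exists_linear_parametrization (R := R) π
    (sub_nonneg.2 (hc' i)) (fun j => b - c j - max (c' i + d' i - (c j + d j)) 0)
    (by simpa only [sub_pos] using hrow i)
  have hcoe {S : Type u} [CommRing S] [Algebra R S] {ϖ : Sˣ} (hϖ : algebraMap R S π = ϖ)
      (ψ : MvPolynomial (Fin n × Fin n) R →ₐ[R] S) (m : ℤ) :
      ψ (C (π ^ m.toNat)) = ((ϖ ^ max m 0 : Sˣ) : S) := by
    rw [← algebraMap_eq, AlgHom.commutes, coe_toNat_pow hϖ]
  have hren {S : Type u} [CommRing S] [Algebra R S]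
      (ψ : MvPolynomial (Fin n × Fin n) R →ₐ[R] S) (i : Fin n) (p : MvPolynomial (Fin n) R) :
      ψ (rename (Prod.mk i) p) = aeval (fun j => ψ (X (i, j))) p := by
    have : ψ.comp (rename (Prod.mk i)) = aeval (fun j => ψ (X (i, j))) := by
      ext j
      simp
    exact DFunLike.congr_fun this p
  have hmul {S : Type u} [CommRing S] (ϖ : Sˣ) (a b : ℤ) :
      ((ϖ ^ a : Sˣ) : S) * ((ϖ ^ b : Sˣ) : S) = ((ϖ ^ (a + b) : Sˣ) : S) := by
    rw [← Units.val_mul, ← _root_.zpow_add]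
  have : Algebra.Smooth R (MvPolynomial (Fin n × Fin n) R) := {}
  refine smooth_of_coordinates b c d c' d' (P := MvPolynomial (Fin n × Fin n) R) ?_
    (Matrix.of fun i j =>
      C (π ^ (c j + d j - (c' i + d' i)).toNat) * rename (Prod.mk i) (Z i j))
    (Matrix.of fun i j =>
      C (π ^ (c' i + d' i - (c j + d j)).toNat) * rename (Prod.mk i) (Z i j))
    (fun i => rename (Prod.mk i) (W i)) ?_ ?_ ?_
  · rw [mem_nonZeroDivisors_iff_ne_zero, algebraMap_eq, Ne, C_eq_zero]
    exact hπ
  · intro S _ _ ϖ ψ hϖ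
    refine ⟨fun i => ?_, fun i j => ?_⟩
    · rw [hren, hW i S ϖ _ hϖ, sub_mul, hmul, Finset.sum_mul, neg_sub, sub_add_cancel,
        sub_add, sub_eq_self, sub_eq_zero]
      refine Finset.sum_congr rfl fun j _ => ?_
      rw [map_apply, of_apply, map_mul, hcoe hϖ, hren, mul_right_comm, hmul, mul_right_comm, hmul]
      congr 3
      ring
    · rw [map_apply, map_apply, of_apply, of_apply, map_mul, map_mul, hcoe hϖ, hcoe hϖ,
        mul_right_comm, ← mul_assoc, hmul, hmul]
      congr 3
      omega
  · intro S _ _ ϖ h' k' w' hϖ hE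
    have hz (i) : w' i = ((ϖ ^ (-(b - c' i)) : Sˣ) : S) -
        ∑ j, ((ϖ ^ (-(b - c j - max (c' i + d' i - (c j + d j)) 0)) : Sˣ) : S) *
          (((ϖ ^ (-max (c' i + d' i - (c j + d j)) 0) : Sˣ) : S) * k' i j) := by
      have h1 : ((ϖ ^ b : Sˣ) : S) * ((ϖ ^ (-b) : Sˣ) : S) = 1 := by
        rw [hmul, add_neg_cancel, zpow_zero, Units.val_one]
      have h2 : ((ϖ ^ (-(b - c' i)) : Sˣ) : S) =
          ((ϖ ^ c' i : Sˣ) : S) * ((ϖ ^ (-b) : Sˣ) : S) := by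
        rw [hmul]; congr 2; ring
      have h3 : ∑ j, ((ϖ ^ (-(b - c j - max (c' i + d' i - (c j + d j)) 0)) : Sˣ) : S) *
          (((ϖ ^ (-max (c' i + d' i - (c j + d j)) 0) : Sˣ) : S) * k' i j) =
          (∑ j, k' i j * ((ϖ ^ c j : Sˣ) : S)) * ((ϖ ^ (-b) : Sˣ) : S) := by
        rw [Finset.sum_mul]
        refine Finset.sum_congr rfl fun j _ => ?_
        rw [← mul_assoc, hmul, mul_assoc (k' i j), hmul, mul_comm]
        congr 3
        ring
      rw [h2, h3]
      linear_combination ((ϖ ^ (-b) : Sˣ) : S) * hE.column i - w' i * h1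
    choose ζ hζ1 hζ2 using fun i => hlift i S ϖ _ _ hϖ (hz i)
    refine ⟨aeval fun p => ζ p.1 p.2, ?_, ?_, fun i => ?_⟩
    · ext i j
      rw [map_apply, of_apply, map_mul, hcoe hϖ, hren]
      simp only [aeval_X]
      rw [hζ1, ← mul_assoc, hmul]
      have h1 := hE.entry i j
      have h2 : ((ϖ ^ (-(c' i + d' i)) : Sˣ) : S) * ((ϖ ^ (c' i + d' i) : Sˣ) : S) = 1 := by
        rw [hmul, neg_add_cancel, zpow_zero, Units.val_one]
      have h3 : max (c j + d j - (c' i + d' i)) 0 + -max (c' i + d' i - (c j + d j)) 0 =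
          c j + d j + -(c' i + d' i) := by omega
      rw [h3, ← hmul]
      linear_combination ((ϖ ^ (-(c' i + d' i)) : Sˣ) : S) * h1 + h' i j * h2
    · ext i j
      rw [map_apply, of_apply, map_mul, hcoe hϖ, hren]
      simp only [aeval_X]
      rw [hζ1, ← mul_assoc, hmul, add_neg_cancel, zpow_zero, Units.val_one, one_mul]
    · rw [hren]
      simp only [aeval_X]
      exact hζ2 i
  · intro T hh hk hw
    -- At least one of the two exponents of π is 0, so z_ij is literally an entry of h or of k.
    have hZ (i j) : rename (Prod.mk i) (Z i j) ∈ T := by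
      rcases le_total (c j + d j - (c' i + d' i)) 0 with h0 | h0
      · have := hh i j
        rwa [of_apply, Int.toNat_of_nonpos h0, pow_zero, C_1, one_mul] at this
      · have := hk i j
        rwa [of_apply, Int.toNat_of_nonpos (by omega), pow_zero, C_1, one_mul] at this
    rw [eq_top_iff, ← adjoin_range_X, Algebra.adjoin_le_iff]
    rintro _ ⟨⟨i, j⟩, rfl⟩
    have h1 : (X (i, j) : MvPolynomial (Fin n × Fin n) R) = rename (Prod.mk i) (X j) :=
      (rename_X _ _).symm
    rw [h1]
    rcases hX i j with h | ⟨l, h⟩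
    · rw [h]; exact hw i
    · rw [h]; exact hZ i l

end Rows

lemma smooth_of_mem_piOrbit [IsDomain R] (hπ : π ≠ 0)
    {x y : Cosets (diag n R) (Localization.Away π)}
    (hx : x ∈ piOrbit π (diag n R) (torusHom R n) (dominant n R) {baseCoset n R})
    (hy : y ∈ piOrbit π (diag n R) (torusHom R n) (dominant n R) {baseCoset n R}) :
    Algebra.Smooth R (PairRing n R ⧸ transporterIdeal (diag n R) x y) := by
  obtain ⟨b, c, d, -, -, -, rfl⟩ := (mem_piOrbit_iff π _).1 hx
  obtain ⟨b', c', d', -, hb', -, rfl⟩ := (mem_piOrbit_iff π _).1 hy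
  rcases ne_or_eq b b' with hb | rfl
  · exact smooth_of_ne b b' c d c' d' hb
  by_cases h : ∃ i, c' i < b ∧ ∀ j, b - c j - max (c' i + d' i - (c j + d j)) 0 < b - c' i
  · obtain ⟨i, h1, h2⟩ := h
    exact smooth_of_lt b c d c' d' i h1 h2
  · exact smooth_of_forall_not_lt hπ b c d c' d' hb' (not_exists.1 h)

end Transporter

/-! ### Assembling the four properties -/

section Contraction
open Points

variable {n : ℕ} {R : Type u} [CommRing R] {π : R}

lemma congruenceSubgroup_smul_eq (F : LocalFieldOver R π) {l : ℕ} (hl : 0 < l)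
    {x : Cosets (diag n R) R} (hx : x ∈ ({baseCoset n R} : Set (Cosets (diag n R) R)))
    {m : Cocharacter R (n + 1 + n)} (hm : m ∈ dominant n R) :
    (F.congruenceSubgroup (PairRing n R) l : Set (Points R (PairRing n R) F.K)) •
        (Points.map F.ofAway (piPow π (torusHom R n) m) •
          ((F.congruenceSubgroup (PairRing n R) l : Set (Points R (PairRing n R) F.K)) •
            ({Cosets.map (diag n R) (Algebra.ofId R F.K) x} : Set (Cosets (diag n R) F.K)))) =
      (F.congruenceSubgroup (PairRing n R) l : Set (Points R (PairRing n R) F.K)) •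
        ({Points.map F.ofAway (piPow π (torusHom R n) m) •
          Cosets.map (diag n R) (Algebra.ofId R F.K) x} : Set (Cosets (diag n R) F.K)) := by
  obtain rfl := hx
  obtain ⟨b, c, d, hc, hb, hd, rfl⟩ := hm
  apply subset_antisymm
  · rintro _ ⟨g₁, hg₁, _, ⟨_, ⟨g, hg, _, rfl, rfl⟩, rfl⟩, rfl⟩
    obtain ⟨g', hg', h⟩ := F.exists_smul_comm hl hc hb hd hg
    refine ⟨g₁ * g', mul_mem hg₁ hg', _, rfl, ?_⟩
    beta_reduce
    rw [h, mul_smul]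
  · rintro _ ⟨g, hg, _, rfl, rfl⟩
    exact ⟨g, hg, _, ⟨_, ⟨1, one_mem _, _, rfl, rfl⟩, rfl⟩, by simp only [one_smul]⟩

end Contraction

/-- The pair `(GL_{n+1} × GL_n, Δ GL_n)` is uniform spherical over a domain. -/
lemma isUniformSpherical_diag {R : Type u} [CommRing R] [IsDomain R] {π : R} (hπ : π ≠ 0) (n : ℕ) :
    IsUniformSpherical π (diag n R) :=
  ⟨diag_surjective n R, inferInstance, inferInstance, n + 1 + n, torusHom R n, coordCount n,
    embedding n R, {baseCoset n R}, dominant n R, torusHom_surjective R n,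
    isAffineEmbedding_embedding n R, Set.finite_singleton _,
    fun F z => F.exists_mem_piOrbit z,
    fun _ hx _ hy => smooth_of_mem_piOrbit hπ hx hy,
    fun g hg F F' => val_eq_of_mem_piOrbit g hg F F',
    0, fun _ hl F _ hx _ hm => congruenceSubgroup_smul_eq F hl hx hm⟩

end UniformSpherical

end

theorem mainTheorem6 (R : Type u) [CommRing R] [IsRegularLocalRing R]
    [IsAdicComplete (IsLocalRing.maximalIdeal R) R] (π : R)
    (hπ : π ∈ IsLocalRing.maximalIdeal R) (hπ' : π ∉ IsLocalRing.maximalIdeal R ^ 2) (n : ℕ) :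
    UniformSpherical.IsUniformSpherical π (UniformSpherical.diag n R) := by
  have := UniformSpherical.isDomain_of_isRegularLocalRing R
  have hne : π ≠ 0 := by
    rintro rfl
    exact hπ' (zero_mem _)
  exact UniformSpherical.isUniformSpherical_diag hne n
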